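/- Let $p$ be a prime and let $\mathcal K=\mathbb Q_p(w_n)$, where $w_n$ is a primitive $n$-th root of unity, $n\ge 1$, with valuation ring $\mathcal O$ and residue field $F$. Let $\mathcal H={\rm Gal}(\mathcal K/\mathbb Q_p)$, and take Brauer characters of finite groups with respect to $(\mathcal K,\mathcal O,F)$: they are functions on $p$-regular elements with values in $\mathcal K$. For a group $G$, $a=(\sigma,\phi)\in\mathcal H\times{\rm Aut}(G)$, $J\le G$ and a Brauer character $\chi$ of $J$, put $J^a=\phi(J)$ and let $\chi^a$ be the Brauer character of $J^a$ with $\chi^a(x)=\sigma(\chi(\phi^{-1}(x)))$; write $a_\sigma=\sigma$, $a_\phi=\phi$. For a subgroup $Z$ of $G$, ${\rm Aut}(G)_Z$ is the group of automorphisms $\phi$ of $G$ with $\phi(Z)=Z$. A Brauer character in ${\rm IBr}(Z)$ has defect zero if it is the restriction to the $p$-regular elements of an ordinary irreducible character $\chi$ of $Z$ with $\chi(1)_p=|Z|_p$. For $\lambda\in{\rm IBr}(Z)$, $\mathbb F_p(\lambda)\subseteq F$ is the subfield generated by the images in $F$ of the values of $\lambda$. For $Z\unlhd J$, ${\rm IBr}(J\,|\,\lambda)$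 is the set of irreducible Brauer characters of $J$ lying over $\lambda$. **Theorem.** Let $Z$ be a normal subgroup of a finite group $G$, let $\lambda\in{\rm IBr}(Z)$ be of defect zero, and assume that $n$ is divisible by the exponent of $G$ and by $\exp(G/Z)\cdot|\mathbb F_p(\lambda)^\times|$. Let ${\rm Inn}(G)\le\Phi\le\mathcal H\times{\rm Aut}(G)_Z$ and assume that $\lambda$ is $\Phi$-invariant. Then there exist a finite group $G_1$ with a central cyclic $p'$-subgroup $Z_1$, a faithful linear character $\lambda_1\in{\rm IBr}(Z_1)$, and a group homomorphism $\omega:\Phi\to\mathcal H\times{\rm Aut}(G_1)_{Z_1}$ such that $\lambda_1$ is $\omega(\Phi)$-invariant and the following hold. 1. There is a group isomorphism $\epsilon:G/Z\to G_1/Z_1$, and $|Z_1|=|\mathbb F_p(\lambda)^\times|$. 2. $\omega({\rm Inn}(G))={\rm Inn}(G_1)$, and for every $a\in\Phi$: (a) $\omega(a)_\sigma=a_\sigma$; (b) the automorphisms of $G/Z$ and of $G_1/Z_1$ induced by $a_\phi$ and $\omega(a)_\phi$ correspond to each other under $\epsilon$. 3. For each subgroup $J$ with $Z\le J\le G$,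 let $J_1$ be the subgroup with $Z_1\le J_1\le G_1$ and $J_1/Z_1=\epsilon(J/Z)$. For each such $J$ there is a bijection $\nu_J:{\rm IBr}(J\,|\,\lambda)\to{\rm IBr}(J_1\,|\,\lambda_1)$ such that, for all such $J$ and all $\varphi\in{\rm IBr}(J\,|\,\lambda)$: (a) for all $a\in\Phi$, $\varphi^a\in{\rm IBr}(J^a\,|\,\lambda)$ and $\nu_J(\varphi)^{\omega(a)}=\nu_{J^a}(\varphi^a)$; (b) for all $H$ with $Z\le H\le J$, the restriction $\varphi_H$ is a $\mathbb Z$-linear combination of ${\rm IBr}(H\,|\,\lambda)$ and $\nu_J(\varphi)_{H_1}=\nu_H(\varphi_H)$, where $\nu_H$ is extended $\mathbb Z$-linearly to the $\mathbb Z$-span of ${\rm IBr}(H\,|\,\lambda)$; (c) if $Y$ is a vertex of $\varphi$, then there is a vertex $Y_1$ of $\nu_J(\varphi)$ with $Y_1Z_1/Z_1=\epsilon(YZ/Z)$. -/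

import Mathlib

namespace ModRep

universe u v

section CoefficientRings

variable (p : ℕ) [Fact p.Prime]
variable (K : Type v) [Field K] [Algebra ℚ_[p] K] [Algebra.IsAlgebraic ℚ_[p] K]

/-- The valuation ring `𝒪` of an algebraic extension `K` of `ℚ_p`: the elements of absolute value
at most one, for the unique extension of the `p`-adic absolute value to `K`
(which is the spectral norm). -/
noncomputable def integers : ValuationSubring K where
  carrier := {x | spectralNorm ℚ_[p] K x ≤ 1}
  mul_mem' {x y} hx hy := by
    have h : spectralNorm ℚ_[p] K (x * y) = spectralNorm ℚ_[p] K x * spectralNorm ℚ_[p] K y :=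
      map_mul (spectralMulAlgNorm ℚ_[p] K) x y
    change spectralNorm ℚ_[p] K (x * y) ≤ 1
    rw [h]
    exact mul_le_one₀ hx (spectralNorm_nonneg y) hy
  one_mem' := (spectralNorm_one (K := ℚ_[p]) (L := K)).le
  add_mem' {x y} hx hy :=
    (isNonarchimedean_spectralNorm (K := ℚ_[p]) (L := K) x y).trans (max_le hx hy)
  zero_mem' := by
    change spectralNorm ℚ_[p] K 0 ≤ 1
    rw [spectralNorm_zero]
    exact zero_le_one
  neg_mem' {x} hx := by
    change spectralNorm ℚ_[p] K (-x) ≤ 1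
    rw [spectralNorm_neg (Algebra.IsAlgebraic.isAlgebraic x)]
    exact hx
  mem_or_inv_mem' x := by
    by_cases h0 : x = 0
    · left
      change spectralNorm ℚ_[p] K x ≤ 1
      rw [h0, spectralNorm_zero]
      exact zero_le_one
    · by_cases hx : spectralNorm ℚ_[p] K x ≤ 1
      · exact Or.inl hx
      · right
        change spectralNorm ℚ_[p] K x⁻¹ ≤ 1
        have h : spectralNorm ℚ_[p] K (x * x⁻¹)
            = spectralNorm ℚ_[p] K x * spectralNorm ℚ_[p] K x⁻¹ :=
          map_mul (spectralMulAlgNorm ℚ_[p] K) x x⁻¹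
        rw [mul_inv_cancel₀ h0, spectralNorm_one] at h
        have h1 : 1 < spectralNorm ℚ_[p] K x := not_le.mp hx
        have h2 := spectralNorm_nonneg (K := ℚ_[p]) x⁻¹
        nlinarith

/-- The residue field `F` of `K`. -/
abbrev ResF : Type v := IsLocalRing.ResidueField (integers p K)

open Classical in
/-- The lift to `K` of an element of the residue field: the root of unity in `K` of order prime
to `p` with the given reduction. (It is unique if it exists; the value is `0` otherwise, which
does not occur for the nonzero elements of `F`.) -/
noncomputable def brauerLift (x : ResF p K) : K :=
  if h : ∃ ζ : integers p K,
      (∃ m : ℕ, p.Coprime m ∧ ζ ^ m = 1) ∧ IsLocalRing.residue (integers p K) ζ = x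
  then (h.choose : K) else 0

end CoefficientRings

section BrauerCharacters

variable (p : ℕ)

/-- The set `G_{p'}` of `p`-regular elements of a finite group. -/
def PReg (G : Type u) [Group G] : Type u := {g : G // p.Coprime (orderOf g)}

namespace PReg

variable {p}

/-- A homomorphism maps `p`-regular elements to `p`-regular elements. -/
def map {G : Type*} {G' : Type*} [Group G] [Group G'] (f : G →* G') (x : PReg p G) : PReg p G' :=
  ⟨f x.1, Nat.Coprime.coprime_dvd_right (orderOf_map_dvd f x.1) x.2⟩

end PReg

variable [Fact p.Prime]
variable (K : Type v) [Field K] [Algebra ℚ_[p] K] [Algebra.IsAlgebraic ℚ_[p] K]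

/-- The Brauer character of a representation over the residue field: the sum, with
multiplicities, of the lifts to `K` of the eigenvalues. -/
noncomputable def brauerChar {G : Type u} [Group G] {d : ℕ}
    (ρ : Representation (ResF p K) G (Fin d → ResF p K)) : PReg p G → K :=
  fun g => ((LinearMap.charpoly (ρ g.1)).roots.map (brauerLift p K)).sum

/-- The set `IBr(G)` of irreducible Brauer characters. -/
def IBr (G : Type u) [Group G] : Set (PReg p G → K) :=
  {χ | ∃ (d : ℕ) (ρ : Representation (ResF p K) G (Fin d → ResF p K)),
    ρ.IsIrreducible ∧ brauerChar p K ρ = χ}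

/-- The Brauer characters of defect zero: the irreducible Brauer characters which are
the restrictions to `p`-regular elements of the irreducible ordinary characters `χ`
with `χ(1)_p = |G|_p`. -/
def DefectZero (G : Type u) [Group G] : Set (PReg p G → K) :=
  {θ | θ ∈ IBr p K G ∧ ∃ (d : ℕ) (ρ : Representation K G (Fin d → K)),
    ρ.IsIrreducible ∧ padicValNat p d = padicValNat p (Nat.card G) ∧
      ∀ g : PReg p G, θ g = ρ.character g.1}

/-- A faithful linear Brauer character: it is afforded by a one-dimensional representation
with trivial kernel. -/
def IsFaithfulLinear {G : Type u} [Group G] (θ : PReg p G → K) : Prop :=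
  ∃ ρ : Representation (ResF p K) G (Fin 1 → ResF p K),
    Function.Injective ρ ∧ brauerChar p K ρ = θ

/-- `IBr(J | θ)` for subgroups `N ≤ J` with `N` normal in `J` and a Brauer character `θ ∈ IBr(N)`:
the irreducible Brauer characters of `J` lying over `θ`, that is, those afforded by an irreducible
representation whose restriction to `N` has an irreducible constituent (by Clifford's theorem,
equivalently, an irreducible subrepresentation) affording `θ`. -/
def IBrOver {G : Type u} [Group G] (J N : Subgroup G) (θ : PReg p N → K) :
    Set (PReg p J → K) :=
  {χ | ∃ (d : ℕ) (ρ : Representation (ResF p K) J (Fin d → ResF p K))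
      (e : ℕ) (τ : Representation (ResF p K) N (Fin e → ResF p K))
      (T : (Fin e → ResF p K) →ₗ[ResF p K] (Fin d → ResF p K)),
    ρ.IsIrreducible ∧ brauerChar p K ρ = χ ∧ τ.IsIrreducible ∧ brauerChar p K τ = θ ∧
      T ≠ 0 ∧ ∀ (x : J) (y : N), (x : G) = (y : G) → ρ x ∘ₗ T = T ∘ₗ τ y}

/-- The field `𝔽_p(θ)`: the subfield of the residue field generated by the reductions of the
values of `θ`. (Every subfield contains the prime field.) -/
noncomputable def valueField {G : Type u} [Group G] (θ : PReg p G → K) : Subfield (ResF p K) :=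
  Subfield.closure {x | ∃ (g : PReg p G) (c : integers p K),
    (c : K) = θ g ∧ IsLocalRing.residue (integers p K) c = x}

end BrauerCharacters

section Vertices

/-- `ρ` is projective relative to the subgroup `H`: every surjection of (finite-dimensional)
representations onto `ρ` that splits over `H` splits over `G`. -/
def IsRelProjective {k : Type v} [Field k] {G : Type u} [Group G] {d : ℕ}
    (ρ : Representation k G (Fin d → k)) (H : Subgroup G) : Prop :=
  ∀ (m : ℕ) (τ : Representation k G (Fin m → k)) (π : (Fin m → k) →ₗ[k] (Fin d → k)),
    (∀ g : G, π ∘ₗ τ g = ρ g ∘ₗ π) →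
    (∃ s : (Fin d → k) →ₗ[k] (Fin m → k),
      (∀ h ∈ H, s ∘ₗ ρ h = τ h ∘ₗ s) ∧ π ∘ₗ s = LinearMap.id) →
    ∃ s : (Fin d → k) →ₗ[k] (Fin m → k),
      (∀ g : G, s ∘ₗ ρ g = τ g ∘ₗ s) ∧ π ∘ₗ s = LinearMap.id

/-- `Q` is a vertex of the irreducible Brauer character `χ`: a subgroup minimal subject to the
representation affording `χ` being projective relative to it. -/
def IsVertex (p : ℕ) [Fact p.Prime]
    (K : Type v) [Field K] [Algebra ℚ_[p] K] [Algebra.IsAlgebraic ℚ_[p] K]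
    {G : Type u} [Group G] (χ : PReg p G → K) (Q : Subgroup G) : Prop :=
  ∃ (d : ℕ) (ρ : Representation (ResF p K) G (Fin d → ResF p K)),
    ρ.IsIrreducible ∧ brauerChar p K ρ = χ ∧ Minimal (IsRelProjective ρ) Q

end Vertices

section Actions

variable {p : ℕ} [Fact p.Prime]
variable {K : Type v} [Field K] [Algebra ℚ_[p] K]
variable {G : Type u} [Group G]

/-- Restriction of functions on `p`-regular elements to a smaller subgroup. -/
noncomputable def res {H J : Subgroup G} (h : H ≤ J) (χ : PReg p J → K) : PReg p H → K :=
  fun x => χ (x.map (Subgroup.inclusion h))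

/-- The image `J^a` of a subgroup under (the group automorphism part of) `a = (σ, φ)`. -/
abbrev conjSub (a : (K ≃ₐ[ℚ_[p]] K) × MulAut G) (J : Subgroup G) : Subgroup G :=
  J.map a.2.toMonoidHom

/-- The function `χ^a` on the `p`-regular elements of `J^a`, for `a = (σ, φ)`:
`χ^a(x) = σ (χ (φ⁻¹ x))`. -/
noncomputable def twist (a : (K ≃ₐ[ℚ_[p]] K) × MulAut G) (J : Subgroup G) (χ : PReg p J → K) :
    PReg p (conjSub a J) → K :=
  fun x => a.1 (χ (x.map (a.2.subgroupMap J).symm.toMonoidHom))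

/-- Equality of functions given on the `p`-regular elements of two subgroups: the subgroups
coincide and the functions coincide. -/
def Agree {J J' : Subgroup G} (χ : PReg p J → K) (χ' : PReg p J' → K) : Prop :=
  J = J' ∧ ∀ (x : PReg p J) (y : PReg p J'), (x.1 : G) = (y.1 : G) → χ x = χ' y

variable (p K G) in
/-- `Inn(G)` as a subgroup of `ℋ × Aut(G)`, with `ℋ = Gal(K / ℚ_p)`. -/
noncomputable def innSub : Subgroup ((K ≃ₐ[ℚ_[p]] K) × MulAut G) :=
  Subgroup.prod ⊥ (MulAut.conj : G →* MulAut G).range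

variable (p K) in
/-- `ℋ × Aut(G)_Z`, with `Aut(G)_Z` the group of automorphisms `φ` such that `φ(Z) = Z`. -/
def stabSub (Z : Subgroup G) : Subgroup ((K ≃ₐ[ℚ_[p]] K) × MulAut G) where
  carrier := {a | conjSub a Z = Z}
  one_mem' := by
    change Z.map (MonoidHom.id G) = Z
    exact Subgroup.map_id Z
  mul_mem' {a b} ha hb := by
    have ha' : Z.map a.2.toMonoidHom = Z := ha
    have hb' : Z.map b.2.toMonoidHom = Z := hb
    change Z.map (a.2.toMonoidHom.comp b.2.toMonoidHom) = Z
    rw [← Subgroup.map_map, hb', ha']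
  inv_mem' {a} ha := by
    have ha' : Z.map a.2.toMonoidHom = Z := ha
    have hid : (a.2⁻¹ : MulAut G).toMonoidHom.comp a.2.toMonoidHom = MonoidHom.id G := by
      ext g
      exact a.2.symm_apply_apply g
    change Z.map (a.2⁻¹ : MulAut G).toMonoidHom = Z
    calc Z.map (a.2⁻¹ : MulAut G).toMonoidHom
        = (Z.map a.2.toMonoidHom).map (a.2⁻¹ : MulAut G).toMonoidHom := by rw [ha']
      _ = Z := by rw [Subgroup.map_map, hid, Subgroup.map_id]

/-- `θ`, a function on the `p`-regular elements of `Z`, is `a`-invariant: `θ^a = θ`. -/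
def FixedBy (a : (K ≃ₐ[ℚ_[p]] K) × MulAut G) {Z : Subgroup G} (θ : PReg p Z → K) : Prop :=
  Agree (twist a Z θ) θ

/-- The subgroup `J₁` of `G₁` that contains `Z₁` and satisfies `J₁ / Z₁ = ε (J Z / Z)`. -/
def corr {G₁ : Type u} [Group G₁] {Z : Subgroup G} [Z.Normal] {Z₁ : Subgroup G₁} [Z₁.Normal]
    (ε : G ⧸ Z ≃* G₁ ⧸ Z₁) (J : Subgroup G) : Subgroup G₁ :=
  ((J.map (QuotientGroup.mk' Z)).map ε.toMonoidHom).comap (QuotientGroup.mk' Z₁)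

theorem corr_mono {G₁ : Type u} [Group G₁] {Z : Subgroup G} [Z.Normal] {Z₁ : Subgroup G₁}
    [Z₁.Normal] (ε : G ⧸ Z ≃* G₁ ⧸ Z₁) {H J : Subgroup G} (h : H ≤ J) : corr ε H ≤ corr ε J :=
  Subgroup.comap_mono (Subgroup.map_mono (Subgroup.map_mono h))

/-- The image `Y Z / Z` in `G / Z` of a subgroup `Y` of a subgroup `J` of `G`. -/
def imageMod (Z : Subgroup G) [Z.Normal] {J : Subgroup G} (Y : Subgroup J) : Subgroup (G ⧸ Z) :=
  (Y.map J.subtype).map (QuotientGroup.mk' Z)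

end Actions

end ModRep

open ModRep

/-! Let S : Z → M_e(F) afford λ. Since F contains enough roots of unity, S is absolutely irreducible
and S(Z) spans M_e(F) (`MatIrr.schur`, `span_range_eq_top`). Put k = 𝔽_p(λ) and let V be the k-span
of S(Z). The traces of elements of V lie in k and the trace form is nondegenerate, so the scalar
matrices in V are exactly those with scalar in k (`smul_one_mem_kForm_iff`). As λ is G-invariant,
conjugation by each g ∈ G on S(Z) is induced by an invertible matrix, and a multiple of this matrix
lies in V (`exists_unit_mem_kForm`).

Let Γ be the group of pairs (g, u) with g ∈ G and u an invertible element of V inducing on S(Z) the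
conjugation by g. The projection α : Γ → G is onto with kernel the scalars k^×, and R(g, u) = u is a
genuine representation of Γ extending S along the normal embedding z ↦ (z, S(z)). Put G₁ = Γ/Z with
projection π, and Z₁ = π(ker α) ≅ k^×. Both G/Z and G₁/Z₁ are the quotient of Γ by ker α · ker π,
which gives ε. The character λ₁ sends a scalar to its inverse.

A representation A of J and a representation B of J₁ correspond when A∘α ≅ R ⊗ (B∘π) on the preimage
of J in Γ. Because R(ker π) spans the full matrix algebra, tensoring with R preserves and reflects
equivalence and irreducibility (`TripleLink.eqv_of_kron_eqv`, `TripleLink.irr_kron_iff`), and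
Clifford theory shows that each irreducible A over S arises (`TripleLink.exists_right`). The inverse
scalars in λ₁ are what makes R ⊗ (B∘π) trivial on ker α. Irreducible representations are determined
by their Brauer characters (`MatIrr.eqv_of_matBr_eq`), so this defines ν. Restriction is compatible
because one tensor factor R serves all subgroups; passing to composition factors gives the ℤ-linear
statement (`TripleLink.matBr_induction`), with linear independence of irreducible Brauer characters
making ν extend linearly.

An element (σ, φ) of Φ lifts to the automorphism (g, u) ↦ (φ(g), T σ(u) T⁻¹) of Γ, where T
intertwines the σ-twist of S with S∘φ. The lift does not depend on T and is the only compatible one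
(`FullLink.compat_unique`); hence the lifts form a homomorphism, inner automorphisms lift to inner
ones, and ω is obtained on the quotient G₁.

For vertices, relative projectivity is rephrased by Higman's criterion as an equivariant
decomposition of the identity indexed by a G-set. If ker π acts trivially on the G-set, such
decompositions for R ⊗ (B∘π) all have the form 1 ⊗ β, so they pass between A and B
(`TripleLink.exists_vertex`). -/

namespace ModRep

/-! ### Matrix representations, equivalence and Schur's lemma -/

section MatrixReps

variable {k : Type*} [Field k] {G : Type*} [Group G]
variable {I J L : Type*} [Fintype I] [DecidableEq I] [Fintype J] [DecidableEq J]
  [Fintype L] [DecidableEq L]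

open Matrix

/-- A matrix representation is irreducible. -/
def MatIrr (A : G →* Matrix I I k) : Prop :=
  Nonempty I ∧ ∀ U : Submodule k (I → k), (∀ g, ∀ v ∈ U, A g *ᵥ v ∈ U) → U = ⊥ ∨ U = ⊤

/-- Every matrix commuting with the representation is scalar. -/
def MatSchur (A : G →* Matrix I I k) : Prop :=
  ∀ C : Matrix I I k, (∀ g, C * A g = A g * C) → ∃ c : k, C = c • (1 : Matrix I I k)

/-- Equivalence of matrix representations (of possibly different index types). -/
def MatEqv (A : G →* Matrix I I k) (B : G →* Matrix J J k) : Prop :=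
  ∃ (P : Matrix J I k) (Q : Matrix I J k), Q * P = 1 ∧ P * Q = 1 ∧ ∀ g, P * A g = B g * P

theorem MatEqv.refl (A : G →* Matrix I I k) : MatEqv A A :=
  ⟨1, 1, by simp, by simp, by simp⟩

theorem MatEqv.symm {A : G →* Matrix I I k} {B : G →* Matrix J J k} (h : MatEqv A B) :
    MatEqv B A := by
  obtain ⟨P, Q, h1, h2, h3⟩ := h
  refine ⟨Q, P, h2, h1, fun g => ?_⟩
  calc Q * B g = Q * B g * (P * Q) := by rw [h2, Matrix.mul_one]
    _ = Q * (P * A g) * Q := by rw [h3]; simp only [Matrix.mul_assoc]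
    _ = A g * Q := by rw [← Matrix.mul_assoc, h1, Matrix.one_mul]

theorem MatEqv.trans {A : G →* Matrix I I k} {B : G →* Matrix J J k} {D : G →* Matrix L L k}
    (h : MatEqv A B) (h' : MatEqv B D) : MatEqv A D := by
  obtain ⟨P, Q, h1, h2, h3⟩ := h
  obtain ⟨P', Q', h1', h2', h3'⟩ := h'
  refine ⟨P' * P, Q * Q', ?_, ?_, fun g => ?_⟩
  · rw [Matrix.mul_assoc, ← Matrix.mul_assoc Q', h1', Matrix.one_mul, h1]
  · rw [Matrix.mul_assoc, ← Matrix.mul_assoc P, h2, Matrix.one_mul, h2']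
  · rw [Matrix.mul_assoc, h3, ← Matrix.mul_assoc, h3', Matrix.mul_assoc]

theorem MatEqv.charpoly_eq {A : G →* Matrix I I k} {B : G →* Matrix J J k} (h : MatEqv A B)
    (g : G) : (A g).charpoly = (B g).charpoly := by
  obtain ⟨P, Q, h1, h2, h3⟩ := h
  let e : (I → k) ≃ₗ[k] (J → k) := LinearEquiv.ofLinearMap (toLin' P) (toLin' Q)
    (by rw [← toLin'_mul, h2, toLin'_one]) (by rw [← toLin'_mul, h1, toLin'_one])
  have he : e.conj (toLin' (A g)) = toLin' (B g) := by
    change (toLin' P ∘ₗ toLin' (A g)) ∘ₗ toLin' Q = _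
    rw [← toLin'_mul, h3, ← toLin'_mul, Matrix.mul_assoc, h2, Matrix.mul_one]
  rw [← charpoly_toLin', ← charpoly_toLin', ← he, LinearEquiv.charpoly_conj]

theorem MatEqv.irr {A : G →* Matrix I I k} {B : G →* Matrix J J k} (h : MatEqv A B)
    (hA : MatIrr A) : MatIrr B := by
  obtain ⟨P, Q, h1, h2, h3⟩ := h
  constructor
  · by_contra hJ
    rw [not_nonempty_iff] at hJ
    obtain ⟨i⟩ := hA.1
    have := congrFun (congrFun h1 i) i
    simp [Matrix.mul_apply] at this
  · intro U hU
    have := hA.2 (U.comap (toLin' P)) (fun g v hv => by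
      simp only [Submodule.mem_comap, toLin'_apply, mulVec_mulVec] at hv ⊢
      rw [h3, ← mulVec_mulVec]
      exact hU g _ hv)
    have key : ∀ v : J → k, v ∈ U ↔ Q *ᵥ v ∈ U.comap (toLin' P) := fun v => by
      simp only [Submodule.mem_comap, toLin'_apply, mulVec_mulVec, h2, one_mulVec]
    refine this.imp (fun h => ?_) (fun h => ?_)
    · rw [eq_bot_iff]
      intro v hv
      rw [key, h, Submodule.mem_bot] at hv
      have := congrArg (P *ᵥ ·) hv
      simpa [mulVec_mulVec, h2] using this
    · rw [eq_top_iff]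
      intro v _
      rw [key, h]; trivial

theorem exists_inv_of_bijective {T : Matrix J I k} (hker : LinearMap.ker (toLin' T) = ⊥)
    (hran : LinearMap.range (toLin' T) = ⊤) : ∃ Q : Matrix I J k, Q * T = 1 ∧ T * Q = 1 := by
  let e := LinearEquiv.ofBijective (toLin' T)
    ⟨LinearMap.ker_eq_bot.mp hker, LinearMap.range_eq_top.mp hran⟩
  refine ⟨LinearMap.toMatrix' (e.symm : (J → k) →ₗ[k] (I → k)), ?_, ?_⟩
  · apply toLin'.injective
    rw [toLin'_mul, toLin'_toMatrix', toLin'_one]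
    ext v; exact congrFun (e.symm_apply_apply _) _
  · apply toLin'.injective
    rw [toLin'_mul, toLin'_toMatrix', toLin'_one]
    ext v; exact congrFun (e.apply_symm_apply _) _

/-- Schur's lemma: a nonzero intertwiner of irreducible representations is invertible. -/
theorem MatIrr.exists_inv {A : G →* Matrix I I k} {B : G →* Matrix J J k} (hA : MatIrr A)
    (hB : MatIrr B) {T : Matrix J I k} (hT : T ≠ 0) (h : ∀ g, T * A g = B g * T) :
    ∃ Q : Matrix I J k, Q * T = 1 ∧ T * Q = 1 := by
  have hker : LinearMap.ker (toLin' T) = ⊥ := by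
    refine (hA.2 _ fun g v hv => ?_).resolve_right fun htop => hT ?_
    · rw [LinearMap.mem_ker, toLin'_apply] at hv ⊢
      rw [mulVec_mulVec, h, ← mulVec_mulVec, hv, mulVec_zero]
    · rw [LinearMap.ker_eq_top] at htop
      exact (LinearEquiv.map_eq_zero_iff _).mp htop
  have hran : LinearMap.range (toLin' T) = ⊤ := by
    refine (hB.2 _ fun g v hv => ?_).resolve_left fun hbot => hT ?_
    · obtain ⟨w, rfl⟩ := hv
      refine ⟨A g *ᵥ w, ?_⟩
      simp only [toLin'_apply, mulVec_mulVec, h]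
    · rw [LinearMap.range_eq_bot] at hbot
      exact (LinearEquiv.map_eq_zero_iff _).mp hbot
  exact exists_inv_of_bijective hker hran

theorem MatIrr.eqv_of_ne_zero {A : G →* Matrix I I k} {B : G →* Matrix J J k} (hA : MatIrr A)
    (hB : MatIrr B) {T : Matrix J I k} (hT : T ≠ 0) (h : ∀ g, T * A g = B g * T) :
    MatEqv A B := by
  obtain ⟨Q, h1, h2⟩ := hA.exists_inv hB hT h
  exact ⟨T, Q, h1, h2, h⟩

/-- The representation on `I → k` given by a matrix representation. -/
def toRep (A : G →* Matrix I I k) : Representation k G (I → k) :=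
  (toLinAlgEquiv' : Matrix I I k ≃ₐ[k] _).toAlgHom.toMonoidHom.comp A

theorem toRep_apply (A : G →* Matrix I I k) (g : G) : toRep A g = toLin' (A g) := rfl

/-- The matrix representation given by a representation on `I → k`. -/
def toMat (ρ : Representation k G (I → k)) : G →* Matrix I I k :=
  (LinearMap.toMatrixAlgEquiv' : _ ≃ₐ[k] Matrix I I k).toAlgHom.toMonoidHom.comp ρ

theorem toMat_apply (ρ : Representation k G (I → k)) (g : G) :
    toMat ρ g = LinearMap.toMatrix' (ρ g) := rfl

@[simp] theorem toRep_toMat (ρ : Representation k G (I → k)) : toRep (toMat ρ) = ρ := by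
  ext g v
  simp [toRep_apply, toMat_apply]

@[simp] theorem toMat_toRep (A : G →* Matrix I I k) : toMat (toRep A) = A := by
  refine MonoidHom.ext fun g => ?_
  simp [toRep_apply, toMat_apply]

theorem irreducible_toRep_iff {A : G →* Matrix I I k} :
    (toRep A).IsIrreducible ↔ MatIrr A := by
  constructor
  · intro h
    constructor
    · by_contra hI
      rw [not_nonempty_iff] at hI
      obtain ⟨a, b, hab⟩ := h.toNontrivial
      exact hab (Subrepresentation.toSubmodule_injective (Subsingleton.elim _ _))
    · intro U hU
      have := h.eq_bot_or_eq_top (⟨U, fun g v hv => hU g v hv⟩ : Subrepresentation (toRep A))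
      exact this.imp (fun h => congrArg Subrepresentation.toSubmodule h)
        (fun h => congrArg Subrepresentation.toSubmodule h)
  · rintro ⟨⟨i⟩, h⟩
    have : Nontrivial (Subrepresentation (toRep A)) := by
      refine ⟨⊥, ⊤, fun hbt => ?_⟩
      have h' : (⊥ : Submodule k (I → k)) = ⊤ := congrArg Subrepresentation.toSubmodule hbt
      have h1 : (Pi.single i 1 : I → k) ∈ (⊥ : Submodule k (I → k)) := h' ▸ trivial
      have := congrFun ((Submodule.mem_bot k).mp h1) i
      simp at this
    exact ⟨fun U => (h U.toSubmodule fun g v hv => U.apply_mem_toSubmodule g hv).imp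
      (fun h => Subrepresentation.toSubmodule_injective h)
      (fun h => Subrepresentation.toSubmodule_injective h)⟩

theorem matIrr_toMat {ρ : Representation k G (I → k)} : MatIrr (toMat ρ) ↔ ρ.IsIrreducible := by
  rw [← irreducible_toRep_iff, toRep_toMat]

/-- Bridge between matrices and modules over the group algebra, so that Jacobson density can be
applied to matrix representations. -/
theorem toRep_asModule_smul (A : G →* Matrix I I k) (r : MonoidAlgebra k G)
    (v : (toRep A).asModule) :
    r • v = (MonoidAlgebra.lift k _ G A r) *ᵥ (v : I → k) := by
  have h : ∀ r : MonoidAlgebra k G, (toRep A).asAlgebraHom r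
      = toLin' (MonoidAlgebra.lift k _ G A r) := by
    intro r
    have : (toRep A).asAlgebraHom
        = (toLinAlgEquiv' : Matrix I I k ≃ₐ[k] _).toAlgHom.comp (MonoidAlgebra.lift k _ G A) := by
      refine (MonoidAlgebra.lift k _ G).symm.injective (MonoidHom.ext fun g => ?_)
      rw [MonoidAlgebra.lift_symm_apply, MonoidAlgebra.lift_symm_apply,
        Representation.asAlgebraHom_single, AlgHom.comp_apply, MonoidAlgebra.lift_single,
        one_smul, one_smul, toRep_apply]
      rfl
    rw [this]; rfl
  exact congrArg (fun f : (I → k) →ₗ[k] (I → k) => f v) (h r)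

/-- A module homomorphism between the modules of two matrix representations, as a matrix. -/
theorem exists_intertwiner (A : G →* Matrix I I k) (B : G →* Matrix J J k)
    (f : (toRep A).asModule →ₗ[MonoidAlgebra k G] (toRep B).asModule) :
    ∃ T : Matrix J I k, (∀ g, T * A g = B g * T) ∧ ∀ v : I → k, f v = T *ᵥ v := by
  let f' : (I → k) →ₗ[k] (J → k) := f.restrictScalars k
  have hT : ∀ v : I → k, f v = LinearMap.toMatrix' f' *ᵥ v := fun v =>
    (LinearMap.toMatrix'_mulVec f' v).symm
  refine ⟨LinearMap.toMatrix' f', fun g => ?_, hT⟩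
  apply toLin'.injective
  refine LinearMap.ext fun v => ?_
  have := f.map_smul (MonoidAlgebra.single g (1 : k)) v
  erw [toRep_asModule_smul, toRep_asModule_smul, hT, hT, MonoidAlgebra.lift_single,
    MonoidAlgebra.lift_single] at this
  rw [one_smul, one_smul, mulVec_mulVec, mulVec_mulVec] at this
  rw [toLin'_apply, toLin'_apply, this]

end MatrixReps

/-! ### Density theorem, Burnside and Frobenius–Schur -/

section Density

variable {k : Type*} [Field k] {G : Type*} [Group G]

open Matrix

/-- Jacobson density for a finite family of simple modules without nonzero homomorphisms between
different members. -/
theorem exists_smul_eq_of_simple {R : Type*} [Ring R] {ι : Type*} [Finite ι] {M : ι → Type*}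
    [∀ i, AddCommGroup (M i)] [∀ i, Module R (M i)] [∀ i, IsSimpleModule R (M i)]
    (hne : ∀ i j, i ≠ j → ∀ f : M i →ₗ[R] M j, f = 0) (i : ι) (f : M i →+ M i)
    (hf : ∀ (φ : Module.End R (M i)) (v : M i), f (φ v) = φ (f v)) (s : ∀ j, Finset (M j)) :
    ∃ r : R, (∀ v ∈ s i, r • v = f v) ∧ ∀ j, j ≠ i → ∀ v ∈ s j, r • v = 0 := by
  classical
  cases nonempty_fintype ι
  have hcomp : ∀ (φ : Module.End R (∀ i, M i)) (v : ∀ i, M i) (j : ι),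
      φ v j = ∑ l, φ (Pi.single l (v l)) j := fun φ v j => by
    conv_lhs => rw [← Finset.univ_sum_single v, map_sum, Finset.sum_apply]
  have hoff : ∀ (φ : Module.End R (∀ i, M i)) (l j : ι) (v : M l), l ≠ j →
      φ (Pi.single l v) j = 0 := fun φ l j v hlj =>
    LinearMap.congr_fun (hne l j hlj (LinearMap.proj j ∘ₗ φ ∘ₗ LinearMap.single R M l)) v
  -- Homomorphisms between different components vanish, so every endomorphism of the product is
  -- diagonal. Therefore the map that is `f` on component `i` and zero elsewhere lies in the double
  -- commutant.
  let F : Module.End (Module.End R (∀ i, M i)) (∀ i, M i) :=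
    { toFun := fun v => Pi.single i (f (v i))
      map_add' := fun v w => by rw [← Pi.single_add, Pi.add_apply, map_add]
      map_smul' := fun φ v => by
        funext j
        rw [Module.End.smul_def, RingHom.id_apply, Module.End.smul_def]
        have h1 : φ v i = (LinearMap.proj i ∘ₗ φ ∘ₗ LinearMap.single R M i) (v i) := by
          rw [hcomp φ v i, Finset.sum_eq_single i]
          · rfl
          · exact fun l _ hl => hoff φ l i _ hl
          · simp
        by_cases hij : i = j
        · subst hij
          rw [Pi.single_eq_same, h1, hf]; rfl
        · rw [Pi.single_eq_of_ne (Ne.symm hij), hoff φ i j _ hij] }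
  obtain ⟨r, hr⟩ := jacobson_density (R := R) F
    (Finset.univ.biUnion fun j => (s j).image (Pi.single j))
  have hr' : ∀ j, ∀ v ∈ s j, r • v = F (Pi.single j v) j := fun j v hv => by
    rw [hr _ (Finset.mem_biUnion.mpr ⟨j, Finset.mem_univ _, Finset.mem_image_of_mem _ hv⟩),
      Pi.smul_apply, Pi.single_eq_same]
  refine ⟨r, fun v hv => ?_, fun j hj v hv => ?_⟩
  · rw [hr' i v hv]
    change (Pi.single i (f ((Pi.single i v : ∀ i, M i) i)) : ∀ i, M i) i = _
    rw [Pi.single_eq_same, Pi.single_eq_same]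
  · rw [hr' j v hv]
    change (Pi.single i (f ((Pi.single j v : ∀ i, M i) i)) : ∀ i, M i) j = _
    rw [Pi.single_eq_of_ne hj]

/-- The theorem of Frobenius and Schur: the matrices of pairwise inequivalent absolutely
irreducible representations are jointly linearly independent. -/
theorem span_range_pi_eq_top {ι : Type*} [Finite ι] {I : ι → Type*} [∀ i, Fintype (I i)]
    [∀ i, DecidableEq (I i)] (A : ∀ i, G →* Matrix (I i) (I i) k) (hirr : ∀ i, MatIrr (A i))
    (hschur : ∀ i, MatSchur (A i)) (hne : ∀ i j, MatEqv (A i) (A j) → i = j) :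
    Submodule.span k (Set.range fun g => fun i => A i g) = ⊤ := by
  classical
  cases nonempty_fintype ι
  have hsimple : ∀ i, IsSimpleModule (MonoidAlgebra k G) (toRep (A i)).asModule := fun i =>
    (Representation.irreducible_iff_isSimpleModule_asModule _).mp
      (irreducible_toRep_iff.mpr (hirr i))
  let R := MonoidAlgebra k G
  -- The finite sets fed to density are the standard bases, so agreement on them is equality of
  -- matrices. The hypothesis `hschur` is what makes every `X` commute with the endomorphisms of its
  -- module.
  have key : ∀ (i : ι) (X : Matrix (I i) (I i) k), ∃ r : R, ∀ j,
      MonoidAlgebra.lift k _ G (A j) r = (Pi.single i X : ∀ j, Matrix (I j) (I j) k) j := by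
    intro i X
    obtain ⟨r, hr1, hr2⟩ := exists_smul_eq_of_simple (R := R)
      (M := fun i => (toRep (A i)).asModule) (fun l j hlj f => by
        obtain ⟨T, hT, hTv⟩ := exists_intertwiner (A l) (A j) f
        by_contra h0
        refine hlj (hne _ _ ((hirr l).eqv_of_ne_zero (hirr j) (T := T) ?_ hT))
        rintro rfl
        exact h0 (LinearMap.ext fun v => (hTv v).trans (zero_mulVec _)))
      i (toLin' X).toAddMonoidHom (fun φ v => by
        obtain ⟨T, hT, hTv⟩ := exists_intertwiner (A i) (A i) φ
        obtain ⟨c, rfl⟩ := hschur i T hT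
        have h : ∀ v : I i → k, φ v = c • v := fun v =>
          (hTv v).trans (by rw [smul_mulVec, one_mulVec])
        refine Eq.trans ?_ (h _).symm
        refine (congrArg (toLin' X) (h v)).trans ?_
        exact map_smul (toLin' X) c _)
      (fun j => Finset.univ.image fun a : I j => (Pi.single a 1 : I j → k))
    refine ⟨r, fun j => ?_⟩
    apply toLin'.injective
    refine (Pi.basisFun k (I j)).ext fun a => ?_
    rw [Pi.basisFun_apply, toLin'_apply, toLin'_apply]
    refine (toRep_asModule_smul (A j) r _).symm.trans ?_
    by_cases hij : i = j
    · subst hij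
      rw [Pi.single_eq_same]
      exact hr1 _ (Finset.mem_image_of_mem _ (Finset.mem_univ a))
    · rw [Pi.single_eq_of_ne (Ne.symm hij), zero_mulVec]
      exact hr2 j (Ne.symm hij) _ (Finset.mem_image_of_mem _ (Finset.mem_univ a))
  have hmem : ∀ r : R, (fun i => MonoidAlgebra.lift k _ G (A i) r)
      ∈ Submodule.span k (Set.range fun g => fun i => A i g) := by
    intro r
    induction r using MonoidAlgebra.induction_linear with
    | zero => simp only [map_zero]; exact Submodule.zero_mem _
    | add f g hf hg => simp only [map_add]; exact Submodule.add_mem _ hf hg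
    | single g c =>
      have : (fun i => MonoidAlgebra.lift k _ G (A i) (MonoidAlgebra.single g c))
          = c • fun i => A i g := by
        funext i; rw [MonoidAlgebra.lift_single]; rfl
      rw [this]
      exact Submodule.smul_mem _ _ (Submodule.subset_span ⟨g, rfl⟩)
  rw [eq_top_iff]
  intro X _
  rw [← Finset.univ_sum_single X]
  refine Submodule.sum_mem _ fun i _ => ?_
  obtain ⟨r, hr⟩ := key i (X i)
  rw [← funext hr]
  exact hmem r

/-- Burnside's theorem for an absolutely irreducible representation. -/
theorem span_range_eq_top {I : Type*} [Fintype I] [DecidableEq I] {A : G →* Matrix I I k}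
    (hirr : MatIrr A) (hschur : MatSchur A) : Submodule.span k (Set.range A) = ⊤ := by
  have h := span_range_pi_eq_top (ι := Unit) (fun _ => A) (fun _ => hirr) (fun _ => hschur)
    (fun _ _ _ => rfl)
  have := congrArg (Submodule.map (LinearMap.proj (R := k) (φ := fun _ : Unit => Matrix I I k) ()))
    h
  rw [Submodule.map_span, ← Set.range_comp, Submodule.map_top, LinearMap.range_eq_top.mpr] at this
  · exact this
  · exact LinearMap.proj_surjective ()

/-- The trace functions of pairwise inequivalent absolutely irreducible representations are
linearly independent. -/
theorem eq_zero_of_sum_trace_eq_zero {ι : Type*} [Fintype ι] {I : ι → Type*} [∀ i, Fintype (I i)]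
    [∀ i, DecidableEq (I i)] (A : ∀ i, G →* Matrix (I i) (I i) k) (hirr : ∀ i, MatIrr (A i))
    (hschur : ∀ i, MatSchur (A i)) (hne : ∀ i j, MatEqv (A i) (A j) → i = j)
    (c : ι → k) (hc : ∀ g, ∑ i, c i * (A i g).trace = 0) (i : ι) : c i = 0 := by
  classical
  let f : (∀ i, Matrix (I i) (I i) k) →ₗ[k] k :=
    ∑ i, c i • (traceLinearMap (I i) k k ∘ₗ LinearMap.proj i)
  have hf : ∀ X, f X = ∑ i, c i * (X i).trace := fun X => by
    simp [f, LinearMap.sum_apply]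
  have h0 : f = 0 := by
    refine LinearMap.ext_on (span_range_pi_eq_top A hirr hschur hne) ?_
    rintro _ ⟨g, rfl⟩
    rw [hf, hc]; rfl
  obtain ⟨⟨a⟩, -⟩ := hirr i
  -- A diagonal matrix unit has trace one in every characteristic, unlike the identity matrix.
  have := LinearMap.congr_fun h0 (Pi.single i (Matrix.single a a 1))
  rw [hf, Finset.sum_eq_single i, Pi.single_eq_same, trace_single_eq_same, mul_one] at this
  · exact this
  · intro j _ hj
    rw [Pi.single_eq_of_ne hj, trace_zero, mul_zero]
  · simp

end Density

/-! ### Finite fields with enough roots of unity are splitting fields -/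

section SplittingFields

open Matrix Polynomial

theorem pow_eq_one_of_mem_spectrum {E A : Type*} [Field E] [Ring A] [Nontrivial A] [Algebra E A]
    {x : A} {N : ℕ} (hx : x ^ N = 1) {a : E} (ha : a ∈ spectrum E x) : a ^ N = 1 := by
  have h := spectrum.pow_mem_pow x N ha
  rw [hx, spectrum.one_eq] at h
  exact h

/-- Over the algebraic closure every eigenvalue is an `N`-th root of unity, and these already lie in
the base field. No diagonalizability is needed, so `N` may be divisible by the characteristic. -/
theorem charpoly_splits_of_pow_eq_one {E n : Type*} [Field E] [Fintype n] [DecidableEq n]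
    {x : Matrix n n E} {N : ℕ} (hN : N ≠ 0) (hx : x ^ N = 1) (hs : (X ^ N - 1 : E[X]).Splits) :
    x.charpoly.Splits := by
  cases isEmpty_or_nonempty n
  · refine Splits.of_natDegree_eq_zero ?_
    rw [charpoly_natDegree_eq_dim, Fintype.card_eq_zero]
  refine Splits.of_splits_map (algebraMap E (AlgebraicClosure E)) (IsAlgClosed.splits _) ?_
  intro a ha
  rw [← charpoly_map] at ha
  have h1 := mem_spectrum_of_isRoot_charpoly (isRoot_of_mem_roots ha)
  have h2 : a ^ N = 1 := pow_eq_one_of_mem_spectrum (x := x.map (algebraMap E _))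
    (by rw [← RingHom.mapMatrix_apply, ← map_pow, hx, map_one]) h1
  refine hs.mem_range_of_isRoot (X_pow_sub_C_ne_zero (Nat.pos_of_ne_zero hN) (1 : E)) ?_
  simp [IsRoot, h2]

theorem trace_mem_range_of_pow_eq_one {k D V : Type*} [Field k] [Field D] [AddCommGroup V]
    [Module D V] [FiniteDimensional D V] (i : k →+* D) {f : Module.End D V} {N : ℕ} (hN : N ≠ 0)
    (hf : f ^ N = 1) (hs : (X ^ N - 1 : k[X]).Splits) : LinearMap.trace D V f ∈ i.range := by
  cases subsingleton_or_nontrivial V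
  · rw [show f = 0 from Subsingleton.elim _ _, map_zero]
    exact zero_mem _
  have hs' : (X ^ N - 1 : D[X]).Splits := by simpa using hs.map i
  have hsp : f.charpoly.Splits := by
    refine charpoly_splits_of_pow_eq_one hN ?_ hs'
    rw [LinearMap.toMatrix_pow, hf, LinearMap.toMatrix_one]
  rw [Module.End.trace_eq_sum_roots_charpoly_of_splits hsp]
  refine Subring.multiset_sum_mem _ _ fun a ha => ?_
  have h1 := (Module.End.mem_spectrum_iff_isRoot_charpoly f a).mpr (isRoot_of_mem_roots ha)
  refine hs.mem_range_of_isRoot (X_pow_sub_C_ne_zero (Nat.pos_of_ne_zero hN) (1 : k)) ?_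
  simp [IsRoot, pow_eq_one_of_mem_spectrum hf h1]

/-- The trace over `D` of every element of the group algebra lies in the image of `k`, because the
eigenvalues of group elements are roots of unity of `k`. By density some element of the group
algebra acts as a `D`-linear operator of trace `d`, so `d` comes from `k`. This avoids Galois
descent of representations. -/
theorem mem_range_of_simple_of_pow_eq_one {k G M D : Type*} [Field k] [Group G] [AddCommGroup M]
    [Module (MonoidAlgebra k G) M] [IsSimpleModule (MonoidAlgebra k G) M] [Finite M] [Field D]
    [Module D M] [SMulCommClass (MonoidAlgebra k G) D M]
    (hcomm : ∀ φ : Module.End (MonoidAlgebra k G) M, ∃ d : D, ∀ m, φ m = d • m)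
    (i : k →+* D) (hi : ∀ (c : k) (m : M), i c • m = (MonoidAlgebra.single (1 : G) c : MonoidAlgebra k G) • m)
    {N : ℕ} (hN : N ≠ 0) (hG : ∀ g : G, g ^ N = 1) (hs : (X ^ N - 1 : k[X]).Splits) (d : D) :
    d ∈ i.range := by
  cases nonempty_fintype M
  have : Module.Finite D M := Module.Finite.of_finite
  let act : MonoidAlgebra k G →+* Module.End D M :=
    Module.toModuleEnd D M
  have htr : ∀ r, LinearMap.trace D M (act r) ∈ i.range := by
    intro r
    induction r using MonoidAlgebra.induction_linear with
    | zero => rw [map_zero, map_zero]; exact zero_mem _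
    | add f g hf hg => rw [map_add, map_add]; exact add_mem hf hg
    | single g c =>
      have h1 : act (MonoidAlgebra.single g c) = i c • act (MonoidAlgebra.single g 1) := by
        ext m
        change (MonoidAlgebra.single g c : MonoidAlgebra k G) • m
          = i c • ((MonoidAlgebra.single g 1 : MonoidAlgebra k G) • m)
        rw [hi, smul_smul, MonoidAlgebra.single_mul_single, one_mul, mul_one]
      rw [h1, map_smul, smul_eq_mul]
      refine mul_mem ⟨c, rfl⟩ (trace_mem_range_of_pow_eq_one i hN ?_ hs)
      rw [← map_pow, MonoidAlgebra.single_pow, hG, one_pow]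
      exact map_one act
  have : Nontrivial M := IsSimpleModule.nontrivial (MonoidAlgebra k G) M
  obtain ⟨m, hm⟩ := exists_ne (0 : M)
  obtain ⟨φ, hφ⟩ := Module.Projective.exists_dual_ne_zero D hm
  -- The rank one operator v ↦ (d / φ(m)) φ(v) m, whose trace is `d`.
  let f : Module.End D M := dualTensorHom D M M (((d / φ m) • φ) ⊗ₜ m)
  obtain ⟨r, hr, -⟩ := exists_smul_eq_of_simple (R := MonoidAlgebra k G) (ι := Unit)
    (M := fun _ => M) (fun _ _ h => absurd rfl h) () f.toAddMonoidHom
    (fun ψ v => by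
      obtain ⟨e, he⟩ := hcomm ψ
      rw [he, he]
      exact map_smul f e v) (fun _ => Finset.univ)
  have hrf : act r = f := LinearMap.ext fun v => hr v (Finset.mem_univ v)
  have := htr r
  rw [hrf, LinearMap.trace_eq_contract_apply] at this
  simpa [div_mul_cancel₀ _ hφ] using this

/-- Over a finite field with sufficiently many roots of unity, irreducible representations are
absolutely irreducible. -/
theorem MatIrr.schur {k G I : Type*} [Field k] [Finite k] [Group G] [Fintype I] [DecidableEq I]
    {A : G →* Matrix I I k} (hA : MatIrr A) {N : ℕ} (hN : N ≠ 0) (hG : ∀ g : G, g ^ N = 1)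
    (hs : (X ^ N - 1 : k[X]).Splits) : MatSchur A := by
  classical
  intro C hC
  let R := MonoidAlgebra k G
  let M := (toRep A).asModule
  have hsimple : IsSimpleModule R M :=
    (Representation.irreducible_iff_isSimpleModule_asModule _).mp (irreducible_toRep_iff.mpr hA)
  have hfin : Finite M := inferInstanceAs (Finite (I → k))
  have : Finite (Module.End R M) := DFunLike.finite _
  -- The endomorphism ring is a finite division ring by Schur's lemma, hence commutative by
  -- Wedderburn; the module is a vector space over it.
  let _ : Field (Module.End R M) := littleWedderburn _
  have hsm : ∀ (c : k) (v : I → k), (c • (1 : Matrix I I k)) *ᵥ v = c • v := fun c v => by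
    rw [smul_mulVec, one_mulVec]
  let i : k →+* Module.End R M := algebraMap k (Module.End R M)
  have hext : ∀ r : R, C * MonoidAlgebra.lift k _ G A r = MonoidAlgebra.lift k _ G A r * C := by
    intro r
    induction r using MonoidAlgebra.induction_linear with
    | zero => simp
    | add f g hf hg => simp [mul_add, add_mul, hf, hg]
    | single g c => rw [MonoidAlgebra.lift_single, mul_smul_comm, hC, smul_mul_assoc]
  let d : Module.End R M :=
    { toFun := fun v => toLin' C v
      map_add' := fun v w => (toLin' C).map_add v w
      map_smul' := fun r v => by
        rw [RingHom.id_apply]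
        refine (congrArg (toLin' C) (toRep_asModule_smul A r v)).trans
          (Eq.trans ?_ (toRep_asModule_smul A r _).symm)
        exact (mulVec_mulVec _ _ _).trans ((congrArg (· *ᵥ _) (hext r)).trans
          (mulVec_mulVec _ _ _).symm) }
  obtain ⟨c, hc⟩ := mem_range_of_simple_of_pow_eq_one (k := k) (G := G) (M := M)
    (D := Module.End R M) (fun φ => ⟨φ, fun m => rfl⟩) i (fun c m => by
      refine Eq.trans ?_ (toRep_asModule_smul A _ m).symm
      rw [MonoidAlgebra.lift_single, map_one]
      exact (hsm c _).symm) hN hG hs d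
  refine ⟨c, ?_⟩
  apply toLin'.injective
  refine LinearMap.ext fun v => ?_
  rw [toLin'_apply (c • 1), smul_mulVec, one_mulVec]
  exact (LinearMap.congr_fun hc v).symm

end SplittingFields

/-! ### The residue field and lifting of roots of unity -/

section ResidueField

variable (p : ℕ) [Fact p.Prime]
variable (K : Type*) [Field K] [Algebra ℚ_[p] K] [Algebra.IsAlgebraic ℚ_[p] K]

open Polynomial

variable {p K} in
theorem mem_integers {x : K} : x ∈ integers p K ↔ spectralNorm ℚ_[p] K x ≤ 1 := Iff.rfl

theorem spectralNorm_map_mul (x y : K) :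
    spectralNorm ℚ_[p] K (x * y) = spectralNorm ℚ_[p] K x * spectralNorm ℚ_[p] K y :=
  map_mul (spectralMulAlgNorm ℚ_[p] K) x y

theorem spectralNorm_map_pow (x : K) (m : ℕ) :
    spectralNorm ℚ_[p] K (x ^ m) = spectralNorm ℚ_[p] K x ^ m :=
  map_pow (spectralMulAlgNorm ℚ_[p] K) x m

/-- The `p`-adic integers in the valuation ring of an extension. -/
noncomputable def padicIntHom : ℤ_[p] →+* integers p K where
  toFun c := ⟨algebraMap ℚ_[p] K c, by
    rw [mem_integers, spectralNorm_extends]; exact c.2⟩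
  map_one' := Subtype.ext (map_one (algebraMap ℚ_[p] K))
  map_mul' x y := Subtype.ext (by simp)
  map_zero' := Subtype.ext (by simp)
  map_add' x y := Subtype.ext (by simp)

instance charP_resF : CharP (ResF p K) p := by
  rw [CharP.charP_iff_prime_eq_zero (Fact.out : p.Prime), ← map_natCast (IsLocalRing.residue _),
    IsLocalRing.residue_eq_zero_iff, IsLocalRing.mem_maximalIdeal, mem_nonunits_iff]
  intro h
  obtain ⟨u, hu⟩ := h.exists_right_inv
  have h1 : (p : K) * u = 1 := by
    have := congrArg (Subtype.val : integers p K → K) hu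
    simpa using this
  have h2 := spectralNorm_map_mul p K (p : K) u
  have h3 : spectralNorm ℚ_[p] K (p : K) = ‖(p : ℚ_[p])‖ := by
    rw [← spectralNorm_extends (L := K) (p : ℚ_[p]), map_natCast]
  rw [h1, spectralNorm_one, h3] at h2
  have h4 : ‖(p : ℚ_[p])‖ < 1 := Padic.norm_p_lt_one
  have h5 : spectralNorm ℚ_[p] K (u : K) ≤ 1 := mem_integers.mp u.2
  have h6 := spectralNorm_nonneg (K := ℚ_[p]) (u : K)
  nlinarith [norm_nonneg (p : ℚ_[p])]

theorem residue_padicIntHom (b : ℤ_[p]) :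
    IsLocalRing.residue _ (padicIntHom p K b) = (b.zmodRepr : ResF p K) := by
  have h := PadicInt.sub_zmodRepr_mem b
  rw [PadicInt.maximalIdeal_eq_span_p, Ideal.mem_span_singleton] at h
  obtain ⟨c, hc⟩ := h
  rw [sub_eq_iff_eq_add] at hc
  rw [hc, map_add, map_add, map_mul, map_mul, map_natCast, map_natCast, map_natCast, map_natCast,
    CharP.cast_eq_zero, zero_mul, zero_add, ← hc]

/-- Lifts of residues linearly independent over 𝔽_p are linearly independent over ℚ_p, so the
residue degree is at most the degree of the extension. -/
instance finite_resF [FiniteDimensional ℚ_[p] K] : Finite (ResF p K) := by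
  classical
  let _ : Algebra (ZMod p) (ResF p K) := ZMod.algebra _ p
  have hrank : Module.rank (ZMod p) (ResF p K) ≤ Module.finrank ℚ_[p] K := by
    refine rank_le fun s hs => ?_
    choose X hX using IsLocalRing.residue_surjective (R := integers p K)
    have hli : LinearIndependent ℚ_[p] fun i : s => (X i : K) := by
      rw [Fintype.linearIndependent_iff]
      intro c hc
      by_contra! hne
      obtain ⟨i, hi⟩ := hne
      obtain ⟨i₀, -, hmax⟩ := Finset.exists_max_image Finset.univ (fun j => ‖c j‖)
        ⟨i, Finset.mem_univ i⟩
      have hpos : 0 < ‖c i₀‖ := (norm_pos_iff.mpr hi).trans_le (hmax i (Finset.mem_univ i))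
      -- Dividing the relation by a coefficient of maximal norm makes all coefficients integral and
      -- one of them equal to 1, so its reduction is a nontrivial relation.
      let b : s → ℤ_[p] := fun j => ⟨c j / c i₀, by
        rw [norm_div]; exact div_le_one_of_le₀ (hmax j (Finset.mem_univ j)) hpos.le⟩
      have h1 : ∑ j, padicIntHom p K (b j) * X j = 0 := by
        apply Subtype.ext
        have : ∑ j, algebraMap ℚ_[p] K (c j / c i₀) * (X j : K) = 0 := by
          have h2 : ∀ j, algebraMap ℚ_[p] K (c j / c i₀) * (X j : K)
              = (c i₀)⁻¹ • (c j • (X j : K)) := fun j => by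
            rw [Algebra.smul_def, Algebra.smul_def, ← mul_assoc, ← map_mul, div_eq_inv_mul]
          rw [Finset.sum_congr rfl fun j _ => h2 j, ← Finset.smul_sum, hc, smul_zero]
        rw [AddSubmonoidClass.coe_finsetSum]
        exact this
      have h2 : ∑ j : s, ((b j).zmodRepr : ZMod p) • (j : ResF p K) = 0 := by
        have h3 := congrArg (IsLocalRing.residue (integers p K)) h1
        rw [map_sum, map_zero] at h3
        rw [← h3]
        refine Finset.sum_congr rfl fun j _ => ?_
        rw [map_mul, residue_padicIntHom, hX, Algebra.smul_def, map_natCast]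
      have h4 := Fintype.linearIndependent_iff.mp hs _ h2 i₀
      have h5 : b i₀ = 1 := Subtype.ext (div_self (norm_pos_iff.mp hpos))
      rw [h5] at h4
      have h6 := residue_padicIntHom p K 1
      rw [map_one, map_one] at h6
      rw [ZMod.natCast_eq_zero_iff] at h4
      rw [(CharP.cast_eq_zero_iff (ResF p K) p _).mpr h4] at h6
      exact one_ne_zero h6
    have := hli.fintype_card_le_finrank
    rwa [Fintype.card_coe] at this
  have : Module.Finite (ZMod p) (ResF p K) :=
    Module.rank_lt_aleph0_iff.mp (hrank.trans_lt (Cardinal.natCast_lt_aleph0))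
  exact Module.finite_of_finite (ZMod p)

variable {p K}

theorem mem_integers_of_pow_eq_one {x : K} {m : ℕ} (hm : m ≠ 0) (hx : x ^ m = 1) :
    x ∈ integers p K := by
  have h := spectralNorm_map_pow p K x m
  rw [hx, spectralNorm_one] at h
  exact ((pow_eq_one_iff_of_nonneg (spectralNorm_nonneg x) hm).mp h.symm).le

theorem natCast_ne_zero_of_coprime {m : ℕ} (hm : p.Coprime m) : (m : ResF p K) ≠ 0 := by
  rw [Ne, CharP.cast_eq_zero_iff (ResF p K) p]
  intro h
  exact (Fact.out : p.Prime).one_lt.ne' (Nat.eq_one_of_dvd_coprimes hm (dvd_refl p) h)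

/-- If x ≠ 1, then 1 + x + ⋯ + x^(m-1) = 0, and reduction gives m = 0 in F, although m is prime to
p. Hence reduction is injective on roots of unity of order prime to p. -/
theorem eq_one_of_residue_eq_one {x : integers p K} {m : ℕ} (hm : p.Coprime m) (hx : x ^ m = 1)
    (h1 : IsLocalRing.residue _ x = 1) : x = 1 := by
  by_contra hne
  have h2 : (∑ i ∈ Finset.range m, x ^ i) * (x - 1) = 0 := by
    rw [geom_sum_mul, hx, sub_self]
  have h3 : ∑ i ∈ Finset.range m, x ^ i = 0 :=
    (mul_eq_zero.mp h2).resolve_right (sub_ne_zero.mpr hne)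
  have h4 := congrArg (IsLocalRing.residue (integers p K)) h3
  simp only [map_sum, map_pow, h1, one_pow, Finset.sum_const, Finset.card_range, nsmul_eq_mul,
    mul_one, map_zero] at h4
  exact natCast_ne_zero_of_coprime hm h4

theorem eq_of_residue_eq {x y : integers p K} {m m' : ℕ} (hm : p.Coprime m) (hx : x ^ m = 1)
    (hm' : p.Coprime m') (hy : y ^ m' = 1)
    (h : IsLocalRing.residue _ x = IsLocalRing.residue _ y) : x = y := by
  have hm0 : m' ≠ 0 := by
    rintro rfl
    exact (Fact.out : p.Prime).one_lt.ne' (by simpa using hm')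
  have hyy : y ^ (m' - 1) * y = 1 := by rw [← pow_succ, Nat.sub_add_cancel (by omega), hy]
  have h1 : y ^ (m' - 1) * x = 1 := by
    refine eq_one_of_residue_eq_one (m := m * m') (Nat.Coprime.mul_right hm hm') ?_ ?_
    · rw [mul_pow, pow_mul x, hx, one_pow, ← pow_mul, mul_comm m, ← mul_assoc, mul_comm _ m',
        mul_assoc, pow_mul, hy, one_pow, one_mul]
    · rw [map_mul, h, ← map_mul, hyy, map_one]
  calc x = (y ^ (m' - 1) * y) * x := by rw [hyy, one_mul]
    _ = y * (y ^ (m' - 1) * x) := by ring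
    _ = y := by rw [h1, mul_one]

theorem brauerLift_residue {ζ : integers p K} {m : ℕ} (hm : p.Coprime m) (hζ : ζ ^ m = 1) :
    brauerLift p K (IsLocalRing.residue _ ζ) = ζ := by
  have h : ∃ ξ : integers p K, (∃ m : ℕ, p.Coprime m ∧ ξ ^ m = 1) ∧
      IsLocalRing.residue (integers p K) ξ = IsLocalRing.residue _ ζ := ⟨ζ, ⟨m, hm, hζ⟩, rfl⟩
  rw [brauerLift, dif_pos h]
  obtain ⟨⟨m', hm', h1⟩, h2⟩ := h.choose_spec
  exact congrArg _ (eq_of_residue_eq hm' h1 hm hζ h2)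

/-- Reduction of a primitive root of unity of order prime to `p`. -/
theorem isPrimitiveRoot_residue {ζ : integers p K} {m : ℕ} (hm : p.Coprime m)
    (hζ : IsPrimitiveRoot (ζ : K) m) : IsPrimitiveRoot (IsLocalRing.residue _ ζ) m := by
  have hζ1 : ζ ^ m = 1 := Subtype.ext (by simpa using hζ.pow_eq_one)
  refine ⟨by rw [← map_pow, hζ1, map_one], fun l hl => ?_⟩
  refine hζ.dvd_of_pow_eq_one l ?_
  rw [← map_pow] at hl
  have := eq_one_of_residue_eq_one (m := m) hm (by rw [← pow_mul, mul_comm, pow_mul, hζ1, one_pow])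
    hl
  simpa using congrArg (Subtype.val : integers p K → K) this

theorem exists_primitiveRoot_integers {n m : ℕ} (hn : n ≠ 0) (hK : ∃ ζ : K, IsPrimitiveRoot ζ n)
    (hmn : m ∣ n) : ∃ ζ : integers p K, IsPrimitiveRoot (ζ : K) m := by
  obtain ⟨ζ, hζ⟩ := hK
  obtain ⟨l, rfl⟩ := hmn
  have h := hζ.pow (Nat.pos_of_ne_zero hn) (mul_comm m l)
  exact ⟨⟨ζ ^ l, mem_integers_of_pow_eq_one (left_ne_zero_of_mul hn) h.pow_eq_one⟩, h⟩

theorem exists_root_lift {n m : ℕ} (hn : n ≠ 0) (hK : ∃ ζ : K, IsPrimitiveRoot ζ n)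
    (hmn : m ∣ n) (hm : p.Coprime m) {x : ResF p K} (hx : x ^ m = 1) :
    ∃ ζ : integers p K, ζ ^ m = 1 ∧ IsLocalRing.residue _ ζ = x := by
  have hm0 : NeZero m := ⟨fun h => hn (by rw [h] at hmn; exact zero_dvd_iff.mp hmn)⟩
  obtain ⟨ζ, hζ⟩ := exists_primitiveRoot_integers (p := p) hn hK hmn
  obtain ⟨i, -, hi⟩ := (isPrimitiveRoot_residue hm hζ).eq_pow_of_pow_eq_one hx
  refine ⟨ζ ^ i, ?_, by rw [map_pow, hi]⟩
  rw [← pow_mul, mul_comm, pow_mul]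
  have : ζ ^ m = 1 := Subtype.ext (by simpa using hζ.pow_eq_one)
  rw [this, one_pow]

/-- In characteristic p the p-part of `N` only raises the polynomial for the p'-part to a power, and
the latter splits because a primitive root of unity of p'-order stays primitive under reduction. -/
theorem splits_X_pow_sub_one_resF {n N : ℕ} (hn : n ≠ 0) (hK : ∃ ζ : K, IsPrimitiveRoot ζ n)
    (hN : N ∣ n) : (X ^ N - 1 : (ResF p K)[X]).Splits := by
  have hN0 : N ≠ 0 := fun h => hn (by rw [h] at hN; exact zero_dvd_iff.mp hN)
  obtain ⟨a, m, hm, rfl⟩ := Nat.exists_eq_pow_mul_and_not_dvd hN0 p (Fact.out : p.Prime).ne_one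
  have hcop : p.Coprime m := ((Fact.out : p.Prime).coprime_iff_not_dvd).mpr hm
  obtain ⟨ζ, hζ⟩ := exists_primitiveRoot_integers (p := p) hn hK ((dvd_mul_left m _).trans hN)
  have h1 : (X ^ (p ^ a * m) - 1 : (ResF p K)[X]) = (X ^ m - 1) ^ p ^ a := by
    rw [sub_pow_char_pow, one_pow, ← pow_mul, mul_comm]
  rw [h1]
  exact (X_pow_sub_one_splits (isPrimitiveRoot_residue hcop hζ)).pow _

/-- The action of the Galois group on the valuation ring. -/
noncomputable def galIntegers : (K ≃ₐ[ℚ_[p]] K) →* RingAut (integers p K) where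
  toFun σ :=
    { toFun := fun x => ⟨σ x, by
        rw [mem_integers, ← spectralNorm_eq_of_equiv]; exact x.2⟩
      invFun := fun x => ⟨σ.symm x, by
        rw [mem_integers, ← spectralNorm_eq_of_equiv]; exact x.2⟩
      left_inv := fun x => Subtype.ext (σ.symm_apply_apply x)
      right_inv := fun x => Subtype.ext (σ.apply_symm_apply x)
      map_mul' := fun x y => Subtype.ext (map_mul σ _ _)
      map_add' := fun x y => Subtype.ext (map_add σ _ _) }
  map_one' := rfl
  map_mul' _ _ := rfl

/-- The action of the Galois group on the residue field. -/
noncomputable def galRes : (K ≃ₐ[ℚ_[p]] K) →* RingAut (ResF p K) :=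
  IsLocalRing.ResidueField.mapAut.comp galIntegers

theorem galRes_residue (σ : K ≃ₐ[ℚ_[p]] K) (x : integers p K) :
    galRes σ (IsLocalRing.residue _ x) = IsLocalRing.residue _ (galIntegers σ x) := rfl

theorem coe_galIntegers (σ : K ≃ₐ[ℚ_[p]] K) (x : integers p K) :
    (galIntegers σ x : K) = σ x := rfl

theorem brauerLift_galRes {ζ : integers p K} {m : ℕ} (hm : p.Coprime m) (hζ : ζ ^ m = 1)
    (σ : K ≃ₐ[ℚ_[p]] K) :
    brauerLift p K (galRes σ (IsLocalRing.residue _ ζ))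
      = σ (brauerLift p K (IsLocalRing.residue _ ζ)) := by
  rw [galRes_residue, brauerLift_residue hm hζ, brauerLift_residue hm, coe_galIntegers]
  rw [← map_pow, hζ, map_one]

end ResidueField

/-! ### Brauer characters of matrix representations, their reductions and Galois twists -/

section BrauerCharactersOfMatrixReps

variable {p : ℕ} [Fact p.Prime]
variable {K : Type*} [Field K] [Algebra ℚ_[p] K] [Algebra.IsAlgebraic ℚ_[p] K]
variable {G : Type*} [Group G]
variable {I J : Type*} [Fintype I] [DecidableEq I] [Fintype J] [DecidableEq J]

open Matrix Polynomial

/-- The Brauer character of a matrix representation. -/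
noncomputable def matBr (A : G →* Matrix I I (ResF p K)) : PReg p G → K :=
  fun g => ((A g.1).charpoly.roots.map (brauerLift p K)).sum

theorem brauerChar_eq_matBr {d : ℕ} (ρ : Representation (ResF p K) G (Fin d → ResF p K)) :
    brauerChar p K ρ = matBr (toMat ρ) := by
  funext g
  rw [brauerChar, matBr, toMat_apply, ← charpoly_toLin', toLin'_toMatrix']

theorem MatEqv.matBr_eq {A : G →* Matrix I I (ResF p K)} {B : G →* Matrix J J (ResF p K)}
    (h : MatEqv A B) : matBr A = matBr B := by
  funext g
  rw [matBr, matBr, h.charpoly_eq]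

theorem mem_IBr_iff {χ : PReg p G → K} :
    χ ∈ IBr p K G ↔
      ∃ (d : ℕ) (A : G →* Matrix (Fin d) (Fin d) (ResF p K)), MatIrr A ∧ matBr A = χ := by
  constructor
  · rintro ⟨d, ρ, h, rfl⟩
    exact ⟨d, toMat ρ, matIrr_toMat.mpr h, (brauerChar_eq_matBr ρ).symm⟩
  · rintro ⟨d, A, h, rfl⟩
    exact ⟨d, toRep A, irreducible_toRep_iff.mpr h, by rw [brauerChar_eq_matBr, toMat_toRep]⟩

/-- Change of the index type of a matrix representation. -/
def matReindex {k : Type*} [Field k] (e : I ≃ J) (A : G →* Matrix I I k) : G →* Matrix J J k :=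
  (reindexAlgEquiv k k e).toAlgHom.toMonoidHom.comp A

theorem matReindex_apply {k : Type*} [Field k] (e : I ≃ J) (A : G →* Matrix I I k) (g : G) :
    matReindex e A g = (A g).submatrix e.symm e.symm :=
  (congrFun (coe_reindexAlgEquiv k k e) (A g)).trans (reindex_apply e e (A g))

theorem matEqv_matReindex {k : Type*} [Field k] (e : I ≃ J) (A : G →* Matrix I I k) :
    MatEqv A (matReindex e A) := by
  refine ⟨(1 : Matrix I I k).submatrix e.symm id, (1 : Matrix I I k).submatrix id e.symm,
    ?_, ?_, fun g => ?_⟩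
  · rw [← submatrix_mul _ _ _ _ _ e.symm.bijective, Matrix.mul_one, submatrix_id_id]
  · rw [← submatrix_mul _ _ _ _ _ Function.bijective_id, Matrix.mul_one,
      submatrix_one_equiv]
  · rw [matReindex_apply, ← submatrix_mul _ _ _ _ _ e.symm.bijective, Matrix.mul_one]
    have : A g = (A g).submatrix id id := rfl
    conv_lhs => rw [this]
    rw [← submatrix_mul _ _ _ _ _ Function.bijective_id, Matrix.one_mul]

theorem exists_fin_matEqv {k : Type*} [Field k] (A : G →* Matrix I I k) :
    ∃ (d : ℕ) (B : G →* Matrix (Fin d) (Fin d) k), MatEqv A B :=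
  ⟨_, _, matEqv_matReindex (Fintype.equivFin I) A⟩

/-- Twist of a matrix representation by a field automorphism. -/
def matTwist {k : Type*} [Field k] (s : RingAut k) (A : G →* Matrix I I k) : G →* Matrix I I k :=
  (RingHom.mapMatrix (s : k →+* k)).toMonoidHom.comp A

theorem matTwist_apply {k : Type*} [Field k] (s : RingAut k) (A : G →* Matrix I I k) (g : G) :
    matTwist s A g = (A g).map s := rfl

/-- Entrywise application of the field automorphism is a semilinear bijection, so invariant
subspaces of the twist pull back to invariant subspaces of the original. -/
theorem MatIrr.twist {k : Type*} [Field k] (s : RingAut k) {A : G →* Matrix I I k}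
    (hA : MatIrr A) : MatIrr (matTwist s A) := by
  refine ⟨hA.1, fun U hU => ?_⟩
  let W : Submodule k (I → k) :=
    { carrier := {v | (fun i => s (v i)) ∈ U}
      add_mem' := fun {a b} ha hb => by
        have := U.add_mem ha hb
        simpa [Pi.add_def] using! this
      zero_mem' := by simp only [Set.mem_ofPred_eq, Pi.zero_apply, map_zero]; exact U.zero_mem
      smul_mem' := fun c v hv => by
        have := U.smul_mem (s c) hv
        simpa [Pi.smul_def] using! this }
  have hW : ∀ v : I → k, v ∈ U ↔ (fun i => s.symm (v i)) ∈ W := fun v => by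
    change _ ↔ (fun i => s (s.symm (v i))) ∈ U
    simp
  have := hA.2 W fun g v hv => by
    have h1 := hU g _ hv
    change (fun i => s ((A g *ᵥ v) i)) ∈ U
    convert! h1 using 1
    funext i
    simp [matTwist_apply, mulVec, dotProduct]
  refine this.imp (fun h => ?_) (fun h => ?_)
  · rw [eq_bot_iff]
    intro v hv
    rw [hW, h, Submodule.mem_bot] at hv
    rw [Submodule.mem_bot]
    funext i
    simpa using congrFun hv i
  · rw [eq_top_iff]
    intro v _
    rw [hW, h]; trivial

/-- The standing hypothesis that the exponent of `G` divides `n` and that `K` contains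
a primitive `n`-th root of unity. -/
def EnoughRoots (K : Type*) [Field K] (G : Type*) [Group G] : Prop :=
  ∃ n N : ℕ, n ≠ 0 ∧ (∃ ζ : K, IsPrimitiveRoot ζ n) ∧ N ∣ n ∧ ∀ g : G, g ^ N = 1

theorem EnoughRoots.subgroup (h : EnoughRoots K G) (H : Subgroup G) : EnoughRoots K H := by
  obtain ⟨n, N, h1, h2, h3, h4⟩ := h
  exact ⟨n, N, h1, h2, h3, fun g => Subtype.ext (h4 g)⟩

theorem MatIrr.schur_resF [FiniteDimensional ℚ_[p] K] (hG : EnoughRoots K G)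
    {A : G →* Matrix I I (ResF p K)} (hA : MatIrr A) : MatSchur A := by
  obtain ⟨n, N, h1, h2, h3, h4⟩ := hG
  exact hA.schur (fun h => h1 (by rw [h] at h3; exact zero_dvd_iff.mp h3)) h4
    (splits_X_pow_sub_one_resF h1 h2 h3)

theorem EnoughRoots.charpoly_splits (hG : EnoughRoots K G) (A : G →* Matrix I I (ResF p K))
    (g : G) : (A g).charpoly.Splits := by
  obtain ⟨n, N, h1, h2, h3, h4⟩ := hG
  exact charpoly_splits_of_pow_eq_one (N := N)
    (fun h => h1 (by rw [h] at h3; exact zero_dvd_iff.mp h3)) (by rw [← map_pow, h4, map_one])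
    (splits_X_pow_sub_one_resF h1 h2 h3)

theorem EnoughRoots.exists_lift_of_mem_roots (hG : EnoughRoots K G)
    (A : G →* Matrix I I (ResF p K)) (g : PReg p G) {x : ResF p K}
    (hx : x ∈ (A g.1).charpoly.roots) :
    ∃ (m : ℕ) (ζ : integers p K), p.Coprime m ∧ ζ ^ m = 1 ∧ IsLocalRing.residue _ ζ = x := by
  obtain ⟨n, N, h1, h2, h3, h4⟩ := hG
  have hI : Nonempty I := by
    by_contra hI
    rw [not_nonempty_iff] at hI
    have h5 : (A g.1).charpoly = 1 := by
      rw [Matrix.charpoly, det_isEmpty]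
    rw [h5, roots_one] at hx
    simp at hx
  have h5 : x ^ orderOf g.1 = 1 :=
    pow_eq_one_of_mem_spectrum (x := A g.1) (by rw [← map_pow, pow_orderOf_eq_one, map_one])
      (mem_spectrum_of_isRoot_charpoly (isRoot_of_mem_roots hx))
  obtain ⟨ζ, h6, h7⟩ := exists_root_lift (p := p) h1 h2
    ((orderOf_dvd_of_pow_eq_one (h4 g.1)).trans h3) g.2 h5
  exact ⟨_, ζ, g.2, h6, h7⟩

/-- Values of Brauer characters are integral and reduce to traces. -/
theorem EnoughRoots.exists_residue_matBr (hG : EnoughRoots K G) (A : G →* Matrix I I (ResF p K))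
    (g : PReg p G) :
    ∃ c : integers p K, (c : K) = matBr A g ∧ IsLocalRing.residue _ c = (A g.1).trace := by
  rw [trace_eq_sum_roots_charpoly_of_splits (hG.charpoly_splits A g.1)]
  have h := fun x hx => hG.exists_lift_of_mem_roots A g (x := x) hx
  unfold matBr
  generalize (A g.1).charpoly.roots = s at h
  induction s using Multiset.induction_on with
  | empty => exact ⟨0, by simp, by simp⟩
  | cons a s ih =>
    obtain ⟨c, h1, h2⟩ := ih fun x hx => h x (Multiset.mem_cons_of_mem hx)
    obtain ⟨m, ζ, hm, hζ, rfl⟩ := h a (Multiset.mem_cons_self a s)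
    refine ⟨ζ + c, ?_, ?_⟩
    · rw [Multiset.map_cons, Multiset.sum_cons, brauerLift_residue hm hζ, ← h1]; rfl
    · rw [Multiset.sum_cons, map_add, h2]

theorem EnoughRoots.matBr_twist (hG : EnoughRoots K G) (A : G →* Matrix I I (ResF p K))
    (σ : K ≃ₐ[ℚ_[p]] K) (g : PReg p G) :
    matBr (matTwist (galRes σ) A) g = σ (matBr A g) := by
  unfold matBr
  rw [matTwist_apply]
  have h1 : ((A g.1).map (galRes (p := p) σ)).charpoly
      = (A g.1).charpoly.map ((galRes (p := p) σ : RingAut (ResF p K)) : _ →+* _) :=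
    charpoly_map _ _
  rw [h1, (hG.charpoly_splits A g.1).roots_map, Multiset.map_map]
  have h2 := map_multiset_sum σ ((A g.1).charpoly.roots.map (brauerLift p K))
  rw [h2, Multiset.map_map]
  refine congrArg _ (Multiset.map_congr rfl fun x hx => ?_)
  obtain ⟨m, ζ, hm, hζ, rfl⟩ := hG.exists_lift_of_mem_roots A g hx
  exact brauerLift_galRes hm hζ σ

end BrauerCharactersOfMatrixReps

/-! ### Linear independence of irreducible Brauer characters -/

section LinearIndependence

variable {p : ℕ} [Fact p.Prime]
variable {K : Type*} [Field K] [Algebra ℚ_[p] K] [Algebra.IsAlgebraic ℚ_[p] K]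
variable {G : Type*} [Group G]
variable {I J : Type*} [Fintype I] [DecidableEq I] [Fintype J] [DecidableEq J]

open Matrix Polynomial

/-- Over 𝔽_q the trace of M^q is the q-th power of the trace of M, which is the trace itself. -/
theorem trace_pow_card_pow {k : Type*} [Field k] [Fintype k] (M : Matrix I I k) (b : ℕ) :
    (M ^ Fintype.card k ^ b).trace = M.trace := by
  induction b with
  | zero => simp
  | succ b ih => rw [pow_succ, pow_mul, FiniteField.trace_pow_card, FiniteField.pow_card, ih]

/-- Traces over a finite field only depend on `p`-regular parts. -/
theorem exists_pReg_trace_eq [FiniteDimensional ℚ_[p] K] (hG : EnoughRoots K G) (g : G) :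
    ∃ (j : ℕ) (x : PReg p G), x.1 = g ^ j ∧
      ∀ {d : ℕ} (A : G →* Matrix (Fin d) (Fin d) (ResF p K)), (A x.1).trace = (A g).trace := by
  have := Fintype.ofFinite (ResF p K)
  obtain ⟨n, N, h1, h2, h3, h4⟩ := hG
  have hg0 : orderOf g ≠ 0 := by
    have : N ≠ 0 := fun h => h1 (by rw [h] at h3; exact zero_dvd_iff.mp h3)
    intro h
    have h5 := orderOf_dvd_of_pow_eq_one (h4 g)
    rw [h] at h5
    exact this (zero_dvd_iff.mp h5)
  obtain ⟨a, m, hm, hgm⟩ := Nat.exists_eq_pow_mul_and_not_dvd hg0 p (Fact.out : p.Prime).ne_one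
  have hcop : p.Coprime m := ((Fact.out : p.Prime).coprime_iff_not_dvd).mpr hm
  obtain ⟨f, -, hf⟩ := FiniteField.card (ResF p K) p
  -- With |F| = p^f and f ≥ 1, the exponent |F|^a is divisible by p^a, the p-part of the order of
  -- `g`. Thus this power of `g` is p-regular, while its trace is the trace of `g`.
  have hord : (g ^ Fintype.card (ResF p K) ^ a) ^ m = 1 := by
    rw [← pow_mul, ← orderOf_dvd_iff_pow_eq_one, hgm, hf]
    refine mul_dvd_mul ?_ (dvd_refl m)
    exact pow_dvd_pow_of_dvd (dvd_pow_self p f.pos.ne') a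
  refine ⟨_, ⟨g ^ Fintype.card (ResF p K) ^ a,
    hcop.coprime_dvd_right (orderOf_dvd_of_pow_eq_one hord)⟩, rfl, fun A => ?_⟩
  rw [map_pow, trace_pow_card_pow]

/-- Reducing the relation modulo the maximal ideal yields a relation between traces on p-regular
elements, hence on all elements; traces of inequivalent absolutely irreducible representations are
independent over F. -/
theorem dvd_of_sum_smul_matBr_eq_zero [FiniteDimensional ℚ_[p] K] (hG : EnoughRoots K G)
    {ι : Type*} [Fintype ι] {d : ι → ℕ} (A : ∀ i, G →* Matrix (Fin (d i)) (Fin (d i)) (ResF p K))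
    (hirr : ∀ i, MatIrr (A i)) (hne : ∀ i j, MatEqv (A i) (A j) → i = j) (c : ι → ℤ)
    (hc : ∑ i, c i • matBr (A i) = 0) (i : ι) : (p : ℤ) ∣ c i := by
  rw [← CharP.intCast_eq_zero_iff (ResF p K) p]
  refine eq_zero_of_sum_trace_eq_zero A hirr (fun i => (hirr i).schur_resF hG) hne
    (fun i => (c i : ResF p K)) (fun g => ?_) i
  obtain ⟨j, x, -, hx⟩ := exists_pReg_trace_eq (p := p) hG g
  simp only [← hx]
  choose b hb1 hb2 using fun i => hG.exists_residue_matBr (A i) x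
  have h1 : ∑ i, (c i : integers p K) * b i = 0 := by
    apply Subtype.ext
    have := congrFun hc x
    simp only [Finset.sum_apply, Pi.smul_apply, Pi.zero_apply] at this
    simp only [zsmul_eq_mul, ← hb1] at this
    rw [AddSubmonoidClass.coe_finsetSum]
    simpa using this
  have h2 := congrArg (IsLocalRing.residue (integers p K)) h1
  simpa [hb2] using h2

/-- The irreducible Brauer characters are linearly independent over `ℤ`. -/
theorem linearIndependent_IBr [FiniteDimensional ℚ_[p] K] (hG : EnoughRoots K G) :
    LinearIndependent ℤ (fun χ : IBr p K G => (χ : PReg p G → K)) := by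
  classical
  have : CharZero K := charZero_of_injective_algebraMap (algebraMap ℚ_[p] K).injective
  choose d A hA hχ using fun χ : IBr p K G => mem_IBr_iff.mp χ.2
  rw [linearIndependent_iff']
  intro s c hc i hi
  -- Descent: after dividing a relation by `p` it is again a relation, so every coefficient is
  -- divisible by every power of `p`.
  have hall : ∀ (r : ℕ) (c : s → ℤ), ∑ i, c i • matBr (A i) = 0 → ∀ i, (p : ℤ) ^ r ∣ c i := by
    intro r
    induction r with
    | zero => intro c _ i; simp
    | succ r ih =>
      intro c hc i
      have hdvd := dvd_of_sum_smul_matBr_eq_zero hG (fun i : s => A i) (fun i => hA i)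
        (fun i j h => Subtype.ext (Subtype.ext (by rw [← hχ i, ← hχ j, h.matBr_eq]))) c hc
      choose b hb using hdvd
      have hp : (p : ℤ) ≠ 0 := by exact_mod_cast (Fact.out : p.Prime).ne_zero
      have h1 : ∑ i, b i • matBr (A i) = 0 := by
        have h2 : (p : ℤ) • ∑ i, b i • matBr (A i) = 0 := by
          rw [Finset.smul_sum, ← hc]
          exact Finset.sum_congr rfl fun i _ => by rw [smul_smul, ← hb]
        exact (smul_eq_zero.mp h2).resolve_left hp
      rw [hb, pow_succ']
      exact mul_dvd_mul_left _ (ih b h1 i)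
  have hc' : ∑ i : s, c i • matBr (A i) = 0 := by
    rw [← Finset.sum_coe_sort s] at hc
    simpa only [hχ] using hc
  -- The power of `p` with exponent |c i| + 1 exceeds |c i|, so divisibility forces the coefficient
  -- to vanish.
  have h1 := hall (c i).natAbs.succ (fun i => c i) hc' ⟨i, hi⟩
  by_contra h0
  have h2 := Int.natAbs_dvd_natAbs.mpr h1
  rw [Int.natAbs_pow, Int.natAbs_natCast] at h2
  have h3 := Nat.le_of_dvd (Int.natAbs_pos.mpr h0) h2
  have h4 := Nat.lt_pow_self (n := (c i).natAbs.succ) (Fact.out : p.Prime).one_lt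
  omega

theorem MatIrr.matBr_mem_IBr {A : G →* Matrix I I (ResF p K)} (hA : MatIrr A) :
    matBr A ∈ IBr p K G := by
  obtain ⟨d, B, hB⟩ := exists_fin_matEqv A
  exact mem_IBr_iff.mpr ⟨d, B, hB.irr hA, hB.matBr_eq.symm⟩

/-- Irreducible representations with the same Brauer character are equivalent. -/
theorem MatIrr.eqv_of_matBr_eq [FiniteDimensional ℚ_[p] K] (hG : EnoughRoots K G)
    {A : G →* Matrix I I (ResF p K)} {B : G →* Matrix J J (ResF p K)} (hA : MatIrr A)
    (hB : MatIrr B) (h : matBr A = matBr B) : MatEqv A B := by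
  obtain ⟨d, A', hA'⟩ := exists_fin_matEqv A
  obtain ⟨e, B', hB'⟩ := exists_fin_matEqv B
  refine hA'.trans (MatEqv.trans ?_ hB'.symm)
  by_contra hne
  -- If the two were inequivalent, their difference would be a relation with coefficients 1 and -1,
  -- which `p` does not divide.
  have h1 := dvd_of_sum_smul_matBr_eq_zero hG (ι := Bool) (d := fun b => cond b d e)
    (fun b => match b with
      | true => A'
      | false => B') (by rintro (_ | _); exacts [hB'.irr hB, hA'.irr hA])
    (by
      rintro (_ | _) (_ | _) hab
      exacts [rfl, absurd hab.symm hne, absurd hab hne, rfl])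
    (fun b => cond b 1 (-1))
    (by simp [← hA'.matBr_eq, ← hB'.matBr_eq, h]) true
  have h2 := Int.le_of_dvd (by simp) h1
  have h3 := (Fact.out : p.Prime).one_lt
  simp at h2
  omega

end LinearIndependence

/-! ### Tensor correspondence between representations of two quotients of one group -/

section Correspondence

open Matrix Kronecker

variable {k : Type*} [Field k] {Γ J J₁ : Type*} [Group Γ] [Group J] [Group J₁]
variable {D I I' L L' : Type*} [Fintype D] [DecidableEq D] [Fintype I] [DecidableEq I]
  [Fintype I'] [DecidableEq I'] [Fintype L] [DecidableEq L] [Fintype L'] [DecidableEq L']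

theorem exists_monoidHom_of_surjective {N : Type*} [Monoid N] {f : Γ →* J}
    (hf : Function.Surjective f) (g : Γ →* N) (h : ∀ x ∈ f.ker, g x = 1) :
    ∃ g' : J →* N, ∀ x, g' (f x) = g x := by
  have key : ∀ x y, f x = f y → g x = g y := fun x y hxy => by
    have h1 : x * y⁻¹ ∈ f.ker := by rw [MonoidHom.mem_ker, map_mul, map_inv, hxy, mul_inv_cancel]
    calc g x = g (x * y⁻¹ * y) := by group
      _ = g y := by rw [map_mul, h _ h1, one_mul]
  refine ⟨{ toFun := fun j => g (Function.surjInv hf j), map_one' := ?_, map_mul' := ?_ }, ?_⟩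
  · rw [key _ 1 (by rw [Function.surjInv_eq hf, map_one]), map_one]
  · intro a b
    rw [← map_mul]
    exact key _ _ (by rw [map_mul, Function.surjInv_eq hf, Function.surjInv_eq hf, Function.surjInv_eq hf])
  · intro x
    exact key _ _ (Function.surjInv_eq hf _)

/-- The tensor product of two matrix representations. -/
def matKron (M : Γ →* Matrix D D k) (B : Γ →* Matrix I I k) :
    Γ →* Matrix (D × I) (D × I) k where
  toFun x := M x ⊗ₖ B x
  map_one' := by rw [map_one, map_one, one_kronecker_one]
  map_mul' x y := by rw [map_mul, map_mul, mul_kronecker_mul]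

theorem matKron_apply (M : Γ →* Matrix D D k) (B : Γ →* Matrix I I k) (x : Γ) :
    matKron M B x = M x ⊗ₖ B x := rfl

/-- The situation of a projective representation, presented by a group `Γ` with two quotients
`J` and `J₁`: the kernel of the second map spans the full matrix algebra, and
the kernel of the first map acts by scalars. -/
structure TripleLink (α : Γ →* J) (π : Γ →* J₁) (M : Γ →* Matrix D D k) : Prop where
  surj_left : Function.Surjective α
  surj_right : Function.Surjective π
  span_eq_top : Submodule.span k (Set.range fun x : π.ker => M x) = ⊤
  scalar : ∀ x ∈ α.ker, ∃ c : k, M x = c • (1 : Matrix D D k)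
  nonempty : Nonempty D

/-- A representation of `J` and a representation of `J₁` correspond to each other. -/
def Corr (α : Γ →* J) (π : Γ →* J₁) (M : Γ →* Matrix D D k) (A : J →* Matrix I I k)
    (B : J₁ →* Matrix I' I' k) : Prop :=
  MatEqv (matKron M (B.comp π)) (A.comp α)

theorem MatIrr.comp_iff {α : Γ →* J} (hα : Function.Surjective α) {A : J →* Matrix I I k} :
    MatIrr (A.comp α) ↔ MatIrr A := by
  refine and_congr_right fun _ => forall_congr' fun U => imp_congr_left ?_
  exact ⟨fun h g => by obtain ⟨x, rfl⟩ := hα g; exact h x, fun h x => h _⟩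

theorem MatEqv.comp_iff {α : Γ →* J} (hα : Function.Surjective α) {A : J →* Matrix I I k}
    {B : J →* Matrix I' I' k} : MatEqv (A.comp α) (B.comp α) ↔ MatEqv A B := by
  constructor
  · rintro ⟨P, Q, h1, h2, h3⟩
    exact ⟨P, Q, h1, h2, fun g => by obtain ⟨x, rfl⟩ := hα g; exact h3 x⟩
  · rintro ⟨P, Q, h1, h2, h3⟩
    exact ⟨P, Q, h1, h2, fun x => h3 _⟩

theorem MatEqv.kron (M : Γ →* Matrix D D k) {B : Γ →* Matrix I I k} {B' : Γ →* Matrix I' I' k}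
    (h : MatEqv B B') : MatEqv (matKron M B) (matKron M B') := by
  obtain ⟨P, Q, h1, h2, h3⟩ := h
  refine ⟨1 ⊗ₖ P, 1 ⊗ₖ Q, ?_, ?_, fun x => ?_⟩
  · rw [← mul_kronecker_mul, h1, Matrix.one_mul, one_kronecker_one]
  · rw [← mul_kronecker_mul, h2, Matrix.one_mul, one_kronecker_one]
  · rw [matKron_apply, matKron_apply, ← mul_kronecker_mul, ← mul_kronecker_mul, h3,
      Matrix.one_mul, Matrix.mul_one]

theorem one_kronecker_injective {D I I' : Type*} [DecidableEq D] [Nonempty D] :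
    Function.Injective fun S : Matrix I I' k => (1 : Matrix D D k) ⊗ₖ S := by
  intro S S' h
  obtain ⟨a⟩ := ‹Nonempty D›
  ext i j
  have := congrFun (congrFun h (a, i)) (a, j)
  simpa [kronecker_apply] using this

/-- A matrix commuting with all `X ⊗ 1` is of the form `1 ⊗ S`. -/
theorem exists_one_kronecker [Nonempty D] {T : Matrix (D × I) (D × I') k}
    (h : ∀ X : Matrix D D k, (X ⊗ₖ (1 : Matrix I I k)) * T = T * (X ⊗ₖ (1 : Matrix I' I' k))) :
    ∃ S : Matrix I I' k, T = (1 : Matrix D D k) ⊗ₖ S := by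
  obtain ⟨d⟩ := ‹Nonempty D›
  -- Commutation with the matrix unit at (a, b), read off at the entry ((a, i), (c, j)):
  -- off-diagonal blocks vanish and all diagonal blocks agree.
  have key : ∀ a b c i j, T (b, i) (c, j) = if b = c then T (a, i) (a, j) else 0 := by
    intro a b c i j
    have h1 := congrFun (congrFun (h (single a b 1)) (a, i)) (c, j)
    simp only [mul_apply, kronecker_apply, Fintype.sum_prod_type, single_apply, one_apply] at h1
    simp only [mul_ite, mul_one, mul_zero, ite_mul, one_mul, zero_mul, Finset.sum_ite_eq,
      Finset.sum_ite_eq', Finset.mem_univ, if_true, true_and] at h1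
    by_cases hbc : b = c
    · subst hbc; simpa using h1
    · simpa [hbc] using h1
  refine ⟨Matrix.of fun i j => T (d, i) (d, j), ?_⟩
  ext ⟨b, i⟩ ⟨c, j⟩
  rw [key d b c i j, kronecker_apply, one_apply, of_apply]
  split_ifs <;> simp

variable {α : Γ →* J} {π : Γ →* J₁} {M : Γ →* Matrix D D k}

theorem TripleLink.forall_of_ker (hL : TripleLink α π M) (S : Submodule k (Matrix D D k))
    (h : ∀ x ∈ π.ker, M x ∈ S) (X : Matrix D D k) : X ∈ S := by
  have h1 : (⊤ : Submodule k (Matrix D D k)) ≤ S := by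
    rw [← hL.span_eq_top, Submodule.span_le]
    rintro _ ⟨x, rfl⟩
    exact h x.1 x.2
  exact h1 trivial

theorem TripleLink.exists_one_kronecker (hL : TripleLink α π M) {T : Matrix (D × I) (D × I') k}
    (h : ∀ x ∈ π.ker, (M x ⊗ₖ (1 : Matrix I I k)) * T = T * (M x ⊗ₖ (1 : Matrix I' I' k))) :
    ∃ S : Matrix I I' k, T = (1 : Matrix D D k) ⊗ₖ S := by
  have := hL.nonempty
  refine ModRep.exists_one_kronecker fun X => ?_
  refine hL.forall_of_ker
    { carrier := {X | (X ⊗ₖ (1 : Matrix I I k)) * T = T * (X ⊗ₖ (1 : Matrix I' I' k))}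
      add_mem' := fun {a b} ha hb => by
        change _ * _ = _ * _ at ha hb ⊢
        rw [add_kronecker, add_kronecker, Matrix.add_mul, Matrix.mul_add, ha, hb]
      zero_mem' := by
        change _ * _ = _ * _
        rw [zero_kronecker, zero_kronecker, Matrix.zero_mul, Matrix.mul_zero]
      smul_mem' := fun c a ha => by
        change _ * _ = _ * _ at ha ⊢
        rw [smul_kronecker, smul_kronecker, Matrix.smul_mul, Matrix.mul_smul, ha] } h X

theorem inv_kronecker_cancel {I I' : Type*} [Fintype I] [DecidableEq I] {x : Γ}
    {S S' : Matrix I I' k} (M : Γ →* Matrix D D k) [Nonempty D]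
    (h : M x ⊗ₖ S = M x ⊗ₖ S') : S = S' := by
  apply one_kronecker_injective (D := D)
  have h1 := congrArg (fun T => (M x⁻¹ ⊗ₖ (1 : Matrix I I k)) * T) h
  simp only [← mul_kronecker_mul, ← map_mul, inv_mul_cancel, map_one, Matrix.one_mul] at h1
  exact h1

/-- On ker π the tensor products are `M x ⊗ 1`, and these matrices generate the whole matrix
algebra. An intertwiner therefore has the form 1 ⊗ S, and cancelling the invertible factor `M x`
shows that S intertwines `B` with `B'`. -/
theorem TripleLink.eqv_of_kron_eqv (hL : TripleLink α π M) {B : J₁ →* Matrix I I k}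
    {B' : J₁ →* Matrix I' I' k}
    (h : MatEqv (matKron M (B.comp π)) (matKron M (B'.comp π))) : MatEqv B B' := by
  have := hL.nonempty
  obtain ⟨P, Q, h1, h2, h3⟩ := h
  have h4 := h3
  have hQ : ∀ x, Q * matKron M (B'.comp π) x = matKron M (B.comp π) x * Q := fun x => by
    calc Q * matKron M (B'.comp π) x = Q * matKron M (B'.comp π) x * (P * Q) := by
          rw [h2, Matrix.mul_one]
      _ = Q * (P * matKron M (B.comp π) x) * Q := by rw [h3]; simp only [Matrix.mul_assoc]
      _ = _ := by rw [← Matrix.mul_assoc, h1, Matrix.one_mul]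
  have hk : ∀ x ∈ π.ker, matKron M (B.comp π) x = M x ⊗ₖ 1 := fun x hx => by
    rw [matKron_apply, MonoidHom.comp_apply, (MonoidHom.mem_ker).mp hx, map_one]
  have hk' : ∀ x ∈ π.ker, matKron M (B'.comp π) x = M x ⊗ₖ 1 := fun x hx => by
    rw [matKron_apply, MonoidHom.comp_apply, (MonoidHom.mem_ker).mp hx, map_one]
  obtain ⟨S, rfl⟩ := hL.exists_one_kronecker (T := P) fun x hx => by
    rw [← hk x hx, ← hk' x hx, h3]
  obtain ⟨S', rfl⟩ := hL.exists_one_kronecker (T := Q) fun x hx => by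
    rw [← hk x hx, ← hk' x hx, hQ]
  refine ⟨S, S', one_kronecker_injective (D := D) ?_, one_kronecker_injective (D := D) ?_,
    fun g => ?_⟩
  · simpa [← mul_kronecker_mul] using h1
  · simpa [← mul_kronecker_mul] using h2
  · obtain ⟨x, rfl⟩ := hL.surj_right g
    refine inv_kronecker_cancel M (x := x) ?_
    simpa [matKron_apply, ← mul_kronecker_mul] using h3 x

theorem TripleLink.eqv_right (hL : TripleLink α π M) {A : J →* Matrix I I k}
    {A' : J →* Matrix I' I' k} {B : J₁ →* Matrix L L k} {B' : J₁ →* Matrix L' L' k}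
    (h : Corr α π M A B) (h' : Corr α π M A' B') (hA : MatEqv A A') : MatEqv B B' :=
  hL.eqv_of_kron_eqv (h.trans (((MatEqv.comp_iff hL.surj_left).mpr hA).trans h'.symm))

theorem TripleLink.eqv_left (hL : TripleLink α π M) {A : J →* Matrix I I k}
    {A' : J →* Matrix I' I' k} {B : J₁ →* Matrix L L k} {B' : J₁ →* Matrix L' L' k}
    (h : Corr α π M A B) (h' : Corr α π M A' B') (hB : MatEqv B B') : MatEqv A A' :=
  (MatEqv.comp_iff hL.surj_left).mp (h.symm.trans
    ((((MatEqv.comp_iff hL.surj_right).mpr hB).kron M).trans h'))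

theorem kronecker_mulVec_single {D I : Type*} [Fintype D] [Fintype I] (X : Matrix D D k) (Y : Matrix I I k) (v : D × I → k) (a : D)
    (i : I) : ((X ⊗ₖ Y) *ᵥ v) (a, i) = ∑ b, X a b * (Y *ᵥ fun j => v (b, j)) i := by
  simp only [mulVec, dotProduct, kronecker_apply, Fintype.sum_prod_type, Finset.mul_sum, mul_assoc]

/-- A subspace stable under R(ker π) ⊗ 1 is stable under the full matrix algebra on the left factor,
hence of the form k^D ⊗ W. Composing `M x ⊗ B (π x)` with `M x⁻¹ ⊗ 1` shows that W is stable under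
`B`, so invariant subspaces of the two sides match. -/
theorem TripleLink.irr_kron_iff (hL : TripleLink α π M) {B : J₁ →* Matrix I I k} :
    MatIrr (matKron M (B.comp π)) ↔ MatIrr B := by
  obtain ⟨d⟩ := hL.nonempty
  constructor
  · rintro ⟨⟨⟨-, i⟩⟩, h⟩
    refine ⟨⟨i⟩, fun W hW => ?_⟩
    let U : Submodule k (D × I → k) :=
      { carrier := {v | ∀ a, (fun i => v (a, i)) ∈ W}
        add_mem' := fun {u v} hu hv a => W.add_mem (hu a) (hv a)
        zero_mem' := fun a => W.zero_mem
        smul_mem' := fun c v hv a => W.smul_mem c (hv a) }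
    have hU := h U fun x v hv a => by
      have h1 : (fun i => (matKron M (B.comp π) x *ᵥ v) (a, i))
          = ∑ b, M x a b • (B (π x) *ᵥ fun j => v (b, j)) := by
        funext i
        rw [matKron_apply, kronecker_mulVec_single, Finset.sum_apply]
        rfl
      rw [h1]
      exact W.sum_mem fun b _ => W.smul_mem _ (hW _ _ (hv b))
    refine hU.imp (fun h => ?_) (fun h => ?_)
    · rw [eq_bot_iff]
      intro w hw
      have h1 : (fun x : D × I => w x.2) ∈ U := fun a => hw
      rw [h, Submodule.mem_bot] at h1
      rw [Submodule.mem_bot]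
      funext i
      exact congrFun h1 (d, i)
    · rw [eq_top_iff]
      intro w _
      have h1 : (fun x : D × I => w x.2) ∈ U := h ▸ trivial
      exact h1 d
  · rintro ⟨⟨i⟩, h⟩
    refine ⟨⟨(d, i)⟩, fun U hU => ?_⟩
    have hX : ∀ (X : Matrix D D k) (v : D × I → k), v ∈ U → (X ⊗ₖ (1 : Matrix I I k)) *ᵥ v ∈ U := by
      intro X v hv
      refine hL.forall_of_ker
        { carrier := {X | (X ⊗ₖ (1 : Matrix I I k)) *ᵥ v ∈ U}
          add_mem' := fun {a b} ha hb => by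
            change _ ∈ U at ha hb ⊢
            rw [add_kronecker, add_mulVec]
            exact U.add_mem ha hb
          zero_mem' := by
            change _ ∈ U
            rw [zero_kronecker, zero_mulVec]
            exact U.zero_mem
          smul_mem' := fun c a ha => by
            change _ ∈ U at ha ⊢
            rw [smul_kronecker, smul_mulVec]
            exact U.smul_mem c ha } (fun x hx => ?_) X
      have := hU x v hv
      rwa [matKron_apply, MonoidHom.comp_apply, (MonoidHom.mem_ker).mp hx, map_one] at this
    let ins : D → (I → k) → (D × I → k) := fun a w x => if x.1 = a then w x.2 else 0
    have hins : ∀ a b (v : D × I → k),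
        ((single a b 1 : Matrix D D k) ⊗ₖ (1 : Matrix I I k)) *ᵥ v = ins a fun i => v (b, i) := by
      intro a b v
      funext ⟨c, i⟩
      rw [kronecker_mulVec_single]
      simp only [one_mulVec, single_apply, ins]
      by_cases hca : c = a
      · subst hca; simp
      · simp [hca, Ne.symm hca]
    have hdec : ∀ v : D × I → k, v = ∑ a, ins a fun i => v (a, i) := by
      intro v
      funext ⟨c, i⟩
      simp [Finset.sum_apply, ins]
    let W : Submodule k (I → k) :=
      { carrier := {w | ins d w ∈ U}
        add_mem' := fun {u v} hu hv => by
          have h1 : ins d (u + v) = ins d u + ins d v := by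
            funext x
            simp only [ins, Pi.add_apply]; split_ifs <;> simp
          change ins d (u + v) ∈ U
          rw [h1]; exact U.add_mem hu hv
        zero_mem' := by
          have h1 : ins d 0 = 0 := by
            funext x
            simp [ins]
          change ins d 0 ∈ U
          rw [h1]; exact U.zero_mem
        smul_mem' := fun c v hv => by
          have h1 : ins d (c • v) = c • ins d v := by
            funext x
            simp [ins]
          change ins d (c • v) ∈ U
          rw [h1]; exact U.smul_mem c hv }
    have hW := h W fun g w hw => by
      obtain ⟨x, rfl⟩ := hL.surj_right g
      have h1 := hX (M x⁻¹) _ (hU x _ hw)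
      rw [matKron_apply, mulVec_mulVec, ← mul_kronecker_mul, ← map_mul, inv_mul_cancel, map_one,
        Matrix.one_mul] at h1
      change ins d _ ∈ U
      convert! h1 using 1
      funext ⟨c, i⟩
      rw [kronecker_mulVec_single]
      simp only [one_apply, ins, MonoidHom.comp_apply]
      by_cases hcd : c = d
      · subst hcd; simp
      · have h0 : (fun _ : I => (0 : k)) = 0 := rfl
        simp [hcd, h0]
    refine hW.imp (fun h => ?_) (fun h => ?_)
    · rw [eq_bot_iff]
      intro v hv
      rw [Submodule.mem_bot]
      funext ⟨a, i⟩
      have h1 : (fun i => v (a, i)) ∈ W := by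
        have h2 := hX (single d a 1) _ hv
        rw [hins d a v] at h2
        exact h2
      rw [h, Submodule.mem_bot] at h1
      exact congrFun h1 i
    · rw [eq_top_iff]
      intro v _
      rw [hdec v]
      refine U.sum_mem fun a _ => ?_
      have h1 : (fun i => v (a, i)) ∈ W := h ▸ trivial
      have h2 := hX (single a d 1) _ h1
      rw [hins] at h2
      simpa [ins] using h2

theorem TripleLink.irr_iff (hL : TripleLink α π M) {A : J →* Matrix I I k}
    {B : J₁ →* Matrix L L k} (h : Corr α π M A B) : MatIrr A ↔ MatIrr B := by
  rw [← MatIrr.comp_iff hL.surj_left, ← hL.irr_kron_iff]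
  exact ⟨h.symm.irr, h.irr⟩

theorem TripleLink.exists_left (hL : TripleLink α π M) {B : J₁ →* Matrix I I k}
    (h : ∀ x ∈ α.ker, M x ⊗ₖ B (π x) = 1) :
    ∃ A : J →* Matrix (D × I) (D × I) k, Corr α π M A B := by
  obtain ⟨A, hA⟩ := exists_monoidHom_of_surjective hL.surj_left (matKron M (B.comp π)) h
  refine ⟨A, ?_⟩
  have : A.comp α = matKron M (B.comp π) := MonoidHom.ext hA
  rw [Corr, this]
  exact MatEqv.refl _

/-- The kernel of `α` acts trivially on the tensor product. -/
theorem Corr.kron_eq_one {A : J →* Matrix I I k} {B : J₁ →* Matrix L L k}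
    (h : Corr α π M A B) {x : Γ} (hx : x ∈ α.ker) : M x ⊗ₖ B (π x) = 1 := by
  obtain ⟨P, Q, h1, h2, h3⟩ := h
  have h4 := h3 x
  rw [MonoidHom.comp_apply, (MonoidHom.mem_ker).mp hx, map_one, Matrix.one_mul] at h4
  have h5 := congrArg (Q * ·) h4
  simp only [← Matrix.mul_assoc, h1, Matrix.one_mul] at h5
  exact h5

theorem map_mul_ringAut {X Y W : Type*} [Fintype Y] (s : RingAut k) (U : Matrix X Y k)
    (V : Matrix Y W k) : (U * V).map s = U.map s * V.map s :=
  Matrix.map_mul (f := (s : k →+* k))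

/-- The twist of a correspondence by a field automorphism and compatible group homomorphisms. -/
theorem Corr.twist {A : J →* Matrix I I k} {B : J₁ →* Matrix L L k} (h : Corr α π M A B)
    {Γ' J' J₁' : Type*} [Group Γ'] [Group J'] [Group J₁'] {α' : Γ' →* J'} {π' : Γ' →* J₁'}
    {M' : Γ' →* Matrix D D k} {A' : J' →* Matrix I I k} {B' : J₁' →* Matrix L L k}
    (s : RingAut k) (a : Γ → Γ') (ha : Function.Surjective a) (T T' : Matrix D D k)
    (hT : T' * T = 1) (hT' : T * T' = 1) (hM : ∀ x, T * (M x).map s = M' (a x) * T)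
    (hA : ∀ x, A' (α' (a x)) = (A (α x)).map s) (hB : ∀ x, B' (π' (a x)) = (B (π x)).map s) :
    Corr α' π' M' A' B' := by
  obtain ⟨P, Q, h1, h2, h3⟩ := h
  have e1 : Q.map s * P.map s = 1 := by
    rw [← map_mul_ringAut, h1, Matrix.map_one s (map_zero s) (map_one s)]
  have e2 : P.map s * Q.map s = 1 := by
    rw [← map_mul_ringAut, h2, Matrix.map_one s (map_zero s) (map_one s)]
  obtain ⟨X, hX⟩ : ∃ X : Matrix (D × L) (D × L) k, X = T ⊗ₖ 1 := ⟨_, rfl⟩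
  obtain ⟨X', hX'⟩ : ∃ X : Matrix (D × L) (D × L) k, X = T' ⊗ₖ 1 := ⟨_, rfl⟩
  have t1 : X' * X = 1 := by
    rw [hX, hX', ← mul_kronecker_mul, hT, Matrix.one_mul, one_kronecker_one]
  have t2 : X * X' = 1 := by
    rw [hX, hX', ← mul_kronecker_mul, hT', Matrix.one_mul, one_kronecker_one]
  refine ⟨P.map s * X', X * Q.map s, ?_, ?_, fun y => ?_⟩
  · rw [Matrix.mul_assoc, ← Matrix.mul_assoc (Q.map s), e1, Matrix.one_mul, t2]
  · rw [Matrix.mul_assoc, ← Matrix.mul_assoc X', t1, Matrix.one_mul, e2]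
  · obtain ⟨x, rfl⟩ := ha y
    have h4 : T' * M' (a x) = (M x).map s * T' := by
      calc T' * M' (a x) = T' * (M' (a x) * T) * T' := by
            rw [Matrix.mul_assoc, Matrix.mul_assoc, hT', Matrix.mul_one]
        _ = (M x).map s * T' := by rw [← hM, ← Matrix.mul_assoc, hT, Matrix.one_mul]
    have h5 : ((M x).map s) ⊗ₖ ((B (π x)).map s) = (matKron M (B.comp π) x).map s := by
      ext ⟨a, i⟩ ⟨b, j⟩
      simp [matKron_apply]
    have h6 : X' * matKron M' (B'.comp π') (a x) = (matKron M (B.comp π) x).map s * X' := by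
      rw [← h5, hX', matKron_apply, ← mul_kronecker_mul, ← mul_kronecker_mul, h4,
        MonoidHom.comp_apply, hB, Matrix.one_mul, Matrix.mul_one]
    rw [Matrix.mul_assoc, h6, ← Matrix.mul_assoc, ← map_mul_ringAut, h3, map_mul_ringAut,
      MonoidHom.comp_apply, MonoidHom.comp_apply, hA, Matrix.mul_assoc]

end Correspondence

/-! ### Clifford theory: the multiplicity space as a representation -/

section CorrespondenceExistence

open Matrix Kronecker

variable {k : Type*} [Field k] {Γ J J₁ : Type*} [Group Γ] [Group J] [Group J₁]
variable {D I I' L L' : Type*} [Fintype D] [DecidableEq D] [Fintype I] [DecidableEq I]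
  [Fintype I'] [DecidableEq I'] [Fintype L] [DecidableEq L] [Fintype L'] [DecidableEq L']
variable {α : Γ →* J} {π : Γ →* J₁} {M : Γ →* Matrix D D k}

/-- The space of intertwiners of the restrictions of two representations to a normal subgroup. -/
def intertwinerSpace (N : Subgroup Γ) [N.Normal] (A : Γ →* Matrix I I k) (M : Γ →* Matrix D D k) :
    Submodule k (Matrix I D k) where
  carrier := {X | ∀ n ∈ N, A n * X = X * M n}
  add_mem' := fun {X Y} hX hY n hn => by rw [Matrix.mul_add, Matrix.add_mul, hX n hn, hY n hn]
  zero_mem' := fun n _ => by rw [Matrix.mul_zero, Matrix.zero_mul]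
  smul_mem' := fun c X hX n hn => by rw [Matrix.mul_smul, Matrix.smul_mul, hX n hn]

/-- The action by conjugation on the space of intertwiners. -/
def intertwinerAct (N : Subgroup Γ) [N.Normal] (A : Γ →* Matrix I I k) (M : Γ →* Matrix D D k) :
    Representation k Γ (intertwinerSpace N A M) where
  toFun x :=
    { toFun := fun X => ⟨A x * X.1 * M x⁻¹, fun n hn => by
        have h := X.2 (x⁻¹ * n * x) (by simpa using ‹N.Normal›.conj_mem n hn x⁻¹)
        calc A n * (A x * X.1 * M x⁻¹) = A (n * x) * X.1 * M x⁻¹ := by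
              rw [map_mul A n x]; simp only [Matrix.mul_assoc]
          _ = A (x * (x⁻¹ * n * x)) * X.1 * M x⁻¹ := by
              rw [show n * x = x * (x⁻¹ * n * x) by group]
          _ = A x * (A (x⁻¹ * n * x) * X.1) * M x⁻¹ := by
              rw [map_mul A x]; simp only [Matrix.mul_assoc]
          _ = A x * X.1 * M (x⁻¹ * n * x * x⁻¹) := by
              rw [h, map_mul M _ x⁻¹]; simp only [Matrix.mul_assoc]
          _ = A x * X.1 * M x⁻¹ * M n := by
              rw [show x⁻¹ * n * x * x⁻¹ = x⁻¹ * n by group, map_mul M x⁻¹ n]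
              simp only [Matrix.mul_assoc]⟩
      map_add' := fun X Y => Subtype.ext (by
        simp only [Submodule.coe_add, Matrix.mul_add, Matrix.add_mul])
      map_smul' := fun c X => Subtype.ext (by
        simp only [SetLike.val_smul, Matrix.mul_smul, Matrix.smul_mul, RingHom.id_apply]) }
  map_one' := LinearMap.ext fun X => Subtype.ext (by simp)
  map_mul' x y := LinearMap.ext fun X => Subtype.ext (by
    simp only [LinearMap.coe_mk, AddHom.coe_mk, Module.End.mul_apply, map_mul, _root_.mul_inv_rev,
      Matrix.mul_assoc])

theorem intertwinerAct_apply (N : Subgroup Γ) [N.Normal] (A : Γ →* Matrix I I k)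
    (M : Γ →* Matrix D D k) (x : Γ) (X : intertwinerSpace N A M) :
    (intertwinerAct N A M x X : Matrix I D k) = A x * X.1 * M x⁻¹ := rfl

/-- The space E of ker π-intertwiners from `M` to `A` carries an action of Γ that is trivial on ker
π, hence a representation of the right quotient. Evaluation from k^D ⊗ E to the space of `A` is
equivariant; it is onto since `A` is irreducible and E is nonzero. -/
theorem TripleLink.exists_right (hL : TripleLink α π M) {A : J →* Matrix I I k} (hA : MatIrr A)
    {T : Matrix I D k} (hT0 : T ≠ 0) (hT : ∀ x ∈ π.ker, A (α x) * T = T * M x) :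
    ∃ (e : ℕ) (B : J₁ →* Matrix (Fin e) (Fin e) k), Corr α π M A B := by
  let E := intertwinerSpace π.ker (A.comp α) M
  let b : Module.Basis (Fin (Module.finrank k E)) k E := Module.finBasis k E
  let B' : Γ →* Matrix (Fin (Module.finrank k E)) (Fin (Module.finrank k E)) k :=
    (LinearMap.toMatrixAlgEquiv b).toAlgHom.toMonoidHom.comp (intertwinerAct π.ker (A.comp α) M)
  have hB' : ∀ x, B' x = LinearMap.toMatrix b b (intertwinerAct π.ker (A.comp α) M x) :=
    fun x => rfl
  obtain ⟨B, hB⟩ := exists_monoidHom_of_surjective hL.surj_right B' fun x hx => by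
    have h1 : intertwinerAct π.ker (A.comp α) M x = 1 := LinearMap.ext fun X => Subtype.ext (by
      rw [intertwinerAct_apply, X.2 x hx, Matrix.mul_assoc, ← map_mul, mul_inv_cancel, map_one,
        Matrix.mul_one]; rfl)
    rw [hB', h1, LinearMap.toMatrix_one]
  let P : Matrix I (D × Fin (Module.finrank k E)) k := Matrix.of fun i x => (b x.2).1 i x.1
  have hP : ∀ x, P * matKron M (B.comp π) x = (A.comp α) x * P := by
    intro x
    ext i ⟨a, j⟩
    have h1 : ∑ j', B' x j' j • (b j').1 = (A.comp α) x * (b j).1 * M x⁻¹ := by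
      rw [← intertwinerAct_apply, ← b.sum_repr (intertwinerAct π.ker (A.comp α) M x (b j))]
      simp only [hB', LinearMap.toMatrix_apply, AddSubmonoidClass.coe_finsetSum, SetLike.val_smul]
    have h2 : (∑ j', B' x j' j • (b j').1) * M x = (A.comp α) x * (b j).1 := by
      rw [h1, Matrix.mul_assoc, ← map_mul, inv_mul_cancel, map_one, Matrix.mul_one]
    have h3 := congrFun (congrFun h2 i) a
    simp only [mul_apply, matKron_apply, kronecker_apply, Fintype.sum_prod_type,
      MonoidHom.comp_apply, hB, P, of_apply, Matrix.sum_apply, Matrix.smul_apply, smul_eq_mul]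
      at h3 ⊢
    rw [← h3]
    refine Finset.sum_congr rfl fun a' _ => ?_
    rw [Finset.sum_mul]
    exact Finset.sum_congr rfl fun j' _ => by ring
  have hran : LinearMap.range (toLin' P) = ⊤ := by
    refine (hA.2 _ fun g v hv => ?_).resolve_left fun hbot => hT0 ?_
    · obtain ⟨w, rfl⟩ := hv
      obtain ⟨x, rfl⟩ := hL.surj_left g
      refine ⟨matKron M (B.comp π) x *ᵥ w, ?_⟩
      rw [toLin'_apply, toLin'_apply, mulVec_mulVec, mulVec_mulVec, hP]; rfl
    · rw [LinearMap.range_eq_bot, LinearEquiv.map_eq_zero_iff] at hbot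
      have hb : ∀ j, b j = 0 := fun j => Subtype.ext (by
        ext i a
        exact congrFun (congrFun hbot i) (a, j))
      have h1 : (⟨T, hT⟩ : E) = 0 := by
        rw [← b.sum_repr ⟨T, hT⟩]
        exact Finset.sum_eq_zero fun j _ => by rw [hb, smul_zero]
      exact congrArg Subtype.val h1
  -- The kernel is stable under X ⊗ 1 for all X. Applying matrix units to a kernel vector turns it
  -- into linear relations between the basis elements of E, so its coordinates vanish.
  have hker : LinearMap.ker (toLin' P) = ⊥ := by
    rw [eq_bot_iff]
    intro v hv
    rw [LinearMap.mem_ker, toLin'_apply] at hv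
    have hX : ∀ X : Matrix D D k,
        P *ᵥ ((X ⊗ₖ (1 : Matrix (Fin (Module.finrank k E)) (Fin (Module.finrank k E)) k)) *ᵥ v)
          = 0 := by
      refine hL.forall_of_ker
        { carrier := {X | P *ᵥ ((X ⊗ₖ
            (1 : Matrix (Fin (Module.finrank k E)) (Fin (Module.finrank k E)) k)) *ᵥ v) = 0}
          add_mem' := fun {a b} ha hb => by
            change _ = _ at ha hb ⊢
            rw [add_kronecker, add_mulVec, mulVec_add, ha, hb, add_zero]
          zero_mem' := by
            change _ = _
            rw [zero_kronecker, zero_mulVec, mulVec_zero]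
          smul_mem' := fun c a ha => by
            change _ = _ at ha ⊢
            rw [smul_kronecker, smul_mulVec, mulVec_smul, ha, smul_zero] } fun x hx => ?_
      have h1 := hP x
      rw [matKron_apply, MonoidHom.comp_apply, (MonoidHom.mem_ker).mp hx, map_one] at h1
      change P *ᵥ _ = 0
      rw [mulVec_mulVec, h1, ← mulVec_mulVec, hv, mulVec_zero]
    rw [Submodule.mem_bot]
    funext ⟨c, j⟩
    have h1 : ∑ j, v (c, j) • b j = 0 := by
      apply Subtype.ext
      ext i a
      have h2 := congrFun (hX (single a c 1)) i
      have h3 : (single a c (1 : k) ⊗ₖ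
          (1 : Matrix (Fin (Module.finrank k E)) (Fin (Module.finrank k E)) k)) *ᵥ v
          = fun x => if x.1 = a then v (c, x.2) else 0 := by
        funext ⟨a', j⟩
        rw [kronecker_mulVec_single]
        simp only [one_mulVec, single_apply]
        by_cases h : a' = a
        · subst h; simp
        · simp [h, Ne.symm h]
      rw [h3] at h2
      simp only [mulVec, dotProduct, P, of_apply, Fintype.sum_prod_type, Pi.zero_apply, mul_ite,
        mul_zero] at h2
      rw [Finset.sum_comm] at h2
      simp only [Finset.sum_ite_eq', Finset.mem_univ, if_true] at h2
      rw [AddSubmonoidClass.coe_finsetSum, Matrix.sum_apply]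
      simp only [SetLike.val_smul, Matrix.smul_apply, smul_eq_mul, ZeroMemClass.coe_zero,
        Matrix.zero_apply]
      rw [← h2]
      exact Finset.sum_congr rfl fun j _ => mul_comm _ _
    exact Fintype.linearIndependent_iff.mp b.linearIndependent _ h1 j
  obtain ⟨Q, h1, h2⟩ := exists_inv_of_bijective hker hran
  exact ⟨_, B, P, Q, h1, h2, hP⟩

end CorrespondenceExistence

/-! ### Block triangular form of a reducible representation -/

section BlockTriangular

open Matrix Kronecker

variable {k : Type*} [Field k] {G : Type*} [Group G]
variable {I : Type*} [Fintype I] [DecidableEq I]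

/-- A reducible representation is equivalent to a block triangular one. -/
theorem exists_block_of_not_irr [Nonempty I] {B : G →* Matrix I I k} (hB : ¬ MatIrr B) :
    ∃ (r s : ℕ) (N : G →* Matrix (Fin r ⊕ Fin s) (Fin r ⊕ Fin s) k)
      (B₁ : G →* Matrix (Fin r) (Fin r) k) (B₂ : G →* Matrix (Fin s) (Fin s) k)
      (C : G → Matrix (Fin r) (Fin s) k),
      r < Fintype.card I ∧ s < Fintype.card I ∧ MatEqv B N ∧
        ∀ g, N g = fromBlocks (B₁ g) (C g) 0 (B₂ g) := by
  have h : ∃ U : Submodule k (I → k), (∀ g, ∀ v ∈ U, B g *ᵥ v ∈ U) ∧ U ≠ ⊥ ∧ U ≠ ⊤ := by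
    by_contra! hcon
    exact hB ⟨‹_›, fun U hU => or_iff_not_imp_left.mpr (hcon U hU)⟩
  obtain ⟨U, hU, hbot, htop⟩ := h
  obtain ⟨W, hW⟩ := U.exists_isCompl
  let b₁ := Module.finBasis k U
  let b₂ := Module.finBasis k W
  let e := Submodule.prodEquivOfIsCompl U W hW
  let b := (b₁.prod b₂).map e
  let N : G →* Matrix _ _ k := (LinearMap.toMatrixAlgEquiv b).toAlgHom.toMonoidHom.comp (toRep B)
  have hN : ∀ g, N g = LinearMap.toMatrix b b (toLin' (B g)) := fun g => rfl
  have hinl : ∀ i, b (Sum.inl i) = b₁ i := fun i => by simp [b, e]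
  have hzero : ∀ g, (N g).toBlocks₂₁ = 0 := by
    intro g
    ext j i
    change N g (Sum.inr j) (Sum.inl i) = 0
    rw [hN, LinearMap.toMatrix_apply, hinl, toLin'_apply]
    have h1 : B g *ᵥ (b₁ i : I → k) = e (⟨_, hU g _ (b₁ i).2⟩, 0) := by
      rw [Submodule.coe_prodEquivOfIsCompl']; simp
    rw [h1]
    simp [b]
  have hblocks : ∀ g, N g = fromBlocks (N g).toBlocks₁₁ (N g).toBlocks₁₂ 0 (N g).toBlocks₂₂ := by
    intro g
    rw [← hzero g, fromBlocks_toBlocks]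
  have hmul : ∀ g h, fromBlocks (N (g * h)).toBlocks₁₁ (N (g * h)).toBlocks₁₂ 0
      (N (g * h)).toBlocks₂₂ = fromBlocks ((N g).toBlocks₁₁ * (N h).toBlocks₁₁)
        ((N g).toBlocks₁₁ * (N h).toBlocks₁₂ + (N g).toBlocks₁₂ * (N h).toBlocks₂₂) 0
        ((N g).toBlocks₂₂ * (N h).toBlocks₂₂) := by
    intro g h
    rw [← hblocks, map_mul, hblocks g, hblocks h, fromBlocks_multiply]
    simp
  have hone : fromBlocks (N 1).toBlocks₁₁ (N 1).toBlocks₁₂ 0 (N 1).toBlocks₂₂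
      = fromBlocks 1 0 0 1 := by
    rw [← hblocks, map_one, fromBlocks_one]
  let B₁ : G →* Matrix _ _ k :=
    { toFun := fun g => (N g).toBlocks₁₁
      map_one' := (fromBlocks_inj.mp hone).1
      map_mul' := fun g h => (fromBlocks_inj.mp (hmul g h)).1 }
  let B₂ : G →* Matrix _ _ k :=
    { toFun := fun g => (N g).toBlocks₂₂
      map_one' := (fromBlocks_inj.mp hone).2.2.2
      map_mul' := fun g h => (fromBlocks_inj.mp (hmul g h)).2.2.2 }
  have hcard : Module.finrank k U + Module.finrank k W = Fintype.card I := by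
    rw [Submodule.finrank_add_eq_of_isCompl hW, Module.finrank_fintype_fun_eq_card]
  have hr : Module.finrank k U < Fintype.card I := by
    rw [← Module.finrank_fintype_fun_eq_card k]
    exact Submodule.finrank_lt htop
  have hs : 0 < Module.finrank k U :=
    Module.finrank_pos_iff.mpr (Submodule.nontrivial_iff_ne_bot.mpr hbot)
  refine ⟨_, _, N, B₁, B₂, fun g => (N g).toBlocks₁₂, hr, by omega, ?_, hblocks⟩
  refine ⟨LinearMap.toMatrix (Pi.basisFun k I) b LinearMap.id,
    LinearMap.toMatrix b (Pi.basisFun k I) LinearMap.id, ?_, ?_, fun g => ?_⟩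
  · rw [← LinearMap.toMatrix_comp, LinearMap.id_comp, LinearMap.toMatrix_id]
  · rw [← LinearMap.toMatrix_comp, LinearMap.id_comp, LinearMap.toMatrix_id]
  · have h1 : B g = LinearMap.toMatrix (Pi.basisFun k I) (Pi.basisFun k I) (toLin' (B g)) := by
      rw [LinearMap.toMatrix_eq_toMatrix', LinearMap.toMatrix'_toLin']
    rw [hN, ← LinearMap.toMatrix_comp (Pi.basisFun k I) b b, LinearMap.comp_id]
    conv_lhs => rw [h1]
    rw [← LinearMap.toMatrix_comp (Pi.basisFun k I) (Pi.basisFun k I) b, LinearMap.id_comp]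

end BlockTriangular

/-! ### Corresponding composition factors -/

section Induction

open Matrix Kronecker

variable {p : ℕ} [Fact p.Prime]
variable {K : Type*} [Field K] [Algebra ℚ_[p] K] [Algebra.IsAlgebraic ℚ_[p] K]
variable {Γ J J₁ : Type*} [Group Γ] [Group J] [Group J₁]
variable {D : Type} [Fintype D] [DecidableEq D]
variable {α : Γ →* J} {π : Γ →* J₁} {M : Γ →* Matrix D D (ResF p K)}

theorem charpoly_eq_one_of_isEmpty {k X : Type*} [Field k] [Fintype X] [DecidableEq X] [IsEmpty X]
    (A : Matrix X X k) : A.charpoly = 1 := by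
  rw [Matrix.charpoly, det_isEmpty]

theorem charpoly_kronecker_fromBlocks {k X Y : Type*} [Field k] [Fintype X] [DecidableEq X]
    [Fintype Y] [DecidableEq Y] (U : Matrix D D k) (A : Matrix X X k) (C : Matrix X Y k)
    (B : Matrix Y Y k) :
    (U ⊗ₖ fromBlocks A C 0 B).charpoly = (U ⊗ₖ A).charpoly * (U ⊗ₖ B).charpoly := by
  rw [← charpoly_fromBlocks_zero₂₁ (U ⊗ₖ A) (U ⊗ₖ C) (U ⊗ₖ B),
    ← charpoly_reindex (Equiv.prodSumDistrib D X Y)]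
  congr 1
  ext (⟨a, i⟩ | ⟨a, i⟩) (⟨b, j⟩ | ⟨b, j⟩) <;> simp

theorem Corr.charpoly_eq {k I L : Type*} [Field k] [Fintype I] [DecidableEq I] [Fintype L]
    [DecidableEq L] {M : Γ →* Matrix D D k} {A : J →* Matrix I I k} {B : J₁ →* Matrix L L k}
    (h : Corr α π M A B) (x : Γ) : (A (α x)).charpoly = (M x ⊗ₖ B (π x)).charpoly :=
  (MatEqv.charpoly_eq h x).symm

theorem matBr_eq_add_of_charpoly {G X Y W : Type*} [Group G] [Fintype X] [DecidableEq X]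
    [Fintype Y] [DecidableEq Y] [Fintype W] [DecidableEq W] {A : G →* Matrix X X (ResF p K)}
    {A₁ : G →* Matrix Y Y (ResF p K)} {A₂ : G →* Matrix W W (ResF p K)}
    (h : ∀ g, (A g).charpoly = (A₁ g).charpoly * (A₂ g).charpoly) :
    matBr A = matBr A₁ + matBr A₂ := by
  funext g
  rw [Pi.add_apply, matBr, matBr, matBr, h, Polynomial.roots_mul, Multiset.map_add,
    Multiset.sum_add]
  exact mul_ne_zero (charpoly_monic _).ne_zero (charpoly_monic _).ne_zero

/-- Induction along composition series for pairs of corresponding Brauer characters. -/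
theorem TripleLink.matBr_induction (hL : TripleLink α π M)
    {motive : (PReg p J → K) → (PReg p J₁ → K) → Prop} (zero : motive 0 0)
    (add : ∀ f g f' g', motive f g → motive f' g' → motive (f + f') (g + g'))
    (irr : ∀ (d e : ℕ) (A : J →* Matrix (Fin d) (Fin d) (ResF p K))
      (B : J₁ →* Matrix (Fin e) (Fin e) (ResF p K)), MatIrr A → MatIrr B → Corr α π M A B →
      motive (matBr A) (matBr B)) :
    ∀ (m : ℕ) {I L : Type} [Fintype I] [DecidableEq I] [Fintype L] [DecidableEq L]
      (A : J →* Matrix I I (ResF p K)) (B : J₁ →* Matrix L L (ResF p K)),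
      Fintype.card L = m → Corr α π M A B → motive (matBr A) (matBr B) := by
  intro m
  induction m using Nat.strong_induction_on with
  | _ m ih =>
  intro I L _ _ _ _ A B hm h
  by_cases hB : MatIrr B
  · obtain ⟨d, A', hA'⟩ := exists_fin_matEqv A
    obtain ⟨e, B', hB'⟩ := exists_fin_matEqv B
    rw [hA'.matBr_eq, hB'.matBr_eq]
    exact irr d e A' B' (hA'.irr ((hL.irr_iff h).mpr hB)) (hB'.irr hB)
      ((((MatEqv.comp_iff hL.surj_right).mpr hB'.symm).kron M).trans
        (h.trans ((MatEqv.comp_iff hL.surj_left).mpr hA')))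
  cases isEmpty_or_nonempty L
  · have hA0 : matBr A = 0 := by
      funext g
      obtain ⟨x, hx⟩ := hL.surj_left g.1
      rw [matBr, ← hx, h.charpoly_eq, charpoly_eq_one_of_isEmpty, Polynomial.roots_one]; rfl
    have hB0 : matBr B = 0 := by
      funext g
      rw [matBr, charpoly_eq_one_of_isEmpty, Polynomial.roots_one]; rfl
    rw [hA0, hB0]; exact zero
  obtain ⟨r, s, N, B₁, B₂, C, hr, hs, hBN, hN⟩ := exists_block_of_not_irr hB
  have hAN : Corr α π M A N := (((MatEqv.comp_iff hL.surj_right).mpr hBN.symm).kron M).trans h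
  -- Since ker α acts through `M` by scalars, triviality of the tensor product says that a scalar
  -- multiple of `N` is the identity there. This passes to the diagonal blocks, so each tensor
  -- product with a block descends to `J`.
  have hker : ∀ x ∈ α.ker, M x ⊗ₖ B₁ (π x) = 1 ∧ M x ⊗ₖ B₂ (π x) = 1 := by
    intro x hx
    have := hL.nonempty
    have h1 := hAN.kron_eq_one hx
    obtain ⟨c, hc⟩ := hL.scalar x hx
    rw [hc, smul_kronecker, ← kronecker_smul, ← one_kronecker_one (m := D)] at h1
    have h2 := one_kronecker_injective h1
    rw [hN, fromBlocks_smul, ← fromBlocks_one, fromBlocks_inj] at h2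
    rw [hc, smul_kronecker, smul_kronecker, ← kronecker_smul, ← kronecker_smul, h2.1, h2.2.2.2,
      one_kronecker_one, one_kronecker_one]
    exact ⟨rfl, rfl⟩
  obtain ⟨A₁, hA₁⟩ := hL.exists_left fun x hx => (hker x hx).1
  obtain ⟨A₂, hA₂⟩ := hL.exists_left fun x hx => (hker x hx).2
  have eA : matBr A = matBr A₁ + matBr A₂ := matBr_eq_add_of_charpoly fun g => by
    obtain ⟨x, rfl⟩ := hL.surj_left g
    rw [hAN.charpoly_eq, hA₁.charpoly_eq, hA₂.charpoly_eq, hN, charpoly_kronecker_fromBlocks]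
  have eB : matBr B = matBr B₁ + matBr B₂ := by
    rw [hBN.matBr_eq]
    exact matBr_eq_add_of_charpoly fun g => by rw [hN, charpoly_fromBlocks_zero₂₁]
  rw [eA, eB]
  refine add _ _ _ _ (ih r (by omega) A₁ B₁ (Fintype.card_fin r) hA₁)
    (ih s (by omega) A₂ B₂ (Fintype.card_fin s) hA₂)

end Induction

/-! ### Higman's criterion -/

section Higman

open Matrix

variable {k : Type*} [Field k] {G : Type*} [Group G]
variable {I L : Type*} [Fintype I] [DecidableEq I] [Fintype L] [DecidableEq L]

/-- A `G`-equivariant decomposition of the identity indexed by a `G`-set. -/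
def HigmanOn (A : G →* Matrix I I k) (Ω : Type*) [MulAction G Ω] : Prop :=
  ∃ f : Ω → Matrix I I k, (∀ (g : G) (x : Ω), f (g • x) = A g * f x * A g⁻¹) ∧ ∑ᶠ x, f x = 1

/-- Higman's criterion for relative projectivity. -/
def Higman (A : G →* Matrix I I k) (H : Subgroup G) : Prop := HigmanOn A (G ⧸ H)

/-- Apply relative projectivity to the space of functions from G/H to the representation, mapped
onto it by summation. Over `H` the map splits by placing a vector at the trivial coset; the
components of a splitting over `G` form the required decomposition of the identity. -/
theorem Higman.of_isRelProjective [Finite G] {d : ℕ} {ρ : Representation k G (Fin d → k)}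
    {H : Subgroup G} (h : IsRelProjective ρ H) : Higman (toMat ρ) H := by
  classical
  have := Fintype.ofFinite (G ⧸ H)
  let V := G ⧸ H → Fin d → k
  let τ : Representation k G V :=
    { toFun := fun g =>
        { toFun := fun F x => ρ g (F (g⁻¹ • x))
          map_add' := fun F F' => by funext x; exact map_add (ρ g) _ _
          map_smul' := fun c F => by funext x; exact map_smul (ρ g) c _ }
      map_one' := by ext; simp
      map_mul' := fun g g' => by
        refine LinearMap.ext fun F => funext fun x => ?_
        simp [mul_smul] }
  have hτ : ∀ g F x, τ g F x = ρ g (F (g⁻¹ • x)) := fun _ _ _ => rfl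
  let E : V ≃ₗ[k] (Fin (Module.finrank k V) → k) := (Module.finBasis k V).equivFun
  let τ' : Representation k G (Fin (Module.finrank k V) → k) :=
    (E.conjAlgEquiv k).toAlgHom.toMonoidHom.comp τ
  have hτ' : ∀ g w, τ' g w = E (τ g (E.symm w)) := fun _ _ => rfl
  let π : V →ₗ[k] (Fin d → k) := ∑ x, LinearMap.proj x
  have hπ : ∀ F, π F = ∑ x, F x := fun F => by
    rw [LinearMap.sum_apply]; rfl
  obtain ⟨s, hs, hπs⟩ := h _ τ' (π ∘ₗ E.symm.toLinearMap) (fun g => by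
      refine LinearMap.ext fun w => ?_
      change π (E.symm (τ' g w)) = ρ g (π (E.symm w))
      rw [hτ', E.symm_apply_apply, hπ, hπ, map_sum]
      exact Fintype.sum_equiv (MulAction.toPerm g⁻¹) _ _ fun x => by rw [hτ]; rfl)
    ⟨E.toLinearMap ∘ₗ LinearMap.single k (fun _ => Fin d → k) ((1 : G) : G ⧸ H), fun h hh => by
      refine LinearMap.ext fun v => ?_
      change E (Pi.single _ (ρ h v)) = τ' h (E (Pi.single _ v))
      rw [hτ', E.symm_apply_apply]
      congr 1
      funext x
      rw [hτ]
      have h1 : h⁻¹ • x = ((1 : G) : G ⧸ H) ↔ x = ((1 : G) : G ⧸ H) := by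
        rw [inv_smul_eq_iff]
        have : h • ((1 : G) : G ⧸ H) = ((1 : G) : G ⧸ H) := by
          rw [MulAction.Quotient.smul_coe, QuotientGroup.eq]
          simpa using hh
        rw [this]
      by_cases hx : x = ((1 : G) : G ⧸ H)
      · rw [h1.mpr hx, hx, Pi.single_eq_same, Pi.single_eq_same]
      · rw [Pi.single_eq_of_ne hx, Pi.single_eq_of_ne (fun h => hx (h1.mp h)), map_zero],
    by
      refine LinearMap.ext fun v => ?_
      change π (E.symm (E (Pi.single _ v))) = v
      rw [E.symm_apply_apply, hπ]
      simp⟩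
  have hF : ∀ (g : G) (x : G ⧸ H) (v : Fin d → k),
      E.symm (s v) (g • x) = ρ g (E.symm (s (ρ g⁻¹ v)) x) := by
    intro g x v
    have h1 : s v = τ' g (s (ρ g⁻¹ v)) := by
      have h2 := LinearMap.congr_fun (hs g) (ρ g⁻¹ v)
      rw [LinearMap.comp_apply, LinearMap.comp_apply, ρ.self_inv_apply] at h2
      exact h2
    conv_lhs => rw [h1, hτ', E.symm_apply_apply, hτ, inv_smul_smul]
  let F : G ⧸ H → ((Fin d → k) →ₗ[k] (Fin d → k)) := fun x =>
    LinearMap.proj x ∘ₗ E.symm.toLinearMap ∘ₗ s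
  refine ⟨fun x => LinearMap.toMatrix' (F x), fun g x => ?_, ?_⟩
  · rw [toMat_apply, toMat_apply, ← LinearMap.toMatrix'_comp, ← LinearMap.toMatrix'_comp]
    exact congrArg _ (LinearMap.ext fun v => hF g x v)
  · rw [finsum_eq_sum_of_fintype, ← map_sum, ← LinearMap.toMatrix'_one]
    refine congrArg _ (LinearMap.ext fun v => ?_)
    rw [LinearMap.sum_apply]
    have h1 := LinearMap.congr_fun hπs v
    change π (E.symm (s v)) = v at h1
    rw [hπ] at h1
    exact h1

/-- The conjugates of a splitting over `H` depend only on the coset and permute equivariantly.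
Composing each with the corresponding part of the decomposition of the identity and summing gives a
splitting over `G`. -/
theorem Higman.isRelProjective [Finite G] {d : ℕ} {ρ : Representation k G (Fin d → k)}
    {H : Subgroup G} (h : Higman (toMat ρ) H) : IsRelProjective ρ H := by
  classical
  have := Fintype.ofFinite (G ⧸ H)
  obtain ⟨f, hf, hsum⟩ := h
  rw [finsum_eq_sum_of_fintype] at hsum
  intro m τ π hπ ⟨s, hs, hπs⟩
  let F : G ⧸ H → ((Fin d → k) →ₗ[k] (Fin d → k)) := fun x => toLin' (f x)
  have hF : ∀ g x, F (g • x) = ρ g ∘ₗ F x ∘ₗ ρ g⁻¹ := fun g x => by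
    simp only [F, hf, toLin'_mul, toMat_apply, toLin'_toMatrix', LinearMap.comp_assoc]
  have hFsum : ∑ x, F x = LinearMap.id := by
    simp only [F, ← map_sum, hsum, toLin'_one]
  let S : G ⧸ H → ((Fin d → k) →ₗ[k] (Fin m → k)) := fun x => τ x.out ∘ₗ s ∘ₗ ρ x.out⁻¹
  have hS : ∀ (g : G) (x : G ⧸ H), (g : G ⧸ H) = x → τ g ∘ₗ s ∘ₗ ρ g⁻¹ = S x := by
    intro g x hgx
    have hh : x.out⁻¹ * g ∈ H := by
      rw [← QuotientGroup.eq, hgx]; exact QuotientGroup.out_eq' x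
    have h1 : τ g = τ x.out * τ (x.out⁻¹ * g) := by rw [← map_mul, mul_inv_cancel_left]
    have h2 : ρ x.out⁻¹ = ρ (x.out⁻¹ * g) * ρ g⁻¹ := by rw [← map_mul, mul_inv_cancel_right]
    change _ = τ x.out ∘ₗ s ∘ₗ ρ x.out⁻¹
    rw [h1, h2, Module.End.mul_eq_comp, Module.End.mul_eq_comp, LinearMap.comp_assoc,
      ← LinearMap.comp_assoc _ _ s, hs _ hh, LinearMap.comp_assoc]
  have hSe : ∀ g x, S (g • x) = τ g ∘ₗ S x ∘ₗ ρ g⁻¹ := by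
    intro g x
    rw [← hS (g * x.out) (g • x) (by
      conv_rhs => rw [← QuotientGroup.out_eq' x]
      rfl)]
    rw [map_mul, _root_.mul_inv_rev, map_mul]
    rfl
  refine ⟨∑ x, S x ∘ₗ F x, fun g => ?_, ?_⟩
  · refine LinearMap.ext fun v => ?_
    simp only [LinearMap.comp_apply, LinearMap.sum_apply, map_sum]
    refine Fintype.sum_equiv (MulAction.toPerm g⁻¹) _ _ fun x => ?_
    rw [MulAction.toPerm_apply, hSe, hF]
    simp [LinearMap.comp_apply]
  · have h1 : ∀ x, π ∘ₗ S x = LinearMap.id := fun x => by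
      change π ∘ₗ τ x.out ∘ₗ s ∘ₗ ρ x.out⁻¹ = _
      rw [← LinearMap.comp_assoc, hπ, LinearMap.comp_assoc, ← LinearMap.comp_assoc _ s π, hπs,
        LinearMap.id_comp, ← Module.End.mul_eq_comp, ← map_mul, mul_inv_cancel, map_one]
      rfl
    refine LinearMap.ext fun v => ?_
    have h2 := LinearMap.congr_fun hFsum v
    simp only [LinearMap.comp_apply, LinearMap.sum_apply, map_sum] at h2 ⊢
    refine Eq.trans (Finset.sum_congr rfl fun x _ => ?_) h2
    exact LinearMap.congr_fun (h1 x) (F x v)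

theorem isRelProjective_iff [Finite G] {d : ℕ} {ρ : Representation k G (Fin d → k)}
    {H : Subgroup G} : IsRelProjective ρ H ↔ Higman (toMat ρ) H :=
  ⟨Higman.of_isRelProjective, Higman.isRelProjective⟩

end Higman

/-! ### Vertices and their transfer along the tensor correspondence -/

section HigmanTransfer

open Matrix Kronecker

variable {k : Type*} [Field k] {G Γ J J₁ : Type*} [Group G] [Group Γ] [Group J] [Group J₁]
variable {D I L : Type*} [Fintype D] [DecidableEq D] [Fintype I] [DecidableEq I] [Fintype L]
  [DecidableEq L]

theorem HigmanOn.eqv {Ω : Type*} [MulAction G Ω] [Finite Ω] {A : G →* Matrix I I k}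
    {B : G →* Matrix L L k} (h : MatEqv A B) (hA : HigmanOn A Ω) : HigmanOn B Ω := by
  have := Fintype.ofFinite Ω
  obtain ⟨P, Q, h1, h2, h3⟩ := h
  obtain ⟨f, hf, hsum⟩ := hA
  have h4 : ∀ g, A g * Q = Q * B g := fun g => by
    calc A g * Q = Q * (P * A g) * Q := by rw [← Matrix.mul_assoc, h1, Matrix.one_mul]
      _ = Q * B g := by rw [h3, Matrix.mul_assoc, Matrix.mul_assoc, h2, Matrix.mul_one]
  refine ⟨fun x => P * f x * Q, fun g x => ?_, ?_⟩
  · calc P * f (g • x) * Q = (P * A g) * f x * (A g⁻¹ * Q) := by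
          rw [hf]; simp only [Matrix.mul_assoc]
      _ = _ := by rw [h3, h4]; simp only [Matrix.mul_assoc]
  · rw [finsum_eq_sum_of_fintype] at hsum ⊢
    rw [← Matrix.sum_mul, ← Matrix.mul_sum, hsum, Matrix.mul_one, h2]

/-- Pushing forward along an equivariant map. -/
theorem HigmanOn.map {Ω Ω' : Type*} [MulAction Γ Ω] [MulAction G Ω'] [Finite Ω] [Finite Ω']
    {A : G →* Matrix I I k} {α : Γ →* G} (hα : Function.Surjective α) (φ : Ω → Ω')
    (hφ : ∀ x y, φ (x • y) = α x • φ y) (h : HigmanOn (A.comp α) Ω) : HigmanOn A Ω' := by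
  classical
  have := Fintype.ofFinite Ω
  have := Fintype.ofFinite Ω'
  obtain ⟨f, hf, hsum⟩ := h
  rw [finsum_eq_sum_of_fintype] at hsum
  refine ⟨fun y => ∑ x with φ x = y, f x, fun g y => ?_, ?_⟩
  · obtain ⟨x, rfl⟩ := hα g
    rw [Matrix.mul_sum, Matrix.sum_mul]
    refine Finset.sum_bij' (fun z _ => x⁻¹ • z) (fun z _ => x • z) ?_ ?_ ?_ ?_ ?_
    · intro z hz
      simp only [Finset.mem_filter, Finset.mem_univ, true_and] at hz ⊢
      rw [hφ, hz, map_inv, inv_smul_smul]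
    · intro z hz
      simp only [Finset.mem_filter, Finset.mem_univ, true_and] at hz ⊢
      rw [hφ, hz]
    · intro z _; exact smul_inv_smul _ _
    · intro z _; exact inv_smul_smul _ _
    · intro z _
      have := hf x (x⁻¹ • z)
      rwa [smul_inv_smul, MonoidHom.comp_apply, MonoidHom.comp_apply, map_inv] at this
  · rw [finsum_eq_sum_of_fintype]
    exact (Finset.sum_fiberwise Finset.univ φ f).trans hsum

theorem HigmanOn.comap {Ω Ω' : Type*} [MulAction Γ Ω] [MulAction G Ω']
    {A : G →* Matrix I I k} {α : Γ →* G} (φ : Ω → Ω') (hb : Function.Bijective φ)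
    (hφ : ∀ x y, φ (x • y) = α x • φ y) (h : HigmanOn A Ω') : HigmanOn (A.comp α) Ω := by
  obtain ⟨f, hf, hsum⟩ := h
  refine ⟨fun x => f (φ x), fun x y => ?_, ?_⟩
  · change f (φ (x • y)) = A (α x) * f (φ y) * A (α x⁻¹)
    rw [hφ, hf, map_inv α]
  · rw [← hsum]
    exact finsum_comp_equiv (Equiv.ofBijective φ hb)

theorem Higman.mono [Finite G] {A : G →* Matrix I I k} {H H' : Subgroup G} (hle : H ≤ H')
    (h : Higman A H) : Higman A H' :=
  HigmanOn.map (Ω := G ⧸ H) (Ω' := G ⧸ H') (α := MonoidHom.id G) Function.surjective_id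
    (Quotient.map' id fun a b hab => QuotientGroup.leftRel_apply.mpr
      (hle (QuotientGroup.leftRel_apply.mp hab)))
    (fun x y => by induction y using QuotientGroup.induction_on; rfl) h

theorem Higman.of_comp [Finite Γ] {A : G →* Matrix I I k} {α : Γ →* G}
    (hα : Function.Surjective α) {R : Subgroup Γ} (h : Higman (A.comp α) R) :
    Higman A (R.map α) := by
  have := Finite.of_surjective α hα
  refine HigmanOn.map (Ω := Γ ⧸ R) (Ω' := G ⧸ R.map α) hα (Quotient.map' α fun a b hab => QuotientGroup.leftRel_apply.mpr ?_)
    (fun x y => ?_) h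
  · rw [← map_inv, ← map_mul]
    exact Subgroup.mem_map_of_mem _ (QuotientGroup.leftRel_apply.mp hab)
  · induction y using QuotientGroup.induction_on with
    | _ y => exact congrArg (fun z : G => (z : G ⧸ R.map α)) (map_mul α x y)

theorem Higman.comp {A : G →* Matrix I I k} {α : Γ →* G}
    (hα : Function.Surjective α) {Y : Subgroup G} (h : Higman A Y) :
    Higman (A.comp α) (Y.comap α) := by
  refine HigmanOn.comap (Ω := Γ ⧸ Y.comap α) (Ω' := G ⧸ Y) (Quotient.map' α fun a b hab => QuotientGroup.leftRel_apply.mpr ?_)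
    ⟨fun x y hxy => ?_, fun y => ?_⟩ (fun x y => ?_) h
  · rw [← map_inv, ← map_mul]
    exact QuotientGroup.leftRel_apply.mp hab
  · induction x using QuotientGroup.induction_on with
    | _ x =>
    induction y using QuotientGroup.induction_on with
    | _ y =>
    refine QuotientGroup.eq.mpr ?_
    have := QuotientGroup.eq.mp hxy
    rwa [← map_inv, ← map_mul] at this
  · induction y using QuotientGroup.induction_on with
    | _ y =>
    obtain ⟨x, rfl⟩ := hα y
    exact ⟨(x : Γ ⧸ Y.comap α), rfl⟩
  · induction y using QuotientGroup.induction_on with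
    | _ y => exact congrArg (fun z : G => (z : G ⧸ Y)) (map_mul α x y)

/-- A decomposition of the identity of an absolutely irreducible representation can be
concentrated on one orbit. -/
theorem HigmanOn.exists_stabilizer {Ω : Type*} [MulAction G Ω] [Finite Ω] [Nonempty I]
    {A : G →* Matrix I I k} (hA : MatSchur A) (h : HigmanOn A Ω) :
    ∃ ω : Ω, ∀ g : G, Higman A (MulAction.stabilizer G (g • ω)) := by
  classical
  have := Fintype.ofFinite Ω
  have := Fintype.ofFinite (MulAction.orbitRel.Quotient G Ω)
  obtain ⟨f, hf, hsum⟩ := h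
  let q : Ω → MulAction.orbitRel.Quotient G Ω := Quotient.mk''
  have hq : ∀ (g : G) (x : Ω), q (g • x) = q x := fun g x =>
    Quotient.sound' ⟨g, rfl⟩
  rw [finsum_eq_sum_of_fintype, ← Finset.sum_fiberwise Finset.univ q] at hsum
  obtain ⟨c, -, hc⟩ := Finset.exists_ne_zero_of_sum_ne_zero (hsum.trans_ne one_ne_zero)
  -- The sum over an orbit commutes with the representation, so it is a scalar. The total is the
  -- identity, so some orbit has a nonzero scalar and can be normalized to sum to the identity.
  obtain ⟨s, hs⟩ := hA (∑ x with q x = c, f x) fun g => by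
    have h1 : ∑ x with q x = c, f x = ∑ x with q x = c, f (g • x) := by
      refine Finset.sum_bij' (fun z _ => g⁻¹ • z) (fun z _ => g • z) ?_ ?_ ?_ ?_ ?_
      · intro z hz
        simp only [Finset.mem_filter, Finset.mem_univ, true_and] at hz ⊢
        rw [hq, hz]
      · intro z hz
        simp only [Finset.mem_filter, Finset.mem_univ, true_and] at hz ⊢
        rw [hq, hz]
      · intro z _; exact smul_inv_smul _ _
      · intro z _; exact inv_smul_smul _ _
      · intro z _; rw [smul_inv_smul]
    have h2 : ∑ x with q x = c, f (g • x) = A g * (∑ x with q x = c, f x) * A g⁻¹ := by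
      simp only [hf, Matrix.mul_sum, Matrix.sum_mul]
    conv_lhs => rw [h1, h2]
    rw [Matrix.mul_assoc, ← map_mul, inv_mul_cancel, map_one, Matrix.mul_one]
  have hs0 : s ≠ 0 := by
    rintro rfl
    rw [zero_smul] at hs
    exact hc hs
  obtain ⟨ω, rfl⟩ := Quotient.exists_rep c
  refine ⟨ω, fun g => ⟨fun y => s⁻¹ • f (MulAction.ofQuotientStabilizer G (g • ω) y),
    fun g' y => ?_, ?_⟩⟩
  · beta_reduce
    rw [MulAction.ofQuotientStabilizer_smul, hf, Matrix.mul_smul, Matrix.smul_mul]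
  · have := Finite.of_injective _ (MulAction.injective_ofQuotientStabilizer G (g • ω))
    have := Fintype.ofFinite (G ⧸ MulAction.stabilizer G (g • ω))
    rw [finsum_eq_sum_of_fintype, ← Finset.smul_sum]
    have h1 : ∑ y, f (MulAction.ofQuotientStabilizer G (g • ω) y)
        = ∑ x with q x = q ω, f x := by
      refine Finset.sum_bij (fun y _ => MulAction.ofQuotientStabilizer G (g • ω) y) ?_ ?_ ?_ ?_
      · intro y _
        induction y using QuotientGroup.induction_on with
        | _ y =>
        simp only [Finset.mem_filter, Finset.mem_univ, true_and]
        rw [MulAction.ofQuotientStabilizer_mk, hq, hq]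
      · intro x _ y _ hxy
        exact MulAction.injective_ofQuotientStabilizer G (g • ω) hxy
      · intro x hx
        simp only [Finset.mem_filter, Finset.mem_univ, true_and] at hx
        obtain ⟨g', hg'⟩ := Quotient.exact' hx
        refine ⟨((g' * g⁻¹ : G) : G ⧸ _), Finset.mem_univ _, ?_⟩
        rw [MulAction.ofQuotientStabilizer_mk, mul_smul, inv_smul_smul]
        exact hg'
      · intro x _; rfl
    rw [h1]
    change s⁻¹ • (∑ x with q x = Quotient.mk _ ω, f x) = 1
    rw [hs, smul_smul, inv_mul_cancel₀ hs0, one_smul]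

/-- Products of two equivariant decompositions play the role of Mackey's formula: stabilizers in the
product of two coset spaces are intersections of conjugates. -/
theorem HigmanOn.prod {Ω Ω' : Type*} [MulAction G Ω] [MulAction G Ω'] [Finite Ω] [Finite Ω']
    {A : G →* Matrix I I k} (h : HigmanOn A Ω) (h' : HigmanOn A Ω') : HigmanOn A (Ω × Ω') := by
  have := Fintype.ofFinite Ω
  have := Fintype.ofFinite Ω'
  obtain ⟨f, hf, hs⟩ := h
  obtain ⟨f', hf', hs'⟩ := h'
  rw [finsum_eq_sum_of_fintype] at hs hs'
  refine ⟨fun x => f x.1 * f' x.2, fun g x => ?_, ?_⟩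
  · have h1 : A g⁻¹ * A g = 1 := by rw [← map_mul, inv_mul_cancel, map_one]
    beta_reduce
    rw [Prod.smul_fst, Prod.smul_snd, hf, hf']
    calc A g * f x.1 * A g⁻¹ * (A g * f' x.2 * A g⁻¹)
        = A g * f x.1 * (A g⁻¹ * A g) * f' x.2 * A g⁻¹ := by simp only [Matrix.mul_assoc]
      _ = _ := by rw [h1, Matrix.mul_one]; simp only [Matrix.mul_assoc]
  · rw [finsum_eq_sum_of_fintype, Fintype.sum_prod_type]
    simp only [← Matrix.mul_sum, hs', Matrix.mul_one, hs]

/-- A vertex is contained, up to conjugacy, in every subgroup for which the representation is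
relatively projective. -/
theorem Higman.exists_le_conj [Finite G] [Nonempty I] {A : G →* Matrix I I k} (hA : MatSchur A)
    {X Y : Subgroup G} (hX : Higman A X) (hY : Minimal (Higman A) Y) :
    ∃ g : G, ∀ y ∈ Y, g⁻¹ * y * g ∈ X := by
  -- Some orbit of the product of the two coset spaces suffices, and its base point may be moved to
  -- (gX, Y). The stabilizer is contained in `Y` and in the conjugate of `X` by g; minimality of `Y`
  -- forces it to be all of `Y`.
  obtain ⟨⟨x, y⟩, h⟩ := (HigmanOn.prod hX hY.1).exists_stabilizer hA
  induction y using QuotientGroup.induction_on with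
  | _ y =>
  obtain ⟨g, hg⟩ := QuotientGroup.mk_surjective (y⁻¹ • x)
  have h1 := h y⁻¹
  have h2 : y⁻¹ • (x, (y : G ⧸ Y)) = ((g : G ⧸ X), ((1 : G) : G ⧸ Y)) := by
    refine Prod.ext hg.symm ?_
    change ((y⁻¹ * y : G) : G ⧸ Y) = _
    rw [inv_mul_cancel]
  rw [h2] at h1
  have hmem : ∀ z ∈ MulAction.stabilizer G (((g : G ⧸ X), ((1 : G) : G ⧸ Y)) : (G ⧸ X) × (G ⧸ Y)),
      g⁻¹ * z * g ∈ X ∧ z ∈ Y := by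
    intro z hz
    have h3 := MulAction.mem_stabilizer_iff.mp hz
    have h4 : ((z * g : G) : G ⧸ X) = (g : G ⧸ X) := congrArg Prod.fst h3
    have h5 : ((z * 1 : G) : G ⧸ Y) = ((1 : G) : G ⧸ Y) := congrArg Prod.snd h3
    have h6 := QuotientGroup.eq.mp h4.symm
    have h7 := QuotientGroup.eq.mp h5.symm
    exact ⟨by rwa [mul_assoc], by simpa using h7⟩
  exact ⟨g, fun z hz => (hmem z (hY.2 h1 (fun w hw => (hmem w hw).2) hz)).1⟩

variable {α : Γ →* J} {π : Γ →* J₁} {M : Γ →* Matrix D D k}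

theorem HigmanOn.kron {Ω : Type*} [MulAction Γ Ω] [Finite Ω] {B : Γ →* Matrix I I k}
    (h : HigmanOn B Ω) : HigmanOn (matKron M B) Ω := by
  have := Fintype.ofFinite Ω
  obtain ⟨f, hf, hs⟩ := h
  refine ⟨fun x => 1 ⊗ₖ f x, fun g x => ?_, ?_⟩
  · beta_reduce
    rw [hf, matKron_apply, matKron_apply, ← mul_kronecker_mul, ← mul_kronecker_mul, Matrix.mul_one,
      ← map_mul, mul_inv_cancel, map_one]
  · rw [finsum_eq_sum_of_fintype] at hs ⊢
    have h1 : ∑ x, (1 : Matrix D D k) ⊗ₖ f x = 1 ⊗ₖ ∑ x, f x := by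
      ext ⟨a, i⟩ ⟨b, j⟩
      simp [Matrix.sum_apply, Finset.mul_sum]
    rw [h1, hs, one_kronecker_one]

/-- Equivariance under ker π, which fixes the index set, says that each part commutes with `M x ⊗ 1`
for x in ker π. Each part therefore has the form 1 ⊗ β, and the β decompose the identity of `B`. -/
theorem TripleLink.higmanOn_of_kron (hL : TripleLink α π M) {Ω : Type*} [MulAction Γ Ω] [Finite Ω]
    (hΩ : ∀ x ∈ π.ker, ∀ y : Ω, x • y = y) {B : J₁ →* Matrix I I k}
    (h : HigmanOn (matKron M (B.comp π)) Ω) : HigmanOn (B.comp π) Ω := by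
  have := Fintype.ofFinite Ω
  have := hL.nonempty
  obtain ⟨f, hf, hs⟩ := h
  have h1 : ∀ y, ∃ S : Matrix I I k, f y = (1 : Matrix D D k) ⊗ₖ S := fun y =>
    hL.exists_one_kronecker fun x hx => by
      have h2 := hf x y
      have h3 : ∀ z ∈ π.ker, matKron M (B.comp π) z = M z ⊗ₖ 1 := fun z hz => by
        rw [matKron_apply, MonoidHom.comp_apply, MonoidHom.mem_ker.mp hz, map_one]
      rw [hΩ x hx, h3 x hx, h3 _ (inv_mem hx)] at h2
      conv_rhs => rw [h2]
      rw [Matrix.mul_assoc, ← mul_kronecker_mul, ← map_mul, inv_mul_cancel, map_one,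
        Matrix.one_mul, one_kronecker_one, Matrix.mul_one]
  choose β hβ using h1
  refine ⟨β, fun g x => one_kronecker_injective (D := D) ?_, one_kronecker_injective (D := D) ?_⟩
  · change _ = (1 : Matrix D D k) ⊗ₖ _
    change (1 : Matrix D D k) ⊗ₖ _ = _
    rw [← hβ, hf, hβ, matKron_apply, matKron_apply, ← mul_kronecker_mul, ← mul_kronecker_mul,
      Matrix.mul_one, ← map_mul, mul_inv_cancel, map_one]
  · rw [finsum_eq_sum_of_fintype] at hs ⊢
    have h1 : ∑ x, (1 : Matrix D D k) ⊗ₖ β x = 1 ⊗ₖ ∑ x, β x := by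
      ext ⟨a, i⟩ ⟨b, j⟩
      simp [Matrix.sum_apply, Finset.mul_sum]
    change (1 : Matrix D D k) ⊗ₖ (∑ x, β x) = (1 : Matrix D D k) ⊗ₖ (1 : Matrix I I k)
    rw [← h1, one_kronecker_one, ← hs]
    simp only [hβ]

/-- Enlarging the preimage of `Y` by the normal subgroup ker π makes ker π act trivially on the
coset space, as needed to remove the tensor factor. -/
theorem TripleLink.higman_right [Finite Γ] (hL : TripleLink α π M) {A : J →* Matrix I I k}
    {B : J₁ →* Matrix L L k} (h : Corr α π M A B) {Y : Subgroup J} (hY : Higman A Y) :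
    Higman B ((Y.comap α ⊔ π.ker).map π) := by
  refine Higman.of_comp hL.surj_right (hL.higmanOn_of_kron (fun x hx y => ?_)
    (((hY.comp hL.surj_left).mono le_sup_left).eqv h.symm))
  induction y using QuotientGroup.induction_on with
  | _ y =>
  refine QuotientGroup.eq.mpr ?_
  have h1 : (y⁻¹ * x * y)⁻¹ ∈ π.ker := by
    have := (inferInstance : π.ker.Normal).conj_mem x hx y⁻¹
    rw [inv_inv] at this
    exact inv_mem this
  have h2 : (x • y)⁻¹ * y = (y⁻¹ * x * y)⁻¹ := by rw [smul_eq_mul]; group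
  rw [h2]
  exact Subgroup.mem_sup_right h1

theorem TripleLink.higman_left [Finite Γ] (hL : TripleLink α π M) {A : J →* Matrix I I k}
    {B : J₁ →* Matrix L L k} (h : Corr α π M A B) {Y₁ : Subgroup J₁} (hY : Higman B Y₁) :
    Higman A ((Y₁.comap π ⊔ α.ker).map α) :=
  Higman.of_comp hL.surj_left (HigmanOn.eqv h
    (HigmanOn.kron ((hY.comp hL.surj_right).mono le_sup_left)))

/-- A vertex of `B` is chosen inside the subgroup transferred from `Y`. Transferring back gives a
subgroup for `A` that contains a conjugate of `Y`, so modulo ker α and ker π each vertex is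
contained in the other up to conjugacy. -/
theorem TripleLink.exists_vertex [Finite Γ] (hL : TripleLink α π M) {A : J →* Matrix I I k}
    {B : J₁ →* Matrix L L k} [Nonempty I] (h : Corr α π M A B) (hA : MatSchur A)
    {Y : Subgroup J} (hY : Minimal (Higman A) Y) :
    ∃ Y₁ : Subgroup J₁, Minimal (Higman B) Y₁ ∧
      Y.comap α ⊔ π.ker = Y₁.comap π ⊔ α.ker := by
  have := Finite.of_surjective α hL.surj_left
  have := Finite.of_surjective π hL.surj_right
  obtain ⟨Y₁, hle, hY₁⟩ := exists_minimal_le_of_wellFoundedLT (Higman B) _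
    (hL.higman_right h hY.1)
  refine ⟨Y₁, hY₁, ?_⟩
  have h1 : Y₁.comap π ⊔ α.ker ≤ Y.comap α ⊔ π.ker := by
    refine sup_le ?_ (le_sup_of_le_left (Subgroup.ker_le_comap _ _))
    refine (Subgroup.comap_mono hle).trans ?_
    rw [Subgroup.comap_map_eq, sup_assoc, sup_idem]
  obtain ⟨g, hg⟩ := (hL.higman_left h hY₁.1).exists_le_conj hA hY
  obtain ⟨x, rfl⟩ := hL.surj_left g
  have h2 : Y.comap α ⊔ π.ker ≤ (Y₁.comap π ⊔ α.ker).map (MulAut.conj x).toMonoidHom := by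
    have key : ∀ z, x⁻¹ * z * x ∈ Y₁.comap π ⊔ α.ker →
        z ∈ (Y₁.comap π ⊔ α.ker).map (MulAut.conj x).toMonoidHom := fun z hz =>
      ⟨_, hz, by
        change x * (x⁻¹ * z * x) * x⁻¹ = z
        group⟩
    refine sup_le (fun z hz => key z ?_) (fun z hz => key z ?_)
    · have h3 := hg _ hz
      rw [← map_inv, ← map_mul, ← map_mul] at h3
      have h4 : x⁻¹ * z * x ∈ ((Y₁.comap π ⊔ α.ker).map α).comap α := h3
      rwa [Subgroup.comap_map_eq, sup_assoc, sup_idem] at h4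
    · have h3 := (inferInstance : π.ker.Normal).conj_mem z hz x⁻¹
      rw [inv_inv] at h3
      exact Subgroup.mem_sup_left (Subgroup.ker_le_comap _ _ h3)
  -- One inclusion is literal, the other only up to conjugacy; comparing orders gives equality.
  refine (Subgroup.eq_of_le_of_card_ge h1 ?_).symm
  refine (Subgroup.card_le_of_le h2).trans (le_of_eq ?_)
  exact Subgroup.card_map_of_injective (MulEquiv.injective _)

end HigmanTransfer

/-! ### The span of a representation over its character field -/

section KForm

open Matrix

variable {F : Type*} [Field F] (kk : Subfield F) {Z : Type*} [Group Z]
variable {D : Type*} [Fintype D] [DecidableEq D] (M : Z →* Matrix D D F)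

/-- The span of the values of a matrix representation over a subfield. -/
def kForm : Submodule kk (Matrix D D F) := Submodule.span kk (Set.range M)

variable {kk M}

theorem mem_kForm (z : Z) : M z ∈ kForm kk M := Submodule.subset_span ⟨z, rfl⟩

theorem mul_mem_kForm {X Y : Matrix D D F} (hX : X ∈ kForm kk M) (hY : Y ∈ kForm kk M) :
    X * Y ∈ kForm kk M := by
  induction hX using Submodule.span_induction with
  | mem X hX =>
    obtain ⟨z, rfl⟩ := hX
    induction hY using Submodule.span_induction with
    | mem Y hY =>
      obtain ⟨w, rfl⟩ := hY
      rw [← map_mul]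
      exact mem_kForm _
    | zero => rw [Matrix.mul_zero]; exact zero_mem _
    | add Y Y' _ _ h h' => rw [Matrix.mul_add]; exact add_mem h h'
    | smul c Y _ h => rw [Matrix.mul_smul]; exact Submodule.smul_mem _ _ h
  | zero => rw [Matrix.zero_mul]; exact zero_mem _
  | add X X' _ _ h h' => rw [Matrix.add_mul]; exact add_mem h h'
  | smul c X _ h => rw [Matrix.smul_mul]; exact Submodule.smul_mem _ _ h

theorem one_mem_kForm : (1 : Matrix D D F) ∈ kForm kk M := map_one M ▸ mem_kForm (1 : Z)

theorem pow_mem_kForm {X : Matrix D D F} (hX : X ∈ kForm kk M) (m : ℕ) : X ^ m ∈ kForm kk M := by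
  induction m with
  | zero => rw [pow_zero]; exact one_mem_kForm
  | succ m ih => rw [pow_succ]; exact mul_mem_kForm ih hX

/-- In a finite group of units the inverse is a power, and the span is closed under multiplication.
-/
theorem inv_mem_kForm [Finite F] {u : (Matrix D D F)ˣ} (hu : (u : Matrix D D F) ∈ kForm kk M) :
    ((u⁻¹ : (Matrix D D F)ˣ) : Matrix D D F) ∈ kForm kk M := by
  have : Finite (Matrix D D F) := Matrix.instFinite F
  obtain ⟨m, hm0, hm⟩ := (isOfFinOrder_of_finite u).exists_pow_eq_one
  have h1 : u⁻¹ = u ^ (m - 1) := by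
    rw [inv_eq_iff_mul_eq_one, ← pow_succ', Nat.sub_add_cancel hm0, hm]
  rw [h1, Units.val_pow_eq_pow_val]
  exact pow_mem_kForm hu _

theorem trace_mem_of_mem_kForm (htr : ∀ z, (M z).trace ∈ kk) {X : Matrix D D F}
    (hX : X ∈ kForm kk M) : X.trace ∈ kk := by
  induction hX using Submodule.span_induction with
  | mem X hX => obtain ⟨z, rfl⟩ := hX; exact htr z
  | zero => rw [trace_zero]; exact zero_mem _
  | add X Y _ _ h h' => rw [trace_add]; exact add_mem h h'
  | smul c X _ h =>
    rw [trace_smul, Subfield.smul_def, smul_eq_mul]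
    exact mul_mem c.2 h

theorem mem_of_span_eq_top (hM : Submodule.span F (Set.range M) = ⊤)
    (S : Submodule F (Matrix D D F)) (h : ∀ z, M z ∈ S) (X : Matrix D D F) : X ∈ S := by
  have h1 : (⊤ : Submodule F (Matrix D D F)) ≤ S := by
    rw [← hM, Submodule.span_le]
    rintro _ ⟨z, rfl⟩
    exact h z
  exact h1 trivial

/-- Nondegeneracy of the trace form, tested only on the span over the subfield; this is enough
because that span contains a spanning set over F. -/
theorem eq_of_trace_mul_eq (hM : Submodule.span F (Set.range M) = ⊤) {X X' : Matrix D D F}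
    (h : ∀ Y ∈ kForm kk M, (X * Y).trace = (X' * Y).trace) : X = X' := by
  rw [Matrix.ext_iff_trace_mul_right]
  intro Y
  have h2 := mem_of_span_eq_top hM
    (LinearMap.ker (traceLinearMap D F F ∘ₗ LinearMap.mulLeft F X
      - traceLinearMap D F F ∘ₗ LinearMap.mulLeft F X')) (fun z => by
        rw [LinearMap.mem_ker, LinearMap.sub_apply, sub_eq_zero]
        exact h _ (mem_kForm z)) Y
  rw [LinearMap.mem_ker, LinearMap.sub_apply, sub_eq_zero] at h2
  exact h2

theorem eq_smul_one_of_commute (hM : Submodule.span F (Set.range M) = ⊤) {C : Matrix D D F}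
    (h : ∀ z, C * M z = M z * C) : ∃ c : F, C = c • (1 : Matrix D D F) := by
  have h1 : ∀ X, C * X = X * C := fun X => by
    have h2 := mem_of_span_eq_top hM
      (LinearMap.ker (LinearMap.mulLeft F C - LinearMap.mulRight F C)) (fun z => by
        rw [LinearMap.mem_ker, LinearMap.sub_apply, sub_eq_zero]
        exact h z) X
    rw [LinearMap.mem_ker, LinearMap.sub_apply, sub_eq_zero] at h2
    exact h2
  obtain ⟨c, hc⟩ := Matrix.mem_range_scalar_of_commute_single (M := C)
    (fun i j _ => (h1 (single i j 1)).symm)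
  exact ⟨c, by rw [← hc, scalar_apply, smul_one_eq_diagonal]⟩

/-- On the span over the subfield the trace form takes values in the subfield and is nondegenerate,
so each functional there is represented by an element of the span. The functional used is Y ↦
l(tr(XY)); it serves as a projection of `X` to the span. -/
theorem exists_mem_kForm_trace [Finite F] (hM : Submodule.span F (Set.range M) = ⊤)
    (htr : ∀ z, (M z).trace ∈ kk) (l : F →ₗ[kk] kk) (X : Matrix D D F) :
    ∃ X' ∈ kForm kk M, ∀ Y ∈ kForm kk M, (X' * Y).trace = l (X * Y).trace := by
  have : Finite (Matrix D D F) := Matrix.instFinite F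
  let V := kForm kk M
  let B : V →ₗ[kk] Module.Dual kk V := LinearMap.mk₂ kk
    (fun X Y => (⟨(X.1 * Y.1).trace, trace_mem_of_mem_kForm htr (mul_mem_kForm X.2 Y.2)⟩ : kk))
    (fun X X' Y => Subtype.ext (by simp [Matrix.add_mul]))
    (fun c X Y => Subtype.ext (by simp [Subfield.smul_def]))
    (fun X Y Y' => Subtype.ext (by simp [Matrix.mul_add]))
    (fun c X Y => Subtype.ext (by simp [Subfield.smul_def]))
  have hB : ∀ X Y, ((B X Y : kk) : F) = (X.1 * Y.1).trace := fun X Y => rfl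
  have hinj : Function.Injective B := fun X X' h => Subtype.ext
    (eq_of_trace_mul_eq (kk := kk) hM fun Y hY => by
      have := congrArg (fun f => ((f ⟨Y, hY⟩ : kk) : F)) h
      exact this)
  have hsurj : Function.Surjective B :=
    (LinearMap.injective_iff_surjective_of_finrank_eq_finrank Subspace.dual_finrank_eq.symm).mp
      hinj
  let f : Module.Dual kk V :=
    { toFun := fun Y => l (X * Y.1).trace
      map_add' := fun Y Y' => by
        rw [Submodule.coe_add, Matrix.mul_add, trace_add, map_add]
      map_smul' := fun c Y => by
        rw [SetLike.val_smul, Matrix.mul_smul, trace_smul, map_smul]; rfl }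
  obtain ⟨X', hX'⟩ := hsurj f
  refine ⟨X'.1, X'.2, fun Y hY => ?_⟩
  rw [← hB X' ⟨Y, hY⟩, hX']
  rfl

/-- Multiply c · 1 by an element of the span with nonzero trace, and divide traces. -/
theorem smul_one_mem_kForm_iff [Nonempty D] (hM : Submodule.span F (Set.range M) = ⊤)
    (htr : ∀ z, (M z).trace ∈ kk) {c : F} : c • (1 : Matrix D D F) ∈ kForm kk M ↔ c ∈ kk := by
  constructor
  · intro hc
    obtain ⟨Y, hY, hY0⟩ : ∃ Y ∈ kForm kk M, Y.trace ≠ 0 := by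
      by_contra! h
      have h1 : (1 : Matrix D D F) = 0 := eq_of_trace_mul_eq (kk := kk) hM fun Y hY => by
        rw [Matrix.one_mul, Matrix.zero_mul, trace_zero, h Y hY]
      exact one_ne_zero h1
    have h1 := trace_mem_of_mem_kForm htr (mul_mem_kForm hc hY)
    rw [Matrix.smul_mul, Matrix.one_mul, trace_smul, smul_eq_mul] at h1
    have h2 := mul_mem h1 (inv_mem (trace_mem_of_mem_kForm htr hY))
    rwa [mul_inv_cancel_right₀ hY0] at h2
  · intro hc
    exact Submodule.smul_mem _ (⟨c, hc⟩ : kk) one_mem_kForm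

/-- An intertwiner can be rescaled to have its entries in the form over the subfield. -/
theorem exists_unit_mem_kForm [Finite F] (hM : Submodule.span F (Set.range M) = ⊤)
    (htr : ∀ z, (M z).trace ∈ kk) [Nonempty D] {T T' : Matrix D D F} (h1 : T' * T = 1)
    (h2 : T * T' = 1) (c : Z → Z) (hT : ∀ z, T * M z = M (c z) * T) :
    ∃ u : (Matrix D D F)ˣ, (u : Matrix D D F) ∈ kForm kk M ∧
      ∀ z, (u : Matrix D D F) * M z = M (c z) * u := by
  obtain ⟨Y, hY, hY0⟩ : ∃ Y ∈ kForm kk M, (T * Y).trace ≠ 0 := by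
    by_contra! h
    have h3 : T = 0 := eq_of_trace_mul_eq (kk := kk) hM fun Y hY => by
      rw [h Y hY, Matrix.zero_mul, trace_zero]
    rw [h3, Matrix.mul_zero] at h1
    exact zero_ne_one h1
  obtain ⟨l, hl⟩ : ∃ l : Module.Dual kk F, l (T * Y).trace ≠ 0 := by
    by_contra! h
    exact hY0 ((Module.forall_dual_apply_eq_zero_iff kk _).mp h)
  -- The projection `X` of `T` to the span inherits the intertwining relation, since the relation
  -- can be tested by traces against the span. Schur's lemma then makes `X` a scalar multiple of
  -- `T`; the choice of `l` and `Y` keeps it nonzero.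
  obtain ⟨X, hX, hXt⟩ := exists_mem_kForm_trace hM htr l T
  have hX0 : X ≠ 0 := by
    rintro rfl
    have := hXt Y hY
    rw [Matrix.zero_mul, trace_zero] at this
    exact hl (Subtype.ext this.symm)
  have hXM : ∀ z, X * M z = M (c z) * X := fun z => by
    have h3 : M (c z)⁻¹ * (X * M z) = X := eq_of_trace_mul_eq (kk := kk) hM fun W hW => by
      have e : ∀ S : Matrix D D F, (M (c z)⁻¹ * (S * M z) * W).trace
          = (S * (M z * W * M (c z)⁻¹)).trace := fun S => by
        rw [Matrix.mul_assoc, trace_mul_comm]; simp only [Matrix.mul_assoc]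
      rw [e, hXt _ (mul_mem_kForm (mul_mem_kForm (mem_kForm z) hW) (mem_kForm _)), ← e, hT,
        ← Matrix.mul_assoc, ← map_mul, inv_mul_cancel, map_one, Matrix.one_mul, hXt W hW]
    conv_rhs => rw [← h3]
    rw [← Matrix.mul_assoc, ← map_mul, mul_inv_cancel, map_one, Matrix.one_mul]
  have hT' : ∀ z, T' * M (c z) = M z * T' := fun z => by
    calc T' * M (c z) = T' * (M (c z) * T) * T' := by
          rw [Matrix.mul_assoc, Matrix.mul_assoc, h2, Matrix.mul_one]
      _ = M z * T' := by rw [← hT, ← Matrix.mul_assoc, h1, Matrix.one_mul]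
  obtain ⟨s, hs⟩ := eq_smul_one_of_commute hM (C := T' * X) fun z => by
    rw [Matrix.mul_assoc, hXM, ← Matrix.mul_assoc, hT', Matrix.mul_assoc]
  have hXs : X = s • T := by
    calc X = T * (T' * X) := by rw [← Matrix.mul_assoc, h2, Matrix.one_mul]
      _ = s • T := by rw [hs, Matrix.mul_smul, Matrix.mul_one]
  have hs0 : s ≠ 0 := by
    rintro rfl
    exact hX0 (by rw [hXs, zero_smul])
  exact ⟨⟨X, s⁻¹ • T', by
    rw [hXs, Matrix.smul_mul, Matrix.mul_smul, smul_smul, h2, mul_inv_cancel₀ hs0, one_smul], by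
    rw [hXs, Matrix.smul_mul, Matrix.mul_smul, smul_smul, h1, inv_mul_cancel₀ hs0, one_smul]⟩,
    hX, hXM⟩

theorem map_mem_kForm {s : RingAut F} (hs : ∀ c ∈ kk, s c ∈ kk) {f : Z → Z} {T T' : Matrix D D F}
    (h : ∀ z, T * (M z).map s * T' = M (f z)) {X : Matrix D D F} (hX : X ∈ kForm kk M) :
    T * X.map s * T' ∈ kForm kk M := by
  induction hX using Submodule.span_induction with
  | mem X hX => obtain ⟨z, rfl⟩ := hX; rw [h]; exact mem_kForm _
  | zero =>
    rw [Matrix.map_zero _ (map_zero s), Matrix.mul_zero, Matrix.zero_mul]; exact zero_mem _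
  | add X Y _ _ hX hY =>
    rw [Matrix.map_add _ (map_add s), Matrix.mul_add, Matrix.add_mul]; exact add_mem hX hY
  | smul c X _ hX =>
    have h1 : (c • X).map s = (⟨s c, hs c c.2⟩ : kk) • X.map s := by
      ext i j
      simp [Subfield.smul_def]
    rw [h1, Matrix.mul_smul, Matrix.smul_mul]
    exact Submodule.smul_mem _ _ hX

end KForm

/-! ### The group Γ of pairs (g, u) -/

section LinkGroup

open Matrix

variable {k : Type*} [Field k] {G Γ G₁ : Type*} [Group G] [Group Γ] [Group G₁]
variable {D : Type*} [Fintype D] [DecidableEq D]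

/-- A link in which the big group embeds both in `G × GL` and in `G × G₁`. -/
structure FullLink (α : Γ →* G) (π : Γ →* G₁) (M : Γ →* Matrix D D k) : Prop
    extends TripleLink α π M where
  faithful : ∀ x, α x = 1 → M x = 1 → x = 1
  disjoint : ∀ x ∈ π.ker, α x = 1 → x = 1

/-- An automorphism of the big group compatible with a field automorphism and with
an automorphism of `G`. -/
def LinkCompat (α : Γ →* G) (π : Γ →* G₁) (M : Γ →* Matrix D D k) (s : RingAut k) (φ : MulAut G)
    (θ : MulAut Γ) : Prop :=
  (∀ x, α (θ x) = φ (α x)) ∧ (∀ x ∈ π.ker, θ x ∈ π.ker) ∧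
    ∃ T T' : Matrix D D k, T' * T = 1 ∧ T * T' = 1 ∧ ∀ x, T * (M x).map s = M (θ x) * T

variable {F : Type*} [Field F] [Finite F] (kk : Subfield F) {Z : Subgroup G} [Z.Normal]
  (M : Z →* Matrix D D F)

/-- The group of pairs consisting of an element of `G` and a matrix over the subfield which
induces the same automorphism on the image of `Z`. -/
def linkGroup : Subgroup (G × (Matrix D D F)ˣ) where
  carrier := {x | (x.2 : Matrix D D F) ∈ kForm kk M ∧
    ∀ z, (x.2 : Matrix D D F) * M z = M (MulAut.conjNormal x.1 z) * x.2}
  one_mem' := ⟨one_mem_kForm, fun z => by simp⟩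
  mul_mem' := fun {x y} hx hy => ⟨by
    rw [Prod.snd_mul, Units.val_mul]; exact mul_mem_kForm hx.1 hy.1, fun z => by
    rw [Prod.snd_mul, Units.val_mul, Matrix.mul_assoc, hy.2, ← Matrix.mul_assoc, hx.2,
      Prod.fst_mul, map_mul, Matrix.mul_assoc]; rfl⟩
  inv_mem' := fun {x} hx => ⟨inv_mem_kForm hx.1, fun z => by
    have h := hx.2 (MulAut.conjNormal x.1⁻¹ z)
    have h1 : MulAut.conjNormal x.1 (MulAut.conjNormal x.1⁻¹ z) = z := by
      rw [← MulAut.mul_apply, ← map_mul, mul_inv_cancel, map_one, MulAut.one_apply]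
    rw [h1] at h
    change ((x.2⁻¹ : (Matrix D D F)ˣ) : Matrix D D F) * M z = M (MulAut.conjNormal x.1⁻¹ z) * _
    change _ = M (MulAut.conjNormal x.1⁻¹ z) * ((x.2⁻¹ : (Matrix D D F)ˣ) : Matrix D D F)
    rw [Units.inv_mul_eq_iff_eq_mul, ← Matrix.mul_assoc, h, Matrix.mul_assoc, Units.mul_inv,
      Matrix.mul_one]⟩

variable {kk M}

/-- The projection of the link group to `G`. -/
def linkFst : linkGroup kk M →* G := (MonoidHom.fst _ _).comp (linkGroup kk M).subtype

/-- The tautological representation of the link group. -/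
def linkRep : linkGroup kk M →* Matrix D D F :=
  (Units.coeHom _).comp ((MonoidHom.snd _ _).comp (linkGroup kk M).subtype)

/-- The embedding of `Z` in the link group. -/
def linkIncl : Z →* linkGroup kk M :=
  (Z.subtype.prod M.toHomUnits).codRestrict _ fun z => ⟨mem_kForm z, fun w => by
    change M z * M w = M (MulAut.conjNormal (z : G) w) * M z
    rw [← map_mul, ← map_mul]
    congr 1
    refine Subtype.ext ?_
    simp⟩

theorem linkFst_linkIncl (z : Z) : linkFst (linkIncl (kk := kk) (M := M) z) = z := rfl

theorem linkRep_linkIncl (z : Z) : linkRep (linkIncl (kk := kk) (M := M) z) = M z := rfl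

theorem linkRep_mem (x : linkGroup kk M) : linkRep x ∈ kForm kk M := x.2.1

theorem linkRep_mul (x : linkGroup kk M) (z : Z) :
    linkRep x * M z = M (MulAut.conjNormal (linkFst x) z) * linkRep x := x.2.2 z

theorem linkGroup_ext {x y : linkGroup kk M} (h : linkFst x = linkFst y)
    (h' : linkRep x = linkRep y) : x = y :=
  Subtype.ext (Prod.ext h (Units.ext h'))

theorem exists_linkGroup {g : G} {u : (Matrix D D F)ˣ} (hu : (u : Matrix D D F) ∈ kForm kk M)
    (h : ∀ z, (u : Matrix D D F) * M z = M (MulAut.conjNormal g z) * u) :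
    ∃ x : linkGroup kk M, linkFst x = g ∧ linkRep x = u :=
  ⟨⟨(g, u), hu, h⟩, rfl, rfl⟩

instance normal_range_linkIncl : (linkIncl (kk := kk) (M := M)).range.Normal := by
  refine ⟨?_⟩
  rintro _ ⟨z, rfl⟩ x
  refine ⟨MulAut.conjNormal (linkFst x) z, linkGroup_ext ?_ ?_⟩
  · rw [linkFst_linkIncl, map_mul, map_mul, map_inv, linkFst_linkIncl, MulAut.conjNormal_apply]
  · rw [linkRep_linkIncl, map_mul, map_mul, linkRep_linkIncl, linkRep_mul, Matrix.mul_assoc,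
      ← map_mul, mul_inv_cancel, map_one, Matrix.mul_one]

/-- The automorphism is (g, u) ↦ (φ(g), T s(u) T'). It preserves the group because `s` preserves the
subfield and the conjugated twist of `M z` is `M (f z)`. -/
theorem exists_link_aut [Finite G] {s : RingAut F} (hs : ∀ c ∈ kk, s c ∈ kk) {φ : MulAut G}
    {f : Z → Z} (hf : ∀ z, (f z : G) = φ z) (hf' : Function.Surjective f) {T T' : Matrix D D F}
    (h1 : T' * T = 1) (h2 : T * T' = 1) (h : ∀ z, T * (M z).map s = M (f z) * T) :
    ∃ θ : MulAut (linkGroup kk M), (∀ x, linkFst (θ x) = φ (linkFst x)) ∧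
      (∀ z, θ (linkIncl z) = linkIncl (f z)) ∧
      ∀ x, T * (linkRep x).map s = linkRep (θ x) * T := by
  have : Finite (Matrix D D F) := Matrix.instFinite F
  let V : (Matrix D D F)ˣ := ⟨T, T', h2, h1⟩
  let C : (Matrix D D F)ˣ →* (Matrix D D F)ˣ := (MulAut.conj V).toMonoidHom.comp
    (Units.map ((s : F →+* F).mapMatrix (m := D)).toMonoidHom)
  have hC : ∀ u : (Matrix D D F)ˣ, ((C u : (Matrix D D F)ˣ) : Matrix D D F)
      = T * (u : Matrix D D F).map s * T' := fun u => rfl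
  have hM : ∀ z, T * (M z).map s * T' = M (f z) := fun z => by
    rw [h, Matrix.mul_assoc, h2, Matrix.mul_one]
  have hmem : ∀ x : linkGroup kk M, ((φ.toMonoidHom.prodMap C).comp (linkGroup kk M).subtype) x
      ∈ linkGroup kk M := by
    intro x
    refine ⟨map_mem_kForm hs hM x.2.1, fun z => ?_⟩
    obtain ⟨z, rfl⟩ := hf' z
    change T * (linkRep x).map s * T' * M (f z)
      = M (MulAut.conjNormal (φ (linkFst x)) (f z)) * (T * (linkRep x).map s * T')
    have e1 : MulAut.conjNormal (φ (linkFst x)) (f z) = f (MulAut.conjNormal (linkFst x) z) := by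
      refine Subtype.ext ?_
      rw [MulAut.conjNormal_apply, hf, hf, MulAut.conjNormal_apply, map_mul, map_mul, map_inv]
    rw [e1, ← hM, ← hM]
    calc T * (linkRep x).map s * T' * (T * (M z).map s * T')
        = T * (linkRep x).map s * (T' * T) * (M z).map s * T' := by simp only [Matrix.mul_assoc]
      _ = T * (linkRep x * M z).map s * T' := by
          rw [h1, Matrix.mul_one, map_mul_ringAut, Matrix.mul_assoc T]
      _ = T * (M (MulAut.conjNormal (linkFst x) z)).map s * (T' * T) * (linkRep x).map s * T' := by
          rw [h1, Matrix.mul_one, linkRep_mul, map_mul_ringAut]; simp only [Matrix.mul_assoc]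
      _ = _ := by simp only [Matrix.mul_assoc]
  let θ : linkGroup kk M →* linkGroup kk M := MonoidHom.codRestrict _ _ hmem
  have hfst : ∀ x, linkFst (θ x) = φ (linkFst x) := fun x => rfl
  have hrep : ∀ x, linkRep (θ x) = T * (linkRep x).map s * T' := fun x => rfl
  have hinj : Function.Injective θ := by
    rw [injective_iff_map_eq_one]
    intro x hx
    have e1 := hfst x
    have e2 := hrep x
    rw [hx, map_one] at e1 e2
    refine linkGroup_ext ?_ ?_
    · rw [map_one]
      exact (φ.injective (by rw [← e1, map_one]))
    · rw [map_one]
      have e3 : (linkRep x).map s = 1 := by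
        calc (linkRep x).map s = (T' * T) * (linkRep x).map s * (T' * T) := by
              rw [h1, Matrix.one_mul, Matrix.mul_one]
          _ = T' * (T * (linkRep x).map s * T') * T := by simp only [Matrix.mul_assoc]
          _ = 1 := by rw [← e2, Matrix.mul_one, h1]
      refine Matrix.map_injective s.injective ?_
      exact e3.trans (Matrix.map_one s (map_zero s) (map_one s)).symm
  refine ⟨MulEquiv.ofBijective θ (Finite.injective_iff_bijective.mp hinj), hfst, fun z => ?_,
    fun x => ?_⟩
  · refine linkGroup_ext ?_ ?_
    · rw [linkFst_linkIncl, hf]; rfl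
    · rw [linkRep_linkIncl, ← hM]; rfl
  · change _ = linkRep (θ x) * T
    rw [hrep, Matrix.mul_assoc, h1, Matrix.mul_one]

end LinkGroup

universe u v

/-! ### Construction of Γ, G₁ and the two projections -/

section LinkExistence

open Matrix

/-- The existence of a link with a prescribed kernel. -/
theorem exists_fullLink {G : Type u} [Group G] [Finite G] {Z : Subgroup G} [Z.Normal]
    {F : Type v} [Field F] [Finite F] (kk : Subfield F) {D : Type*} [Fintype D] [DecidableEq D]
    [Nonempty D] (M : Z →* Matrix D D F) (hM : Submodule.span F (Set.range M) = ⊤)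
    (htr : ∀ z, (M z).trace ∈ kk)
    (hT : ∀ g : G, ∃ T T' : Matrix D D F, T' * T = 1 ∧ T * T' = 1 ∧
      ∀ z, T * M z = M (MulAut.conjNormal g z) * T) :
    ∃ (Γ : Type u) (_ : Group Γ) (_ : Finite Γ) (G₁ : Type u) (_ : Group G₁) (_ : Finite G₁)
      (α : Γ →* G) (π : Γ →* G₁) (R : Γ →* Matrix D D F),
      FullLink α π R ∧
      (∀ x ∈ π.ker, ∃ z : Z, α x = z ∧ R x = M z) ∧
      (∀ z : Z, ∃ x ∈ π.ker, α x = z) ∧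
      (∀ x ∈ α.ker, ∃ c ∈ kk, R x = c • (1 : Matrix D D F)) ∧
      (∀ c ∈ kk, c ≠ 0 → ∃ x ∈ α.ker, R x = c • (1 : Matrix D D F)) ∧
      ∀ (s : RingAut F) (φ : MulAut G) (f : Z → Z), (∀ c ∈ kk, s c ∈ kk) →
        (∀ z, (f z : G) = φ z) → Function.Surjective f →
        (∃ T T' : Matrix D D F, T' * T = 1 ∧ T * T' = 1 ∧
          ∀ z, T * (M z).map s = M (f z) * T) →
        ∃ θ : MulAut Γ, LinkCompat α π R s φ θ := by
  have : Finite (Matrix D D F) := Matrix.instFinite F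
  -- The group of pairs also involves the universes of F and of the index type; being finite, it has
  -- a copy in the universe of `G`.
  obtain ⟨Γ, iΓ, hΓ, ⟨e⟩⟩ := Finite.exists_type_univ_nonempty_mulEquiv.{_, u} (linkGroup kk M)
  obtain ⟨G₁, iG₁, hG₁, ⟨e₁⟩⟩ := Finite.exists_type_univ_nonempty_mulEquiv.{_, u}
    (linkGroup kk M ⧸ (linkIncl (kk := kk) (M := M)).range)
  let α : Γ →* G := linkFst.comp e.symm.toMonoidHom
  let π : Γ →* G₁ := e₁.toMonoidHom.comp
    ((QuotientGroup.mk' (linkIncl (kk := kk) (M := M)).range).comp e.symm.toMonoidHom)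
  let R : Γ →* Matrix D D F := linkRep.comp e.symm.toMonoidHom
  have hα : ∀ x, α x = linkFst (e.symm x) := fun _ => rfl
  have hR : ∀ x, R x = linkRep (e.symm x) := fun _ => rfl
  have hker : ∀ x, x ∈ π.ker ↔ ∃ z, linkIncl z = e.symm x := fun x => by
    rw [MonoidHom.mem_ker]
    change e₁ (QuotientGroup.mk' _ (e.symm x)) = 1 ↔ _
    rw [EmbeddingLike.map_eq_one_iff, QuotientGroup.mk'_apply, QuotientGroup.eq_one_iff]
    rfl
  have hscal : ∀ x ∈ α.ker, ∃ c ∈ kk, R x = c • (1 : Matrix D D F) := fun x hx => by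
    obtain ⟨c, hc⟩ := eq_smul_one_of_commute hM (C := R x) fun z => by
      rw [hR, linkRep_mul, ← hα, MonoidHom.mem_ker.mp hx, map_one, MulAut.one_apply]
    refine ⟨c, ?_, hc⟩
    have h1 := linkRep_mem (e.symm x)
    rw [← hR, hc] at h1
    exact (smul_one_mem_kForm_iff hM htr).mp h1
  -- Surjectivity is where invariance enters: the matrix realizing conjugation by g is rescaled into
  -- the span over the subfield.
  have hsurj : Function.Surjective α := fun g => by
    obtain ⟨T, T', h1, h2, h3⟩ := hT g
    obtain ⟨u, hu, hu'⟩ := exists_unit_mem_kForm (kk := kk) hM htr h1 h2 _ h3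
    obtain ⟨x, hx, -⟩ := exists_linkGroup hu hu'
    exact ⟨e x, by rw [hα, e.symm_apply_apply, hx]⟩
  refine ⟨Γ, iΓ, inferInstance, G₁, iG₁, inferInstance, α, π, R,
    ⟨⟨hsurj, ?_, ?_, fun x hx => ?_, inferInstance⟩, fun x h1 h2 => ?_, fun x h1 h2 => ?_⟩,
    fun x hx => ?_, fun z => ?_, hscal, fun c hc hc0 => ?_, ?_⟩
  · exact e₁.surjective.comp ((QuotientGroup.mk'_surjective _).comp e.symm.surjective)
  · rw [eq_top_iff, ← hM]
    refine Submodule.span_mono ?_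
    rintro _ ⟨z, rfl⟩
    refine ⟨⟨e (linkIncl z), (hker _).mpr ⟨z, (e.symm_apply_apply _).symm⟩⟩, ?_⟩
    change R _ = _
    rw [hR, e.symm_apply_apply, linkRep_linkIncl]
  · obtain ⟨c, -, hc⟩ := hscal x hx
    exact ⟨c, hc⟩
  · have h3 : e.symm x = 1 := linkGroup_ext (by rw [← hα, h1, map_one]) (by rw [← hR, h2, map_one])
    rwa [EmbeddingLike.map_eq_one_iff] at h3
  · obtain ⟨z, hz⟩ := (hker x).mp h1
    rw [hα, ← hz, linkFst_linkIncl] at h2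
    have h3 : z = 1 := Subtype.ext h2
    rw [h3, map_one] at hz
    exact (EmbeddingLike.map_eq_one_iff (f := e.symm)).mp hz.symm
  · obtain ⟨z, hz⟩ := (hker x).mp hx
    exact ⟨z, by rw [hα, ← hz, linkFst_linkIncl], by rw [hR, ← hz, linkRep_linkIncl]⟩
  · exact ⟨e (linkIncl z), (hker _).mpr ⟨z, (e.symm_apply_apply _).symm⟩, by
      rw [hα, e.symm_apply_apply, linkFst_linkIncl]⟩
  · obtain ⟨x, hx, hx'⟩ := exists_linkGroup (kk := kk) (M := M) (g := 1)
      (u := ⟨c • 1, c⁻¹ • 1, by simp [smul_smul, hc0], by simp [smul_smul, hc0]⟩)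
      ((smul_one_mem_kForm_iff hM htr).mpr hc) fun z => by
        rw [map_one, MulAut.one_apply]
        change (c • (1 : Matrix D D F)) * M z = M z * (c • (1 : Matrix D D F))
        rw [Matrix.smul_mul, Matrix.mul_smul, Matrix.one_mul, Matrix.mul_one]
    refine ⟨e x, ?_, ?_⟩
    · rw [MonoidHom.mem_ker, hα, e.symm_apply_apply, hx]
    · rw [hR, e.symm_apply_apply, hx']
  · rintro s φ f hs hf hf' ⟨T, T', h1, h2, h3⟩
    obtain ⟨θ, hθ₁, hθ₂, hθ₃⟩ := exists_link_aut hs hf hf' h1 h2 h3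
    refine ⟨(e.symm.trans θ).trans e, fun x => ?_, fun x hx => ?_, T, T', h1, h2, fun x => ?_⟩
    · rw [hα, hα]
      change linkFst (e.symm (e (θ (e.symm x)))) = _
      rw [e.symm_apply_apply, hθ₁]
    · obtain ⟨z, hz⟩ := (hker x).mp hx
      refine (hker _).mpr ⟨f z, ?_⟩
      change _ = e.symm (e (θ (e.symm x)))
      rw [e.symm_apply_apply, ← hz, hθ₂]
    · rw [hR, hR]
      change _ = linkRep (e.symm (e (θ (e.symm x)))) * T
      rw [e.symm_apply_apply, hθ₃]

end LinkExistence

/-! ### Uniqueness of lifts of automorphisms, the central subgroup and its linear character -/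

section LinkAutomorphisms

open Matrix

variable {k : Type*} [Field k] {G Γ G₁ : Type*} [Group G] [Group Γ] [Group G₁]
variable {D : Type*} [Fintype D] [DecidableEq D]
variable {α : Γ →* G} {π : Γ →* G₁} {M : Γ →* Matrix D D k}

theorem FullLink.ext (hL : FullLink α π M) {x y : Γ} (h : α x = α y) (h' : M x = M y) : x = y := by
  refine mul_inv_eq_one.mp (hL.faithful _ ?_ ?_)
  · rw [map_mul, map_inv, h, mul_inv_cancel]
  · rw [map_mul, h', ← map_mul, mul_inv_cancel, map_one]

theorem FullLink.ext_of_mem_ker (hL : FullLink α π M) {x y : Γ} (hx : x ∈ π.ker) (hy : y ∈ π.ker)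
    (h : α x = α y) : x = y := by
  refine mul_inv_eq_one.mp (hL.disjoint _ (mul_mem hx (inv_mem hy)) ?_)
  rw [map_mul, map_inv, h, mul_inv_cancel]

/-- Both lifts preserve ker π, on which α is injective, so they agree there. The two intertwining
matrices then differ by a scalar because R(ker π) spans the matrix algebra; consequently the lifts
agree after applying `M`, and after α, hence everywhere. -/
theorem FullLink.compat_unique (hL : FullLink α π M) {s : RingAut k} {φ : MulAut G}
    {θ θ' : MulAut Γ} (h : LinkCompat α π M s φ θ) (h' : LinkCompat α π M s φ θ') : θ = θ' := by
  obtain ⟨hα, hπ, T, T', h1, h2, h3⟩ := h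
  obtain ⟨hα', hπ', S, S', h1', h2', h3'⟩ := h'
  obtain ⟨d⟩ := hL.nonempty
  have hs : ∀ X : Matrix D D k, (X.map s).map s.symm = X := fun X => by ext; simp
  have hs' : ∀ X : Matrix D D k, (X.map s.symm).map s = X := fun X => by ext; simp
  have hS : ∀ x, S' * M (θ' x) = (M x).map s * S' := fun x => by
    calc S' * M (θ' x) = S' * (M (θ' x) * S) * S' := by
          rw [Matrix.mul_assoc, Matrix.mul_assoc, h2', Matrix.mul_one]
      _ = (M x).map s * S' := by rw [← h3', ← Matrix.mul_assoc, h1', Matrix.one_mul]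
  obtain ⟨c, hc⟩ := eq_smul_one_of_commute (M := M.comp π.ker.subtype) hL.span_eq_top
    (C := (S' * T).map s.symm) fun x => by
      have e1 : θ x = θ' x := hL.ext_of_mem_ker (hπ x x.2) (hπ' x x.2) (by rw [hα, hα'])
      change (S' * T).map s.symm * M x = M x * (S' * T).map s.symm
      conv_lhs => rw [← hs (M x)]
      conv_rhs => rw [← hs (M x)]
      rw [← map_mul_ringAut s.symm, ← map_mul_ringAut s.symm, Matrix.mul_assoc, h3, e1,
        ← Matrix.mul_assoc, hS, Matrix.mul_assoc]
  have hc' : S' * T = s c • (1 : Matrix D D k) := by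
    rw [← hs' (S' * T), hc]
    ext i j
    simp [one_apply, apply_ite s]
  have hT : T = s c • S := by
    calc T = S * (S' * T) := by rw [← Matrix.mul_assoc, h2', Matrix.one_mul]
      _ = s c • S := by rw [hc', Matrix.mul_smul, Matrix.mul_one]
  have hc0 : s c ≠ 0 := fun h0 => by
    rw [h0, zero_smul] at hT
    rw [hT, Matrix.mul_zero] at h1
    have := congrFun (congrFun h1 d) d
    simp at this
  refine MulEquiv.ext fun x => hL.ext (by rw [hα, hα']) ?_
  have h4 := h3 x
  rw [hT, Matrix.smul_mul, Matrix.mul_smul, h3'] at h4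
  have h5 := smul_right_injective _ hc0 h4
  calc M (θ x) = M (θ x) * S * S' := by rw [Matrix.mul_assoc, h2', Matrix.mul_one]
    _ = M (θ' x) * S * S' := by rw [← h5]
    _ = M (θ' x) := by rw [Matrix.mul_assoc, h2', Matrix.mul_one]

theorem LinkCompat.mul {s s' : RingAut k} {φ φ' : MulAut G} {θ θ' : MulAut Γ}
    (h : LinkCompat α π M s φ θ) (h' : LinkCompat α π M s' φ' θ') :
    LinkCompat α π M (s * s') (φ * φ') (θ * θ') := by
  obtain ⟨hα, hπ, T, T', h1, h2, h3⟩ := h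
  obtain ⟨hα', hπ', S, S', h1', h2', h3'⟩ := h'
  have hs1 : (1 : Matrix D D k).map s = 1 := Matrix.map_one s (map_zero s) (map_one s)
  refine ⟨fun x => ?_, fun x hx => hπ _ (hπ' x hx), T * S.map s, S'.map s * T', ?_, ?_, fun x => ?_⟩
  · rw [MulAut.mul_apply, MulAut.mul_apply, hα, hα']
  · calc S'.map s * T' * (T * S.map s) = S'.map s * (T' * T) * S.map s := by
          simp only [Matrix.mul_assoc]
      _ = 1 := by rw [h1, Matrix.mul_one, ← map_mul_ringAut, h1', hs1]
  · calc T * S.map s * (S'.map s * T') = T * (S.map s * S'.map s) * T' := by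
          simp only [Matrix.mul_assoc]
      _ = 1 := by rw [← map_mul_ringAut, h2', hs1, Matrix.mul_one, h2]
  · have e : (M x).map (s * s') = ((M x).map s').map s := by ext; rfl
    rw [e, Matrix.mul_assoc, ← map_mul_ringAut, h3', map_mul_ringAut, ← Matrix.mul_assoc, h3,
      Matrix.mul_assoc, MulAut.mul_apply]

theorem LinkCompat.conj (x : Γ) : LinkCompat α π M 1 (MulAut.conj (α x)) (MulAut.conj x) := by
  refine ⟨fun y => ?_, fun y hy => ?_, M x, M x⁻¹, ?_, ?_, fun y => ?_⟩
  · rw [MulAut.conj_apply, MulAut.conj_apply, map_mul, map_mul, map_inv]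
  · exact (inferInstance : π.ker.Normal).conj_mem y hy x
  · rw [← map_mul, inv_mul_cancel, map_one]
  · rw [← map_mul, mul_inv_cancel, map_one]
  · have e : (M y).map (1 : RingAut k) = M y := by ext; rfl
    rw [e, ← map_mul, ← map_mul, MulAut.conj_apply, inv_mul_cancel_right]

/-- Uniqueness turns an arbitrary choice of compatible lifts into a homomorphism. -/
theorem FullLink.exists_hom (hL : FullLink α π M) {Φ : Type*} [Group Φ] (s : Φ →* RingAut k)
    (φ : Φ →* MulAut G) (h : ∀ a, ∃ θ, LinkCompat α π M (s a) (φ a) θ) :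
    ∃ Θ : Φ →* MulAut Γ, ∀ a, LinkCompat α π M (s a) (φ a) (Θ a) := by
  choose Θ hΘ using h
  exact ⟨MonoidHom.mk' Θ fun a b => hL.compat_unique (hΘ (a * b)) (by
    rw [map_mul, map_mul]; exact (hΘ a).mul (hΘ b)), hΘ⟩

theorem exists_hom_of_surjective (hπ : Function.Surjective π) {Φ : Type*} [Group Φ]
    (Θ : Φ →* MulAut Γ) (h : ∀ a, ∀ x ∈ π.ker, Θ a x ∈ π.ker) :
    ∃ Ψ : Φ →* MulAut G₁, ∀ a x, Ψ a (π x) = π (Θ a x) := by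
  have h1 : ∀ a, ∃ f : G₁ →* G₁, ∀ x, f (π x) = π (Θ a x) := fun a => by
    obtain ⟨f, hf⟩ := exists_monoidHom_of_surjective hπ (π.comp (Θ a).toMonoidHom) fun x hx => h a x hx
    exact ⟨f, hf⟩
  choose f hf using h1
  have hmul : ∀ a b, (f a).comp (f b) = f (a * b) := fun a b => MonoidHom.ext fun y => by
    obtain ⟨x, rfl⟩ := hπ y
    rw [MonoidHom.comp_apply, hf, hf, hf, map_mul, MulAut.mul_apply]
  have hone : f 1 = MonoidHom.id G₁ := MonoidHom.ext fun y => by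
    obtain ⟨x, rfl⟩ := hπ y
    rw [hf, map_one, MulAut.one_apply, MonoidHom.id_apply]
  refine ⟨MonoidHom.mk' (fun a => MonoidHom.toMulEquiv (f a) (f a⁻¹)
    (by rw [hmul, inv_mul_cancel, hone]) (by rw [hmul, mul_inv_cancel, hone])) fun a b => ?_, hf⟩
  refine MulEquiv.ext fun y => ?_
  change f (a * b) y = f a (f b y)
  rw [← hmul, MonoidHom.comp_apply]

theorem exists_mulEquiv_of_ker_eq {H H₁ : Type*} [Group H] [Group H₁] {f : Γ →* H} {g : Γ →* H₁}
    (hf : Function.Surjective f) (hg : Function.Surjective g) (h : f.ker = g.ker) :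
    ∃ e : H ≃* H₁, ∀ x, e (f x) = g x := by
  obtain ⟨u, hu⟩ := exists_monoidHom_of_surjective hf g fun x hx => by rwa [h] at hx
  obtain ⟨v, hv⟩ := exists_monoidHom_of_surjective hg f fun x hx => by rwa [← h] at hx
  refine ⟨MonoidHom.toMulEquiv u v (MonoidHom.ext fun y => ?_) (MonoidHom.ext fun y => ?_), hu⟩
  · obtain ⟨x, rfl⟩ := hf y
    rw [MonoidHom.comp_apply, hu, hv]; rfl
  · obtain ⟨x, rfl⟩ := hg y
    rw [MonoidHom.comp_apply, hv, hu]; rfl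

/-- The isomorphism between the quotients by the images of the two kernels. -/
theorem exists_quotient_mulEquiv (hα : Function.Surjective α) (hπ : Function.Surjective π)
    (Z : Subgroup G) [Z.Normal] (Z₁ : Subgroup G₁) [Z₁.Normal] (hZ : π.ker.map α = Z)
    (hZ₁ : α.ker.map π = Z₁) :
    ∃ ε : G ⧸ Z ≃* G₁ ⧸ Z₁,
      ∀ x, ε (QuotientGroup.mk (α x)) = QuotientGroup.mk (π x) := by
  refine exists_mulEquiv_of_ker_eq (f := (QuotientGroup.mk' Z).comp α)
    (g := (QuotientGroup.mk' Z₁).comp π) ((QuotientGroup.mk'_surjective Z).comp hα)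
    ((QuotientGroup.mk'_surjective Z₁).comp hπ) ?_
  rw [← MonoidHom.comap_ker, ← MonoidHom.comap_ker, QuotientGroup.ker_mk', QuotientGroup.ker_mk',
    ← hZ, ← hZ₁, Subgroup.comap_map_eq, Subgroup.comap_map_eq, sup_comm]

/-- An element of ker α is trivial in `G` and scalar in the matrix algebra, so it is central already
in Γ. -/
theorem FullLink.le_center (hL : FullLink α π M) : α.ker.map π ≤ Subgroup.center G₁ := by
  rintro _ ⟨x, hx, rfl⟩
  rw [Subgroup.mem_center_iff]
  intro g
  obtain ⟨y, rfl⟩ := hL.surj_right g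
  obtain ⟨c, hc⟩ := hL.scalar x hx
  rw [← map_mul, ← map_mul]
  congr 1
  refine hL.ext ?_ ?_
  · rw [map_mul, map_mul, MonoidHom.mem_ker.mp hx, one_mul, mul_one]
  · rw [map_mul, map_mul, hc, Matrix.smul_mul, Matrix.mul_smul, Matrix.one_mul, Matrix.mul_one]

theorem FullLink.smul_one_injective (hL : FullLink α π M) {c c' : k}
    (h : c • (1 : Matrix D D k) = c' • 1) : c = c' := by
  obtain ⟨d⟩ := hL.nonempty
  simpa using congrFun (congrFun h d) d

/-- Elements of ker α are determined by their scalars, and ker α embeds in G₁ because it meets ker π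
trivially. In the main theorem this yields cyclicity and the order of Z₁. -/
theorem FullLink.exists_units_equiv (hL : FullLink α π M) (kk : Subfield k)
    (h1 : ∀ x ∈ α.ker, ∃ c ∈ kk, M x = c • (1 : Matrix D D k))
    (h2 : ∀ c ∈ kk, c ≠ 0 → ∃ x ∈ α.ker, M x = c • (1 : Matrix D D k)) :
    ∃ e : kkˣ ≃* α.ker.map π, ∀ c : kkˣ, ∃ x ∈ α.ker, M x = ((c : kk) : k) • (1 : Matrix D D k) ∧
      (e c : G₁) = π x := by
  have h3 : ∀ c : kkˣ, ∃ x ∈ α.ker, M x = ((c : kk) : k) • (1 : Matrix D D k) := fun c =>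
    h2 _ c.1.2 (by simp)
  choose j hj hj' using h3
  have hmul : ∀ c c', j (c * c') = j c * j c' := fun c c' => hL.ext (by
    rw [map_mul, MonoidHom.mem_ker.mp (hj _), MonoidHom.mem_ker.mp (hj _),
      MonoidHom.mem_ker.mp (hj _), one_mul]) (by
    rw [map_mul, hj', hj', hj', Matrix.smul_mul, Matrix.one_mul, smul_smul]; rfl)
  let f : kkˣ →* α.ker.map π := MonoidHom.mk'
    (fun c => ⟨π (j c), Subgroup.mem_map_of_mem _ (hj c)⟩) fun c c' => Subtype.ext (by
      change π (j (c * c')) = π (j c) * π (j c')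
      rw [hmul, map_mul])
  have hf : Function.Bijective f := by
    refine ⟨fun c c' h => ?_, ?_⟩
    · have e1 : π (j c) = π (j c') := congrArg Subtype.val h
      have e2 : j c = j c' := by
        refine mul_inv_eq_one.mp (hL.disjoint _ ?_ (mul_mem (hj c) (inv_mem (hj c'))))
        rw [MonoidHom.mem_ker, map_mul, map_inv, e1, mul_inv_cancel]
      refine Units.ext (Subtype.ext (hL.smul_one_injective ?_))
      rw [← hj', ← hj', e2]
    · rintro ⟨_, x, hx, rfl⟩
      obtain ⟨c, hc, hcx⟩ := h1 x hx
      have hc0 : c ≠ 0 := fun h0 => by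
        rw [h0, zero_smul] at hcx
        have e1 : M x * M x⁻¹ = 1 := by rw [← map_mul, mul_inv_cancel, map_one]
        rw [hcx, Matrix.zero_mul] at e1
        obtain ⟨d⟩ := hL.nonempty
        have := congrFun (congrFun e1 d) d
        simp at this
      refine ⟨Units.mk0 ⟨c, hc⟩ fun h => hc0 (congrArg Subtype.val h), Subtype.ext ?_⟩
      change π (j _) = π x
      congr 1
      exact hL.ext (by rw [MonoidHom.mem_ker.mp (hj _), MonoidHom.mem_ker.mp hx])
        (by rw [hj', hcx]; rfl)
  exact ⟨MulEquiv.ofBijective f hf, fun c => ⟨j c, hj c, hj' c, rfl⟩⟩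

/-- The linear representation of the central subgroup inverse to the scalars in the link. -/
theorem FullLink.exists_linear (hL : FullLink α π M) (kk : Subfield k)
    (h1 : ∀ x ∈ α.ker, ∃ c ∈ kk, M x = c • (1 : Matrix D D k))
    (h2 : ∀ c ∈ kk, c ≠ 0 → ∃ x ∈ α.ker, M x = c • (1 : Matrix D D k)) :
    ∃ B : α.ker.map π →* Matrix (Fin 1) (Fin 1) k, Function.Injective B ∧
      ∀ x ∈ α.ker, ∀ c : k, M x = c • (1 : Matrix D D k) → ∀ z : α.ker.map π, (z : G₁) = π x →
        B z = c⁻¹ • (1 : Matrix (Fin 1) (Fin 1) k) := by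
  obtain ⟨e, he⟩ := hL.exists_units_equiv kk h1 h2
  let B : α.ker.map π →* Matrix (Fin 1) (Fin 1) k :=
    { toFun := fun z => (((e.symm z⁻¹ : kkˣ) : kk) : k) • 1
      map_one' := by simp
      map_mul' := fun z w => by
        rw [_root_.mul_inv_rev, map_mul, Units.val_mul, Subfield.coe_mul, Matrix.smul_mul,
          Matrix.one_mul, smul_smul, mul_comm] }
  have hB : ∀ z, B z = (((e.symm z⁻¹ : kkˣ) : kk) : k) • 1 := fun _ => rfl
  refine ⟨B, fun z w h => ?_, fun x hx c hc z hz => ?_⟩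
  · rw [hB, hB] at h
    have h3 := congrFun (congrFun h 0) 0
    simp only [Matrix.smul_apply, one_apply_eq, smul_eq_mul, mul_one] at h3
    exact inv_injective (e.symm.injective (Units.ext (Subtype.ext h3)))
  · rw [hB]
    congr 1
    obtain ⟨y, hy, hy', hey⟩ := he (e.symm z)
    rw [e.apply_symm_apply, hz] at hey
    have hxy : x = y := by
      refine mul_inv_eq_one.mp (hL.disjoint _ ?_ (mul_mem hx (inv_mem hy)))
      rw [MonoidHom.mem_ker, map_mul, map_inv, hey, mul_inv_cancel]
    rw [← hxy, hc] at hy'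
    rw [map_inv, hL.smul_one_injective hy']
    simp

end LinkAutomorphisms

/-! ### Constituents seen through the correspondence -/

section OverIntertwiner

open Matrix Kronecker

variable {k : Type*} [Field k] {Γ J J₁ : Type*} [Group Γ] [Group J] [Group J₁]
variable {D I L : Type*} [Fintype D] [DecidableEq D] [Fintype I] [DecidableEq I] [Fintype L]
  [DecidableEq L]
variable {α : Γ →* J} {π : Γ →* J₁} {M : Γ →* Matrix D D k}

/-- Fixing one basis vector of the space of `B` embeds k^D in the tensor product equivariantly for
ker π. Thus `A` restricted to Z contains the representation affording λ. -/
theorem Corr.exists_intertwiner [Nonempty D] [Nonempty L] {A : J →* Matrix I I k}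
    {B : J₁ →* Matrix L L k} (h : Corr α π M A B) :
    ∃ T : Matrix I D k, T ≠ 0 ∧ ∀ x ∈ π.ker, A (α x) * T = T * M x := by
  obtain ⟨P, Q, h1, -, h3⟩ := h
  obtain ⟨l⟩ := ‹Nonempty L›
  let E : Matrix (D × L) D k := of fun x b => if x.2 = l then (1 : Matrix D D k) x.1 b else 0
  have hE : ∀ X : Matrix D D k, (X ⊗ₖ (1 : Matrix L L k)) * E = E * X := fun X => by
    ext ⟨a, i⟩ b
    simp only [mul_apply, kronecker_apply, Fintype.sum_prod_type, E, of_apply, one_apply]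
    by_cases hi : i = l
    · simp [hi]
    · simp [hi]
  have hE0 : E ≠ 0 := fun h0 => by
    obtain ⟨a⟩ := ‹Nonempty D›
    have := congrFun (congrFun h0 (a, l)) a
    simp [E] at this
  refine ⟨P * E, fun h0 => hE0 ?_, fun x hx => ?_⟩
  · calc E = Q * (P * E) := by rw [← Matrix.mul_assoc, h1, Matrix.one_mul]
      _ = 0 := by rw [h0, Matrix.mul_zero]
  · have h4 := h3 x
    rw [matKron_apply, MonoidHom.comp_apply, MonoidHom.comp_apply, MonoidHom.mem_ker.mp hx,
      map_one] at h4
    rw [← Matrix.mul_assoc, ← h4, Matrix.mul_assoc, hE, Matrix.mul_assoc]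

/-- The tensor product descends to `J`, so on ker α the scalar of `B` must cancel that of `M`. This
is the source of the inverse in λ₁. -/
theorem Corr.eq_inv_smul_one [Nonempty D] {A : J →* Matrix I I k}
    {B : J₁ →* Matrix L L k} (h : Corr α π M A B) {x : Γ} (hx : x ∈ α.ker) {c : k} (hc0 : c ≠ 0)
    (hc : M x = c • (1 : Matrix D D k)) : B (π x) = c⁻¹ • (1 : Matrix L L k) := by
  have h1 := h.kron_eq_one hx
  rw [hc, smul_kronecker, ← kronecker_smul, ← one_kronecker_one (m := D)] at h1
  have h2 := one_kronecker_injective h1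
  rw [← h2, smul_smul, inv_mul_cancel₀ hc0, one_smul]

theorem ne_zero_of_eq_smul_one [Nonempty D] {x : Γ} {c : k} (hc : M x = c • (1 : Matrix D D k)) :
    c ≠ 0 := by
  rintro rfl
  rw [zero_smul] at hc
  have e1 : M x * M x⁻¹ = 1 := by rw [← map_mul, mul_inv_cancel, map_one]
  rw [hc, Matrix.zero_mul] at e1
  exact zero_ne_one e1

end OverIntertwiner

/-! ### Restriction of a link to preimages of subgroups -/

section RestrictedLink

open Matrix Kronecker

variable {k : Type*} [Field k] {Γ G G₁ : Type*} [Group Γ] [Group G] [Group G₁]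
variable {D : Type*} [Fintype D] [DecidableEq D]

/-- The restriction of the first map of a link to the preimage of a subgroup. -/
def linkL (α : Γ →* G) (J : Subgroup G) : J.comap α →* J :=
  (α.comp (J.comap α).subtype).codRestrict J fun x => x.2

/-- The restriction of the second map of a link to the preimage of a subgroup. -/
def linkR {α : Γ →* G} {π : Γ →* G₁} {J : Subgroup G} {J₁ : Subgroup G₁}
    (h : ∀ x, π x ∈ J₁ ↔ α x ∈ J) : J.comap α →* J₁ :=
  (π.comp (J.comap α).subtype).codRestrict J₁ fun x => (h x).mpr x.2

variable {α : Γ →* G} {π : Γ →* G₁} {M : Γ →* Matrix D D k} {J : Subgroup G} {J₁ : Subgroup G₁}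

theorem coe_linkL (x : J.comap α) : (linkL α J x : G) = α x := rfl

theorem coe_linkR (h : ∀ x, π x ∈ J₁ ↔ α x ∈ J) (x : J.comap α) : (linkR h x : G₁) = π x := rfl

theorem mem_ker_linkL {x : J.comap α} : x ∈ (linkL α J).ker ↔ (x : Γ) ∈ α.ker := by
  rw [MonoidHom.mem_ker, MonoidHom.mem_ker, ← OneMemClass.coe_eq_one, coe_linkL]

theorem mem_ker_linkR {h : ∀ x, π x ∈ J₁ ↔ α x ∈ J} {x : J.comap α} :
    x ∈ (linkR h).ker ↔ (x : Γ) ∈ π.ker := by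
  rw [MonoidHom.mem_ker, MonoidHom.mem_ker, ← OneMemClass.coe_eq_one, coe_linkR]

/-- The preimage of `J` contains all of ker π, so the spanning property survives restriction. -/
theorem TripleLink.restrict (hL : TripleLink α π M) (h : ∀ x, π x ∈ J₁ ↔ α x ∈ J) :
    TripleLink (linkL α J) (linkR h) (M.comp (J.comap α).subtype) where
  surj_left := fun ⟨g, hg⟩ => by
    obtain ⟨x, rfl⟩ := hL.surj_left g
    exact ⟨⟨x, hg⟩, rfl⟩
  surj_right := fun ⟨g, hg⟩ => by
    obtain ⟨x, rfl⟩ := hL.surj_right g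
    exact ⟨⟨x, (h x).mp hg⟩, rfl⟩
  span_eq_top := by
    rw [eq_top_iff, ← hL.span_eq_top]
    refine Submodule.span_mono ?_
    rintro _ ⟨x, rfl⟩
    have hx : (x : Γ) ∈ J.comap α := (h x).mp (by
      rw [MonoidHom.mem_ker.mp x.2]; exact one_mem _)
    exact ⟨⟨⟨x, hx⟩, mem_ker_linkR.mpr x.2⟩, rfl⟩
  scalar := fun x hx => hL.scalar x (mem_ker_linkL.mp hx)
  nonempty := hL.nonempty

end RestrictedLink

/-! ### The correspondence of irreducible Brauer characters -/

section BrauerCorrespondence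

open Matrix Kronecker

variable {p : ℕ} [Fact p.Prime]
variable {K : Type*} [Field K] [Algebra ℚ_[p] K] [Algebra.IsAlgebraic ℚ_[p] K]

/-- The representation of the normal subgroup may be fixed once and for all, since irreducible
representations with equal Brauer characters are equivalent. -/
theorem mem_IBrOver_iff [FiniteDimensional ℚ_[p] K] {G : Type*} [Group G] {J N : Subgroup G}
    (hN : EnoughRoots K N) {e : ℕ} {S : N →* Matrix (Fin e) (Fin e) (ResF p K)} (hS : MatIrr S)
    {χ : PReg p J → K} :
    χ ∈ IBrOver p K J N (matBr S) ↔ ∃ (d : ℕ) (A : J →* Matrix (Fin d) (Fin d) (ResF p K)),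
      MatIrr A ∧ matBr A = χ ∧ ∃ T : Matrix (Fin d) (Fin e) (ResF p K), T ≠ 0 ∧
        ∀ (x : J) (y : N), (x : G) = y → A x * T = T * S y := by
  constructor
  · rintro ⟨d, ρ, e', τ, T, hρ, rfl, hτ, hτS, hT0, hT⟩
    rw [brauerChar_eq_matBr] at hτS
    obtain ⟨P, Q, h1, h2, h3⟩ := hS.eqv_of_matBr_eq hN (matIrr_toMat.mpr hτ) hτS.symm
    refine ⟨d, toMat ρ, matIrr_toMat.mpr hρ, (brauerChar_eq_matBr ρ).symm,
      LinearMap.toMatrix' T * P, fun h0 => hT0 ?_, fun x y hxy => ?_⟩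
    · have h4 : LinearMap.toMatrix' T = 0 := by
        calc LinearMap.toMatrix' T = LinearMap.toMatrix' T * P * Q := by
              rw [Matrix.mul_assoc, h2, Matrix.mul_one]
          _ = 0 := by rw [h0, Matrix.zero_mul]
      exact (LinearEquiv.map_eq_zero_iff _).mp h4
    · rw [Matrix.mul_assoc, h3, ← Matrix.mul_assoc, ← Matrix.mul_assoc, toMat_apply, toMat_apply,
        ← LinearMap.toMatrix'_comp, ← LinearMap.toMatrix'_comp, hT x y hxy]
  · rintro ⟨d, A, hA, rfl, T, hT0, hT⟩
    refine ⟨d, toRep A, e, toRep S, toLin' T, irreducible_toRep_iff.mpr hA, ?_,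
      irreducible_toRep_iff.mpr hS, ?_, fun h0 => hT0 ?_, fun x y hxy => ?_⟩
    · rw [brauerChar_eq_matBr, toMat_toRep]
    · rw [brauerChar_eq_matBr, toMat_toRep]
    · exact (LinearEquiv.map_eq_zero_iff _).mp h0
    · rw [toRep_apply, toRep_apply, ← toLin'_mul, ← toLin'_mul, hT x y hxy]

theorem isVertex_iff [FiniteDimensional ℚ_[p] K] {G : Type*} [Group G] [Finite G]
    (hG : EnoughRoots K G) {I : Type*} [Fintype I] [DecidableEq I]
    {A : G →* Matrix I I (ResF p K)} (hA : MatIrr A) {Y : Subgroup G} :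
    IsVertex p K (matBr A) Y ↔ Minimal (Higman A) Y := by
  have key : ∀ {d : ℕ} {B : G →* Matrix (Fin d) (Fin d) (ResF p K)}, MatEqv A B →
      Higman B = Higman A := fun h => by
    funext H
    exact propext ⟨HigmanOn.eqv h.symm, HigmanOn.eqv h⟩
  constructor
  · rintro ⟨d, ρ, hρ, hρA, hY⟩
    rw [brauerChar_eq_matBr] at hρA
    rw [← key (hA.eqv_of_matBr_eq hG (matIrr_toMat.mpr hρ) hρA.symm)]
    have h1 : IsRelProjective ρ = Higman (toMat ρ) := funext fun H => propext isRelProjective_iff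
    rwa [h1] at hY
  · intro hY
    obtain ⟨d, B, hB⟩ := exists_fin_matEqv A
    refine ⟨d, toRep B, irreducible_toRep_iff.mpr (hB.irr hA), ?_, ?_⟩
    · rw [brauerChar_eq_matBr, toMat_toRep, hB.matBr_eq]
    · have h1 : IsRelProjective (toRep B) = Higman B := funext fun H => propext (by
        rw [isRelProjective_iff, toMat_toRep])
      rwa [h1, key hB]

variable {Γ G G₁ : Type*} [Group Γ] [Group G] [Group G₁]
variable {α : Γ →* G} {π : Γ →* G₁} {e : ℕ} {M : Γ →* Matrix (Fin e) (Fin e) (ResF p K)}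
  {J : Subgroup G} {J₁ : Subgroup G₁}

/-- The correspondence of irreducible Brauer characters defined by a link. -/
def BrCorr (M : Γ →* Matrix (Fin e) (Fin e) (ResF p K)) (h : ∀ x, π x ∈ J₁ ↔ α x ∈ J)
    (χ : PReg p J → K) (χ₁ : PReg p J₁ → K) : Prop :=
  ∃ (d d₁ : ℕ) (A : J →* Matrix (Fin d) (Fin d) (ResF p K))
    (B : J₁ →* Matrix (Fin d₁) (Fin d₁) (ResF p K)), MatIrr A ∧ MatIrr B ∧
      Corr (linkL α J) (linkR h) (M.comp (J.comap α).subtype) A B ∧ matBr A = χ ∧ matBr B = χ₁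

variable {h : ∀ x, π x ∈ J₁ ↔ α x ∈ J} {χ χ' : PReg p J → K} {χ₁ χ₁' : PReg p J₁ → K}

theorem BrCorr.unique_right [FiniteDimensional ℚ_[p] K] (hL : TripleLink α π M)
    (hJ : EnoughRoots K J) (h1 : BrCorr M h χ χ₁) (h2 : BrCorr M h χ χ₁') : χ₁ = χ₁' := by
  obtain ⟨d, d₁, A, B, hA, hB, hAB, rfl, rfl⟩ := h1
  obtain ⟨d', d₁', A', B', hA', hB', hAB', hχ, rfl⟩ := h2
  exact ((hL.restrict h).eqv_right hAB hAB' (hA.eqv_of_matBr_eq hJ hA' hχ.symm)).matBr_eq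

theorem BrCorr.unique_left [FiniteDimensional ℚ_[p] K] (hL : TripleLink α π M)
    (hJ₁ : EnoughRoots K J₁) (h1 : BrCorr M h χ χ₁) (h2 : BrCorr M h χ' χ₁) : χ = χ' := by
  obtain ⟨d, d₁, A, B, hA, hB, hAB, rfl, rfl⟩ := h1
  obtain ⟨d', d₁', A', B', hA', hB', hAB', rfl, hχ⟩ := h2
  exact ((hL.restrict h).eqv_left hAB hAB' (hB.eqv_of_matBr_eq hJ₁ hB' hχ.symm)).matBr_eq

/-- The subgroup on the right is determined by the one on the left, but only propositionally. This
form of uniqueness compares characters on two descriptions of the same subgroup, as needed for the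
action of Φ. -/
theorem BrCorr.agree [FiniteDimensional ℚ_[p] K] (hL : TripleLink α π M)
    (hJ : EnoughRoots K J) {J₁' : Subgroup G₁} {h' : ∀ x, π x ∈ J₁' ↔ α x ∈ J}
    {χ₁' : PReg p J₁' → K} (h1 : BrCorr M h χ χ₁) (h2 : BrCorr M h' χ χ₁') : Agree χ₁ χ₁' := by
  have hJJ : J₁ = J₁' := by
    ext y
    obtain ⟨x, rfl⟩ := hL.surj_right y
    rw [h, h']
  subst hJJ
  refine ⟨rfl, fun x y hxy => ?_⟩
  rw [h1.unique_right hL hJ h2]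
  exact congrArg _ (Subtype.ext (Subtype.ext hxy))

section Over

variable {Z : Subgroup G} {S : Z →* Matrix (Fin e) (Fin e) (ResF p K)}

theorem BrCorr.exists_right [FiniteDimensional ℚ_[p] K] (hL : TripleLink α π M)
    (hZ : EnoughRoots K Z) (hS : MatIrr S)
    (hSM : ∀ x ∈ π.ker, ∃ z : Z, α x = z ∧ M x = S z)
    (hχ : χ ∈ IBrOver p K J Z (matBr S)) : ∃ χ₁, BrCorr M h χ χ₁ := by
  obtain ⟨d, A, hA, rfl, T, hT0, hT⟩ := (mem_IBrOver_iff hZ hS).mp hχ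
  obtain ⟨d₁, B, hB⟩ := (hL.restrict h).exists_right hA hT0 fun x hx => by
    obtain ⟨z, hz, hz'⟩ := hSM x (mem_ker_linkR.mp hx)
    rw [MonoidHom.comp_apply, Subgroup.coe_subtype, hz']
    exact hT _ _ hz
  exact ⟨matBr B, d, d₁, A, B, hA, ((hL.restrict h).irr_iff hB).mp hA, hB, rfl, rfl⟩

theorem BrCorr.mem_left [FiniteDimensional ℚ_[p] K] (hL : TripleLink α π M)
    (hZ : EnoughRoots K Z) (hS : MatIrr S)
    (hSM : ∀ x ∈ π.ker, ∃ z : Z, α x = z ∧ M x = S z) (hZ' : ∀ z : Z, ∃ x ∈ π.ker, α x = z)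
    (h1 : BrCorr M h χ χ₁) : χ ∈ IBrOver p K J Z (matBr S) := by
  obtain ⟨d, d₁, A, B, hA, hB, hAB, rfl, rfl⟩ := h1
  have := hL.nonempty
  have := hB.1
  obtain ⟨T, hT0, hT⟩ := hAB.exists_intertwiner
  refine (mem_IBrOver_iff hZ hS).mpr ⟨d, A, hA, rfl, T, hT0, fun x y hxy => ?_⟩
  obtain ⟨w, hw, hwy⟩ := hZ' y
  obtain ⟨z, hz, hz'⟩ := hSM w hw
  have hzy : z = y := Subtype.ext (hz.symm.trans hwy)
  have hwJ : w ∈ J.comap α := by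
    rw [Subgroup.mem_comap, hwy, ← hxy]; exact x.2
  have h2 := hT ⟨w, hwJ⟩ (mem_ker_linkR.mpr hw)
  have h3 : linkL α J ⟨w, hwJ⟩ = x := Subtype.ext (hwy.trans hxy.symm)
  rw [h3, MonoidHom.comp_apply, Subgroup.coe_subtype, hz', hzy] at h2
  exact h2

end Over

section OverCentral

variable {S₁ : α.ker.map π →* Matrix (Fin 1) (Fin 1) (ResF p K)}

/-- On Z₁ both `B` and `S₁` are given by the same scalar, so any nonzero matrix is an intertwiner.
-/
theorem BrCorr.mem_right [FiniteDimensional ℚ_[p] K] (hL : TripleLink α π M)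
    (hZ₁ : EnoughRoots K (α.ker.map π)) (hS : MatIrr S₁)
    (hSM : ∀ x ∈ α.ker, ∀ c : ResF p K, M x = c • (1 : Matrix (Fin e) (Fin e) (ResF p K)) →
      ∀ z : α.ker.map π, (z : G₁) = π x → S₁ z = c⁻¹ • (1 : Matrix (Fin 1) (Fin 1) (ResF p K)))
    (h1 : BrCorr M h χ χ₁) : χ₁ ∈ IBrOver p K J₁ (α.ker.map π) (matBr S₁) := by
  obtain ⟨d, d₁, A, B, hA, hB, hAB, rfl, rfl⟩ := h1
  have := hL.nonempty
  obtain ⟨i⟩ := hB.1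
  refine (mem_IBrOver_iff hZ₁ hS).mpr ⟨d₁, B, hB, rfl, single i 0 1, fun h0 => ?_, fun y z hyz => ?_⟩
  · have := congrFun (congrFun h0 i) 0
    simp at this
  obtain ⟨x, hx, hxz⟩ := z.2
  obtain ⟨c, hc⟩ := hL.scalar x hx
  have hxJ : x ∈ J.comap α := by
    rw [Subgroup.mem_comap, MonoidHom.mem_ker.mp hx]; exact one_mem J
  have h2 : linkR h ⟨x, hxJ⟩ = y := Subtype.ext (hxz.trans hyz.symm)
  have h3 := hAB.eq_inv_smul_one (x := ⟨x, hxJ⟩) (mem_ker_linkL.mpr hx)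
    (ne_zero_of_eq_smul_one hc) hc
  rw [h2] at h3
  rw [h3, hSM x hx c hc z hxz.symm, Matrix.smul_mul, Matrix.mul_smul, Matrix.one_mul,
    Matrix.mul_one]

/-- Centrality and Schur's lemma make `B` scalar on Z₁, and lying over λ₁ identifies the scalar as
the inverse of the one in `M`. The tensor product is then trivial on ker α and descends to `J`. -/
theorem BrCorr.exists_left [FiniteDimensional ℚ_[p] K] (hL : TripleLink α π M)
    (hcent : α.ker.map π ≤ Subgroup.center G₁) (hJ₁ : EnoughRoots K J₁)
    (hZ₁ : EnoughRoots K (α.ker.map π)) (hS : MatIrr S₁)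
    (hSM : ∀ x ∈ α.ker, ∀ c : ResF p K, M x = c • (1 : Matrix (Fin e) (Fin e) (ResF p K)) →
      ∀ z : α.ker.map π, (z : G₁) = π x → S₁ z = c⁻¹ • (1 : Matrix (Fin 1) (Fin 1) (ResF p K)))
    (hχ : χ₁ ∈ IBrOver p K J₁ (α.ker.map π) (matBr S₁)) : ∃ χ, BrCorr M h χ χ₁ := by
  obtain ⟨d₁, B, hB, rfl, T, hT0, hT⟩ := (mem_IBrOver_iff hZ₁ hS).mp hχ
  have := hL.nonempty
  obtain ⟨A', hA'⟩ := (hL.restrict h).exists_left (B := B) fun x hx => by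
    have hx' := mem_ker_linkL.mp hx
    obtain ⟨c, hc⟩ := hL.scalar x hx'
    have hz : π x ∈ α.ker.map π := Subgroup.mem_map_of_mem _ hx'
    obtain ⟨b, hb⟩ := hB.schur_resF hJ₁ (B (linkR h x)) fun g => by
      rw [← map_mul, ← map_mul]
      congr 1
      exact Subtype.ext ((Subgroup.mem_center_iff.mp (hcent hz) g).symm)
    have h2 := hT (linkR h x) ⟨π x, hz⟩ rfl
    rw [hb, hSM x hx' c hc _ rfl, Matrix.smul_mul, Matrix.mul_smul, Matrix.one_mul,
      Matrix.mul_one] at h2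
    have h3 : b = c⁻¹ := smul_left_injective _ hT0 h2
    rw [hb, h3, MonoidHom.comp_apply, Subgroup.coe_subtype, hc, smul_kronecker, kronecker_smul,
      smul_smul, mul_inv_cancel₀ (ne_zero_of_eq_smul_one hc), one_smul, one_kronecker_one]
  obtain ⟨d, A, hA⟩ := exists_fin_matEqv A'
  have hAB : Corr (linkL α J) (linkR h) (M.comp (J.comap α).subtype) A B :=
    MatEqv.trans hA' ((MatEqv.comp_iff (hL.restrict h).surj_left).mpr hA)
  exact ⟨matBr A, d, d₁, A, B, ((hL.restrict h).irr_iff hAB).mpr hB, hB, hAB, rfl, rfl⟩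

end OverCentral

/-- Applying σ to matrices and θ to Γ turns the tensor factor `M` into an equivalent one, so the
defining equivalence is carried to an equivalence for the twisted characters. -/
theorem BrCorr.twist (hJ : EnoughRoots K J) (hJ₁ : EnoughRoots K J₁)
    (h1 : BrCorr M h χ χ₁) (a : (K ≃ₐ[ℚ_[p]] K) × MulAut G) (a₁ : (K ≃ₐ[ℚ_[p]] K) × MulAut G₁)
    (ha : a₁.1 = a.1) {θ : MulAut Γ} (hθ : LinkCompat α π M (galRes a.1) a.2 θ)
    (hψ : ∀ x, a₁.2 (π x) = π (θ x)) (h' : ∀ x, π x ∈ conjSub a₁ J₁ ↔ α x ∈ conjSub a J) :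
    BrCorr M h' (ModRep.twist a J χ) (ModRep.twist a₁ J₁ χ₁) := by
  obtain ⟨d, d₁, A, B, hA, hB, hAB, rfl, rfl⟩ := h1
  obtain ⟨hα, -, T, T', e1, e2, e3⟩ := hθ
  have hsurj : Function.Surjective (a.2.subgroupMap J).symm.toMonoidHom := MulEquiv.surjective _
  have hsurj₁ : Function.Surjective (a₁.2.subgroupMap J₁).symm.toMonoidHom := MulEquiv.surjective _
  have hmem : ∀ x, x ∈ J.comap α → θ x ∈ (conjSub a J).comap α := fun x hx => by
    rw [Subgroup.mem_comap, hα]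
    exact Subgroup.mem_map_of_mem _ hx
  refine ⟨d, d₁, (matTwist (galRes a.1) A).comp (a.2.subgroupMap J).symm.toMonoidHom,
    (matTwist (galRes a.1) B).comp (a₁.2.subgroupMap J₁).symm.toMonoidHom,
    (MatIrr.comp_iff hsurj).mpr (hA.twist _), (MatIrr.comp_iff hsurj₁).mpr (hB.twist _),
    hAB.twist (galRes a.1) (fun x => ⟨θ x, hmem x x.2⟩) ?_ T T' e1 e2 (fun x => e3 x)
      (fun x => ?_) (fun x => ?_), ?_, ?_⟩
  · rintro ⟨y, hy⟩
    obtain ⟨x, rfl⟩ := θ.surjective y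
    refine ⟨⟨x, ?_⟩, rfl⟩
    rw [Subgroup.mem_comap, hα] at hy
    obtain ⟨g, hg, hgx⟩ := hy
    rw [Subgroup.mem_comap, ← a.2.injective hgx]
    exact hg
  · have e4 : linkL α (conjSub a J) ⟨θ x, hmem x x.2⟩ = a.2.subgroupMap J (linkL α J x) :=
      Subtype.ext (hα x)
    rw [e4]
    change matTwist (galRes a.1) A ((a.2.subgroupMap J).symm (a.2.subgroupMap J (linkL α J x))) = _
    rw [MulEquiv.symm_apply_apply, matTwist_apply]
  · have e4 : linkR h' ⟨θ x, hmem x x.2⟩ = a₁.2.subgroupMap J₁ (linkR h x) :=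
      Subtype.ext (hψ x).symm
    rw [e4]
    change matTwist (galRes a.1) B ((a₁.2.subgroupMap J₁).symm (a₁.2.subgroupMap J₁ (linkR h x)))
      = _
    rw [MulEquiv.symm_apply_apply, matTwist_apply]
  · funext x
    exact hJ.matBr_twist A a.1 (x.map (a.2.subgroupMap J).symm.toMonoidHom)
  · funext x
    rw [ModRep.twist, ha]
    exact hJ₁.matBr_twist B a.1 (x.map (a₁.2.subgroupMap J₁).symm.toMonoidHom)

/-- Induction along the composition factors of the restrictions of corresponding characters. -/
theorem BrCorr.res_induction (hL : TripleLink α π M) (h1 : BrCorr M h χ χ₁) {H : Subgroup G}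
    {H₁ : Subgroup G₁} (hH : ∀ x, π x ∈ H₁ ↔ α x ∈ H) (hle : H ≤ J) (hle₁ : H₁ ≤ J₁)
    {motive : (PReg p H → K) → (PReg p H₁ → K) → Prop} (zero : motive 0 0)
    (add : ∀ f g f' g', motive f g → motive f' g' → motive (f + f') (g + g'))
    (irr : ∀ f g, BrCorr M hH f g → motive f g) : motive (res hle χ) (res hle₁ χ₁) := by
  obtain ⟨d, d₁, A, B, hA, hB, ⟨P, Q, e1, e2, e3⟩, rfl, rfl⟩ := h1
  refine (hL.restrict hH).matBr_induction zero add
    (fun d e A B hA hB hAB => irr _ _ ⟨d, e, A, B, hA, hB, hAB, rfl, rfl⟩) d₁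
    (A.comp (Subgroup.inclusion hle)) (B.comp (Subgroup.inclusion hle₁)) (Fintype.card_fin d₁)
    ⟨P, Q, e1, e2, fun x => e3 ⟨x, hle x.2⟩⟩

theorem BrCorr.exists_vertex [FiniteDimensional ℚ_[p] K] [Finite Γ] (hL : TripleLink α π M)
    (hJ : EnoughRoots K J) (hJ₁ : EnoughRoots K J₁) (h1 : BrCorr M h χ χ₁) {Y : Subgroup J}
    (hY : IsVertex p K χ Y) : ∃ Y₁ : Subgroup J₁, IsVertex p K χ₁ Y₁ ∧
      Y.comap (linkL α J) ⊔ (linkR h).ker = Y₁.comap (linkR h) ⊔ (linkL α J).ker := by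
  obtain ⟨d, d₁, A, B, hA, hB, hAB, rfl, rfl⟩ := h1
  have := Finite.of_surjective _ (hL.restrict h).surj_left
  have := Finite.of_surjective _ (hL.restrict h).surj_right
  have := hA.1
  obtain ⟨Y₁, hY₁, hYY⟩ := (hL.restrict h).exists_vertex hAB (hA.schur_resF hJ)
    ((isVertex_iff hJ hA).mp hY)
  exact ⟨Y₁, (isVertex_iff hJ₁ hB).mpr hY₁, hYY⟩

end BrauerCorrespondence

/-! ### Invariance, value fields and quotient groups -/

section Assembly

open Matrix

theorem matIrr_fin_one {k : Type*} [Field k] {G : Type*} [Group G]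
    (A : G →* Matrix (Fin 1) (Fin 1) k) : MatIrr A := by
  have h : Module.finrank k (Fin 1 → k) = 1 := by simp
  have := isSimpleModule_iff_finrank_eq_one.mpr h
  exact ⟨inferInstance, fun U _ => eq_bot_or_eq_top U⟩

theorem exists_linearMap_span {V W : Type*} [AddCommGroup V] [AddCommGroup W] {X : Set V}
    (hX : LinearIndependent ℤ (fun x : X => (x : V))) (f : V → W) :
    ∃ L : Submodule.span ℤ X →ₗ[ℤ] W, ∀ (x : V) (hx : x ∈ X),
      L ⟨x, Submodule.subset_span hx⟩ = f x := by
  have e : Submodule.span ℤ X = Submodule.span ℤ (Set.range fun x : X => (x : V)) := by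
    rw [Subtype.range_coe]
  refine ⟨(Finsupp.linearCombination ℤ fun x : X => f x) ∘ₗ hX.repr ∘ₗ
    (LinearEquiv.ofEq _ _ e).toLinearMap, fun x hx => ?_⟩
  have h1 : hX.repr (LinearEquiv.ofEq _ _ e ⟨x, Submodule.subset_span hx⟩)
      = Finsupp.single ⟨x, hx⟩ 1 := hX.repr_eq_single ⟨x, hx⟩ _ rfl
  change Finsupp.linearCombination ℤ _ (hX.repr (LinearEquiv.ofEq _ _ e _)) = _
  rw [h1, Finsupp.linearCombination_single, one_smul]

variable {p : ℕ} [Fact p.Prime]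
variable {K : Type*} [Field K] [Algebra ℚ_[p] K]

/-- The restriction of an automorphism to an invariant subgroup. -/
def autRestrict {G : Type*} [Group G] (φ : MulAut G) {Z : Subgroup G}
    (h : Z.map φ.toMonoidHom = Z) : Z →* Z :=
  (φ.toMonoidHom.comp Z.subtype).codRestrict Z fun z =>
    h.le (Subgroup.mem_map_of_mem _ z.2)

theorem autRestrict_surjective {G : Type*} [Group G] (φ : MulAut G) {Z : Subgroup G}
    (h : Z.map φ.toMonoidHom = Z) : Function.Surjective (autRestrict φ h) := by
  rintro ⟨z, hz⟩
  have hz' := hz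
  rw [← h] at hz'
  obtain ⟨w, hw, hwz⟩ := hz'
  exact ⟨⟨w, hw⟩, Subtype.ext hwz⟩

theorem FixedBy.apply {G : Type*} [Group G] {a : (K ≃ₐ[ℚ_[p]] K) × MulAut G} {Z : Subgroup G}
    {θ : PReg p Z → K} (hθ : FixedBy a θ) (h : Z.map a.2.toMonoidHom = Z) (g : PReg p Z) :
    θ (g.map (autRestrict a.2 h)) = a.1 (θ g) := by
  have h1 := hθ.2 (g.map (a.2.subgroupMap Z).toMonoidHom) (g.map (autRestrict a.2 h)) rfl
  rw [← h1, ModRep.twist]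
  congr 2
  exact Subtype.ext ((a.2.subgroupMap Z).symm_apply_apply g.1)

theorem mem_conjSub_iff {G : Type*} [Group G] {a : (K ≃ₐ[ℚ_[p]] K) × MulAut G} {J : Subgroup G}
    {g : G} : a.2 g ∈ conjSub a J ↔ g ∈ J :=
  ⟨fun ⟨_, hw, hwg⟩ => a.2.injective hwg ▸ hw, fun h => Subgroup.mem_map_of_mem _ h⟩

variable [Algebra.IsAlgebraic ℚ_[p] K]

/-- The Galois automorphism permutes the values of an invariant character and commutes with
reduction, so it preserves the generators of the value field. -/
theorem galRes_mem_valueField {G : Type*} [Group G] {θ : PReg p G → K} {σ : K ≃ₐ[ℚ_[p]] K}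
    {f : PReg p G → PReg p G} (hf : ∀ g, θ (f g) = σ (θ g)) {c : ResF p K}
    (hc : c ∈ valueField p K θ) : galRes σ c ∈ valueField p K θ := by
  have h : valueField p K θ
      ≤ (valueField p K θ).comap ((galRes σ : RingAut (ResF p K)) : ResF p K →+* ResF p K) := by
    refine Subfield.closure_le.mpr ?_
    rintro _ ⟨g, x, hx, rfl⟩
    exact Subfield.subset_closure ⟨f g, galIntegers σ x, by rw [coe_galIntegers, hx, hf], rfl⟩
  exact h hc

/-- Every trace is the trace of a p-regular element, hence the reduction of a Brauer character
value. -/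
theorem trace_mem_valueField [FiniteDimensional ℚ_[p] K] {G : Type*} [Group G]
    (hG : EnoughRoots K G) {d : ℕ} (A : G →* Matrix (Fin d) (Fin d) (ResF p K)) (g : G) :
    (A g).trace ∈ valueField p K (matBr A) := by
  obtain ⟨j, x, -, hx⟩ := exists_pReg_trace_eq (p := p) hG g
  obtain ⟨c, hc, hc'⟩ := hG.exists_residue_matBr A x
  rw [← hx A, ← hc']
  exact Subfield.subset_closure ⟨x, c, hc, rfl⟩

/-- Invariance says that the Galois twist of `S` and the composite of `S` with the group
automorphism have equal Brauer characters; such irreducible representations are equivalent. -/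
theorem exists_intertwiner_of_fixedBy [FiniteDimensional ℚ_[p] K] {G : Type*} [Group G]
    {Z : Subgroup G} (hZ : EnoughRoots K Z) {d : ℕ} {S : Z →* Matrix (Fin d) (Fin d) (ResF p K)}
    (hS : MatIrr S) {a : (K ≃ₐ[ℚ_[p]] K) × MulAut G} (hθ : FixedBy a (matBr S))
    (h : Z.map a.2.toMonoidHom = Z) :
    ∃ T T' : Matrix (Fin d) (Fin d) (ResF p K), T' * T = 1 ∧ T * T' = 1 ∧
      ∀ z, T * (S z).map (galRes a.1) = S (autRestrict a.2 h z) * T := by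
  refine (hS.twist (galRes a.1)).eqv_of_matBr_eq hZ
    ((MatIrr.comp_iff (autRestrict_surjective a.2 h)).mpr hS) ?_
  funext g
  rw [hZ.matBr_twist, ← hθ.apply h]
  rfl

variable {G Γ G₁ : Type*} [Group G] [Group Γ] [Group G₁] {α : Γ →* G} {π : Γ →* G₁}

theorem LinkCompat.map_smul_one {k : Type*} [Field k] {D : Type*} [Fintype D] [DecidableEq D]
    {M : Γ →* Matrix D D k} {s : RingAut k} {φ : MulAut G} {θ : MulAut Γ}
    (h : LinkCompat α π M s φ θ) {x : Γ} {c : k} (hc : M x = c • (1 : Matrix D D k)) :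
    M (θ x) = s c • (1 : Matrix D D k) := by
  obtain ⟨-, -, T, T', h1, h2, h3⟩ := h
  have h4 : (c • (1 : Matrix D D k)).map s = s c • 1 := by
    ext i j
    simp [one_apply, apply_ite s]
  calc M (θ x) = M (θ x) * T * T' := by rw [Matrix.mul_assoc, h2, Matrix.mul_one]
    _ = s c • 1 := by
      rw [← h3, hc, h4, Matrix.mul_smul, Matrix.mul_one, Matrix.smul_mul, h2]

section Quotients

variable {G Γ G₁ : Type u} [Group G] [Group Γ] [Group G₁] {α : Γ →* G} {π : Γ →* G₁}
  {Z : Subgroup G} [Z.Normal] {Z₁ : Subgroup G₁} [Z₁.Normal] {ε : G ⧸ Z ≃* G₁ ⧸ Z₁}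

theorem mem_corr_iff (hε : ∀ x, ε (QuotientGroup.mk (α x)) = QuotientGroup.mk (π x))
    {J : Subgroup G} (hJ : Z ≤ J) (x : Γ) : π x ∈ corr ε J ↔ α x ∈ J := by
  rw [corr, Subgroup.mem_comap, QuotientGroup.mk'_apply, ← hε]
  constructor
  · rintro ⟨y, ⟨g, hg, rfl⟩, hgx⟩
    have h1 := QuotientGroup.eq.mp (ε.injective hgx)
    have h2 := mul_mem hg (hJ h1)
    rwa [mul_inv_cancel_left] at h2
  · exact fun h => ⟨_, ⟨_, h, rfl⟩, rfl⟩

/-- Both images are the image of one subgroup of the preimage of `J` under the common map to G₁/Z₁,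
which kills the two kernels. -/
theorem imageMod_eq (hε : ∀ x, ε (QuotientGroup.mk (α x)) = QuotientGroup.mk (π x))
    (hα : Function.Surjective α) (hπ : Function.Surjective π)
    {J : Subgroup G} {J₁ : Subgroup G₁} (h : ∀ x, π x ∈ J₁ ↔ α x ∈ J) {Y : Subgroup J}
    {Y₁ : Subgroup J₁}
    (hY : Y.comap (linkL α J) ⊔ (linkR h).ker = Y₁.comap (linkR h) ⊔ (linkL α J).ker) :
    imageMod Z₁ Y₁ = (imageMod Z Y).map ε.toMonoidHom := by
  have hsL : Function.Surjective (linkL α J) := fun ⟨g, hg⟩ => by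
    obtain ⟨x, rfl⟩ := hα g
    exact ⟨⟨x, hg⟩, rfl⟩
  have hsR : Function.Surjective (linkR h) := fun ⟨g, hg⟩ => by
    obtain ⟨x, rfl⟩ := hπ g
    exact ⟨⟨x, (h x).mp hg⟩, rfl⟩
  let fL : J →* G₁ ⧸ Z₁ := ε.toMonoidHom.comp ((QuotientGroup.mk' Z).comp J.subtype)
  let fR : J₁ →* G₁ ⧸ Z₁ := (QuotientGroup.mk' Z₁).comp J₁.subtype
  have hf : fL.comp (linkL α J) = fR.comp (linkR h) := MonoidHom.ext fun x => hε x
  have e1 : (Y.comap (linkL α J) ⊔ (linkR h).ker).map (fL.comp (linkL α J)) = Y.map fL := by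
    rw [Subgroup.map_sup]
    conv_lhs =>
      congr
      · rw [← Subgroup.map_map, Subgroup.map_comap_eq_self_of_surjective hsL]
      · rw [hf, ← Subgroup.map_map, (Subgroup.map_eq_bot_iff _).mpr le_rfl, Subgroup.map_bot]
    rw [sup_bot_eq]
  have e2 : (Y₁.comap (linkR h) ⊔ (linkL α J).ker).map (fL.comp (linkL α J)) = Y₁.map fR := by
    rw [Subgroup.map_sup]
    conv_lhs =>
      congr
      · rw [hf, ← Subgroup.map_map, Subgroup.map_comap_eq_self_of_surjective hsR]
      · rw [← Subgroup.map_map, (Subgroup.map_eq_bot_iff _).mpr le_rfl, Subgroup.map_bot]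
    rw [sup_bot_eq]
  rw [imageMod, imageMod, Subgroup.map_map, Subgroup.map_map, Subgroup.map_map]
  change Y₁.map fR = Y.map fL
  rw [← e1, ← e2, hY]

end Quotients

end Assembly

end ModRep
-- The main theorem
theorem mainTheorem12 {p : ℕ} [Fact p.Prime] {n : ℕ} [NeZero n]
    {K : Type*} [Field K] [Algebra ℚ_[p] K] [Algebra.IsAlgebraic ℚ_[p] K]
    [IsCyclotomicExtension {n} ℚ_[p] K]
    {G : Type*} [Group G] [Finite G] (Z : Subgroup G) [Z.Normal]
    (lam : PReg p Z → K) (hlam : lam ∈ DefectZero p K Z)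
    (hn : Monoid.exponent G ∣ n)
    (hn₁ : Monoid.exponent (G ⧸ Z) * Nat.card (valueField p K lam)ˣ ∣ n)
    (Φ : Subgroup ((K ≃ₐ[ℚ_[p]] K) × MulAut G))
    (hInn : innSub p K G ≤ Φ) (hΦ : Φ ≤ stabSub p K Z)
    (hinv : ∀ a ∈ Φ, FixedBy a lam) :
    ∃ (G₁ : Type _) (_ : Group G₁) (_ : Finite G₁) (Z₁ : Subgroup G₁) (_ : Z₁.Normal)
      (lam₁ : PReg p Z₁ → K) (ω : Φ →* (K ≃ₐ[ℚ_[p]] K) × MulAut G₁)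
      (ε : G ⧸ Z ≃* G₁ ⧸ Z₁)
      (ν : ∀ J : Subgroup G, (PReg p J → K) → (PReg p (corr ε J) → K)),
      -- `Z₁` is a cyclic central `p'`-subgroup and `λ₁` is linear, faithful, `ω(Φ)`-invariant
      (IsCyclic Z₁ ∧ Z₁ ≤ Subgroup.center G₁ ∧ p.Coprime (Nat.card Z₁)) ∧
      (lam₁ ∈ IBr p K Z₁ ∧ IsFaithfulLinear p K lam₁) ∧
      ω.range ≤ stabSub p K Z₁ ∧
      (∀ a : Φ, FixedBy (ω a) lam₁) ∧
      -- (1)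
      Nat.card Z₁ = Nat.card (valueField p K lam)ˣ ∧
      -- (2)
      ((innSub p K G).subgroupOf Φ).map ω = innSub p K G₁ ∧
      (∀ a : Φ, (ω a).1 = a.1.1) ∧
      (∀ (a : Φ) (g : G) (g₁ : G₁),
        ε (QuotientGroup.mk g) = QuotientGroup.mk g₁ →
        ε (QuotientGroup.mk (a.1.2 g)) = QuotientGroup.mk ((ω a).2 g₁)) ∧
      -- (3)
      (∀ J : Subgroup G, Z ≤ J →
        Set.BijOn (ν J) (IBrOver p K J Z lam) (IBrOver p K (corr ε J) Z₁ lam₁)) ∧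
      -- (3a)
      (∀ J : Subgroup G, Z ≤ J → ∀ φ ∈ IBrOver p K J Z lam, ∀ a : Φ,
        twist a.1 J φ ∈ IBrOver p K (conjSub a.1 J) Z lam ∧
        Agree (twist (ω a) (corr ε J) (ν J φ)) (ν (conjSub a.1 J) (twist a.1 J φ))) ∧
      -- (3b)
      (∀ H : Subgroup G, Z ≤ H →
        ∃ L : Submodule.span ℤ (IBrOver p K H Z lam) →ₗ[ℤ] (PReg p (corr ε H) → K),
          (∀ (θ : PReg p H → K) (hθ : θ ∈ IBrOver p K H Z lam),
            L ⟨θ, Submodule.subset_span hθ⟩ = ν H θ) ∧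
          ∀ (J : Subgroup G) (hHJ : H ≤ J), ∀ φ ∈ IBrOver p K J Z lam,
            ∃ hφ : res hHJ φ ∈ Submodule.span ℤ (IBrOver p K H Z lam),
              res (corr_mono ε hHJ) (ν J φ) = L ⟨res hHJ φ, hφ⟩) ∧
      -- (3c)
      (∀ J : Subgroup G, Z ≤ J → ∀ φ ∈ IBrOver p K J Z lam, ∀ Y : Subgroup J,
        IsVertex p K φ Y → ∃ Y₁ : Subgroup (corr ε J), IsVertex p K (ν J φ) Y₁ ∧
          imageMod Z₁ Y₁ = (imageMod Z Y).map ε.toMonoidHom) := by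
  classical
  have : FiniteDimensional ℚ_[p] K := IsCyclotomicExtension.finiteDimensional {n} ℚ_[p] K
  obtain ⟨ζ, hζ⟩ := IsCyclotomicExtension.exists_isPrimitiveRoot ℚ_[p] K (Set.mem_singleton n)
    (NeZero.ne n)
  have hG : EnoughRoots K G :=
    ⟨n, Monoid.exponent G, NeZero.ne n, ⟨ζ, hζ⟩, hn, Monoid.pow_exponent_eq_one⟩
  obtain ⟨e, S, hS, rfl⟩ := mem_IBr_iff.mp hlam.1
  have hZ : EnoughRoots K Z := hG.subgroup Z
  have := hS.1
  have hstab : ∀ a ∈ Φ, Z.map a.2.toMonoidHom = Z := fun a ha => hΦ ha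
  obtain ⟨kk, hkk⟩ : ∃ kk, kk = valueField p K (matBr S) := ⟨_, rfl⟩
  obtain ⟨Γ, _, _, G₁, _, _, α, π, R, hL, hker, hker', hscal, hscal', hθ⟩ :=
    exists_fullLink kk S (span_range_eq_top hS (hS.schur_resF hZ))
      (fun z => hkk ▸ trace_mem_valueField hZ S z) fun g => by
        -- Invariance under the inner automorphisms in Φ supplies the matrix inducing conjugation by
        -- g.
        have ha : ((1 : K ≃ₐ[ℚ_[p]] K), MulAut.conj g) ∈ Φ := hInn ⟨rfl, g, rfl⟩
        obtain ⟨T, T', h1, h2, h3⟩ := exists_intertwiner_of_fixedBy hZ hS (hinv _ ha) (hstab _ ha)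
        refine ⟨T, T', h1, h2, fun z => ?_⟩
        have h4 := h3 z
        rw [map_one] at h4
        exact h4
  have hZmap : π.ker.map α = Z := by
    ext g
    constructor
    · rintro ⟨x, hx, rfl⟩
      obtain ⟨z, hz, -⟩ := hker x hx
      exact hz ▸ z.2
    · intro hg
      obtain ⟨x, hx, hxg⟩ := hker' ⟨g, hg⟩
      exact ⟨x, hx, hxg⟩
  obtain ⟨Z₁, hZ₁⟩ : ∃ Z₁, Z₁ = α.ker.map π := ⟨_, rfl⟩
  have hcent : Z₁ ≤ Subgroup.center G₁ := hZ₁ ▸ hL.le_center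
  have hnormal : Z₁.Normal := ⟨fun z hz g => by
    rw [Subgroup.mem_center_iff.mp (hcent hz) g, mul_inv_cancel_right]; exact hz⟩
  obtain ⟨ε, hε⟩ := exists_quotient_mulEquiv hL.surj_left hL.surj_right Z Z₁ hZmap hZ₁.symm
  subst hZ₁
  obtain ⟨Θ, hΘ⟩ := hL.exists_hom (galRes.comp ((MonoidHom.fst _ _).comp Φ.subtype))
    ((MonoidHom.snd _ _).comp Φ.subtype) fun a => by
      refine hθ (galRes a.1.1) a.1.2 (autRestrict a.1.2 (hstab _ a.2)) (fun c hc => ?_)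
        (fun z => rfl) (autRestrict_surjective _ _)
        (exists_intertwiner_of_fixedBy hZ hS (hinv _ a.2) (hstab _ a.2))
      rw [hkk] at hc ⊢
      exact galRes_mem_valueField (fun g => (hinv _ a.2).apply (hstab _ a.2) g) hc
  obtain ⟨Ψ, hΨ⟩ := exists_hom_of_surjective hL.surj_right Θ fun a => (hΘ a).2.1
  let ω : Φ →* (K ≃ₐ[ℚ_[p]] K) × MulAut G₁ := ((MonoidHom.fst _ _).comp Φ.subtype).prod Ψ
  obtain ⟨S₁, hS₁inj, hS₁⟩ := hL.exists_linear kk hscal hscal'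
  obtain ⟨eU, -⟩ := hL.exists_units_equiv kk hscal hscal'
  have hcard : Nat.card (α.ker.map π) = Nat.card (valueField p K (matBr S))ˣ := by
    rw [← hkk]; exact (Nat.card_congr eU.toEquiv).symm
  -- The power of any element of G₁ with exponent exp(G/Z) lies in Z₁, whose order is |𝔽_p(λ)^×|.
  -- Hence the product of these numbers kills G₁, and it divides n.
  have hG₁ : EnoughRoots K G₁ := by
    refine ⟨n, _, NeZero.ne n, ⟨ζ, hζ⟩, hn₁, fun y => ?_⟩
    obtain ⟨x, rfl⟩ := hL.surj_right y
    have h1 : (π x) ^ Monoid.exponent (G ⧸ Z) ∈ α.ker.map π := by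
      rw [← QuotientGroup.eq_one_iff, QuotientGroup.mk_pow, ← hε, ← map_pow,
        Monoid.pow_exponent_eq_one, map_one]
    rw [pow_mul, ← hcard]
    exact congrArg Subtype.val (pow_card_eq_one' (x := (⟨_, h1⟩ : α.ker.map π)))
  have hstab₁ : ∀ a : Φ, conjSub (ω a) (α.ker.map π) ≤ α.ker.map π := by
    rintro a _ ⟨_, ⟨x, hx, rfl⟩, rfl⟩
    refine ⟨Θ a x, ?_, (hΨ a x).symm⟩
    change α (Θ a x) = 1
    rw [(hΘ a).1, MonoidHom.mem_ker.mp hx, map_one]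
  have hstab₁' : ∀ a : Φ, conjSub (ω a) (α.ker.map π) = α.ker.map π := fun a => by
    refine le_antisymm (hstab₁ a) fun y hy => ⟨Ψ a⁻¹ y, hstab₁ a⁻¹ ⟨y, hy, rfl⟩, ?_⟩
    change Ψ a (Ψ a⁻¹ y) = y
    rw [← MulAut.mul_apply, ← map_mul, mul_inv_cancel, map_one, MulAut.one_apply]
  -- Conjugation by x in Γ is a compatible lift of conjugation by α(x), so by uniqueness it is the
  -- lift. This gives the equality of inner automorphism groups.
  have hconj : ∀ (a : Φ) (x : Γ), (a : (K ≃ₐ[ℚ_[p]] K) × MulAut G) = (1, MulAut.conj (α x)) →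
      ω a = (1, MulAut.conj (π x)) := fun a x hax => by
    have h1 : Θ a = MulAut.conj x := hL.compat_unique (hΘ a) (by
      change LinkCompat α π R (galRes a.1.1) a.1.2 _
      rw [hax, map_one]
      exact LinkCompat.conj x)
    have h0 : a.1.1 = 1 := congrArg Prod.fst hax
    refine Prod.ext h0 (MulEquiv.ext fun y => ?_)
    obtain ⟨w, rfl⟩ := hL.surj_right y
    change Ψ a (π w) = MulAut.conj (π x) (π w)
    rw [hΨ, h1, MulAut.conj_apply, MulAut.conj_apply, map_mul, map_mul, map_inv]
  have hcorr : ∀ J : Subgroup G, Z ≤ J → ∀ x, π x ∈ corr ε J ↔ α x ∈ J := fun J hJ =>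
    mem_corr_iff hε hJ
  -- To have a map on all functions, ν takes the value 0 where no corresponding character exists;
  -- only its values on characters over λ matter.
  have hνex : ∀ (J : Subgroup G) (χ : PReg p J → K), ∃ χ₁ : PReg p (corr ε J) → K,
      ∀ hJ : Z ≤ J, (∃ χ₁', BrCorr R (hcorr J hJ) χ χ₁') → BrCorr R (hcorr J hJ) χ χ₁ := by
    intro J χ
    by_cases hJ : ∃ hJ : Z ≤ J, ∃ χ₁', BrCorr R (hcorr J hJ) χ χ₁'
    · obtain ⟨hJ, χ₁, hχ⟩ := hJ
      exact ⟨χ₁, fun _ _ => hχ⟩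
    · exact ⟨0, fun hJ' h => (hJ ⟨hJ', h⟩).elim⟩
  choose ν hν' using hνex
  have hZ₁R : EnoughRoots K (α.ker.map π) := hG₁.subgroup _
  have hS₁irr : MatIrr S₁ := matIrr_fin_one S₁
  have hν : ∀ (J : Subgroup G) (hJ : Z ≤ J) (χ : PReg p J → K),
      χ ∈ IBrOver p K J Z (matBr S) → BrCorr R (hcorr J hJ) χ (ν J χ) := fun J hJ χ hχ =>
    hν' J χ hJ (BrCorr.exists_right hL.toTripleLink hZ hS hker hχ)
  have hνeq : ∀ (J : Subgroup G) (hJ : Z ≤ J) (χ : PReg p J → K) (χ₁ : PReg p (corr ε J) → K),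
      BrCorr R (hcorr J hJ) χ χ₁ → ν J χ = χ₁ := fun J hJ χ χ₁ h =>
    (hν' J χ hJ ⟨_, h⟩).unique_right hL.toTripleLink (hG.subgroup J) h
  refine ⟨G₁, inferInstance, inferInstance, α.ker.map π, hnormal, matBr S₁, ω, ε, ν,
    ⟨?_, hcent, ?_⟩, ⟨hS₁irr.matBr_mem_IBr, toRep S₁, ?_, ?_⟩, ?_, fun a => ⟨hstab₁' a, ?_⟩, hcard,
    ?_, fun a => rfl, ?_, ?_, ?_, ?_, ?_⟩
  · exact isCyclic_of_surjective eU eU.surjective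
  · have := Fintype.ofFinite kk
    rw [← Nat.card_congr eU.toEquiv]
    -- |k^×| + 1 is a positive power of p, so p does not divide |k^×|.
    have h1 : Nat.card kkˣ + 1 = Nat.card kk := by
      rw [Nat.card_units]
      exact Nat.sub_add_cancel Nat.card_pos
    have h2 : p ∣ Nat.card kk := by
      obtain ⟨m, -, hm⟩ := FiniteField.card kk p
      rw [Nat.card_eq_fintype_card, hm]
      exact dvd_pow_self p m.ne_zero
    rw [Nat.Prime.coprime_iff_not_dvd Fact.out]
    intro h3
    rw [← h1, Nat.dvd_add_right h3, Nat.dvd_one] at h2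
    exact (Fact.out : p.Prime).one_lt.ne' h2
  · intro z w hzw
    refine hS₁inj ?_
    have h1 : Matrix.toLin' (S₁ z) = Matrix.toLin' (S₁ w) := hzw
    exact Matrix.toLin'.injective h1
  · rw [brauerChar_eq_matBr, toMat_toRep]
  · rintro _ ⟨a, rfl⟩
    exact hstab₁' a
  · intro x y hxy
    obtain ⟨w, hw⟩ : ∃ w, w = x.map ((ω a).2.subgroupMap (α.ker.map π)).symm.toMonoidHom :=
      ⟨_, rfl⟩
    have hwx : (ω a).2 (w.1 : G₁) = x.1 := by
      rw [hw]
      exact congrArg Subtype.val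
        (((ω a).2.subgroupMap (α.ker.map π)).apply_symm_apply x.1)
    rw [ModRep.twist, ← hw]
    obtain ⟨u, hu, huw⟩ := w.1.2
    obtain ⟨c, -, hc⟩ := hscal u hu
    have h1 := hS₁ u hu c hc w.1 huw.symm
    have h2 : Θ a u ∈ α.ker := by
      rw [MonoidHom.mem_ker, (hΘ a).1, MonoidHom.mem_ker.mp hu, map_one]
    have h3 := hS₁ (Θ a u) h2 _ ((hΘ a).map_smul_one hc) y.1 (by
      rw [← hxy, ← hwx, ← huw]; exact hΨ a u)
    -- The lift sends the scalar c in ker α to σ(c), so the inverse scalar c⁻¹ giving λ₁ is sent to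
    -- σ(c)⁻¹; this is the invariance of λ₁.
    have h4 : S₁ y.1 = matTwist (galRes a.1.1) S₁ w.1 := by
      rw [matTwist_apply, h1, h3]
      ext i j
      simp [Matrix.one_apply, apply_ite (galRes a.1.1)]
    change a.1.1 (matBr S₁ w) = matBr S₁ y
    rw [← hZ₁R.matBr_twist, matBr, matBr, h4]
  · ext b
    constructor
    · rintro ⟨a, ha, rfl⟩
      obtain ⟨h1, g, hg⟩ := ha
      obtain ⟨x, rfl⟩ := hL.surj_left g
      rw [hconj a x (Prod.ext h1 hg.symm)]
      exact ⟨rfl, π x, rfl⟩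
    · rintro ⟨h1, y, hy⟩
      obtain ⟨x, rfl⟩ := hL.surj_right y
      have ha : ((1 : K ≃ₐ[ℚ_[p]] K), MulAut.conj (α x)) ∈ innSub p K G := ⟨rfl, α x, rfl⟩
      refine ⟨⟨_, hInn ha⟩, ha, ?_⟩
      rw [hconj _ x rfl]
      exact Prod.ext (Subgroup.mem_bot.mp h1).symm hy
  · intro a g g₁ hgg
    obtain ⟨x, rfl⟩ := hL.surj_left g
    have h1 := (hΘ a).1 x
    change α (Θ a x) = a.1.2 (α x) at h1
    rw [← h1, hε, ← hΨ]
    rw [hε, QuotientGroup.eq] at hgg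
    rw [QuotientGroup.eq]
    change (Ψ a (π x))⁻¹ * Ψ a g₁ ∈ _
    rw [← map_inv, ← map_mul]
    exact hstab₁ a ⟨_, hgg, rfl⟩
  · intro J hJ
    refine ⟨fun χ hχ => ?_, fun χ hχ χ' hχ' h => ?_, fun χ₁ hχ₁ => ?_⟩
    · exact (hν J hJ χ hχ).mem_right hL.toTripleLink hZ₁R hS₁irr hS₁
    · have h1 := hν J hJ χ hχ
      rw [h] at h1
      exact h1.unique_left hL.toTripleLink (hG₁.subgroup _) (hν J hJ χ' hχ')
    · obtain ⟨χ, hχ⟩ := BrCorr.exists_left (h := hcorr J hJ) hL.toTripleLink hcent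
        (hG₁.subgroup _) hZ₁R hS₁irr hS₁ hχ₁
      exact ⟨χ, hχ.mem_left hL.toTripleLink hZ hS hker hker', hνeq J hJ χ χ₁ hχ⟩
  · intro J hJ φ hφ a
    have hJa : Z ≤ conjSub a.1 J := by
      conv_lhs => rw [← hstab _ a.2]
      exact Subgroup.map_mono hJ
    have h' : ∀ x, π x ∈ conjSub (ω a) (corr ε J) ↔ α x ∈ conjSub a.1 J := fun y => by
      obtain ⟨x, rfl⟩ := (Θ a).surjective y
      have h1 : α (Θ a x) = a.1.2 (α x) := (hΘ a).1 x
      have h2 : π (Θ a x) = (ω a).2 (π x) := (hΨ a x).symm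
      rw [h1, h2, mem_conjSub_iff, mem_conjSub_iff, hcorr J hJ]
    have h1 := (hν J hJ φ hφ).twist (hG.subgroup J) (hG₁.subgroup _) a.1 (ω a) rfl (hΘ a)
      (hΨ a) h'
    have h2 := h1.mem_left hL.toTripleLink hZ hS hker hker'
    exact ⟨h2, h1.agree hL.toTripleLink (hG.subgroup _) (hν _ hJa _ h2)⟩
  · intro H hH
    have hsub : IBrOver p K H Z (matBr S) ⊆ IBr p K H := by
      rintro _ ⟨d, ρ, -, -, -, hρ, rfl, -⟩
      exact ⟨d, ρ, hρ, rfl⟩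
    -- Characters over λ are among the linearly independent irreducible Brauer characters, so ν
    -- extends ℤ-linearly to their span.
    obtain ⟨L, hLν⟩ := exists_linearMap_span
      ((linearIndependent_IBr (hG.subgroup H)).comp (Set.inclusion hsub)
        (Set.inclusion_injective hsub)) (ν H)
    refine ⟨L, hLν, fun J hHJ φ hφ => ?_⟩
    -- The property carried through the composition factors is that the left function lies in the
    -- span and `L` sends it to the right function. It is additive and holds for corresponding
    -- irreducible pairs.
    refine (hν J (hH.trans hHJ) φ hφ).res_induction hL.toTripleLink (hcorr H hH) hHJ
      (corr_mono ε hHJ)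
      (motive := fun f g => ∃ hf : f ∈ Submodule.span ℤ (IBrOver p K H Z (matBr S)), g = L ⟨f, hf⟩)
      ⟨zero_mem _, (map_zero L).symm⟩ ?_ ?_
    · rintro f g f' g' ⟨hf, rfl⟩ ⟨hf', rfl⟩
      exact ⟨add_mem hf hf', (map_add L ⟨f, hf⟩ ⟨f', hf'⟩).symm⟩
    · intro f g hfg
      have hf := hfg.mem_left hL.toTripleLink hZ hS hker hker'
      exact ⟨Submodule.subset_span hf, by rw [hLν f hf, hνeq H hH f g hfg]⟩
  · intro J hJ φ hφ Y hY
    obtain ⟨Y₁, hY₁, hYY⟩ := (hν J hJ φ hφ).exists_vertex hL.toTripleLink (hG.subgroup J)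
      (hG₁.subgroup _) hY
    exact ⟨Y₁, hY₁, imageMod_eq hε hL.surj_left hL.surj_right (hcorr J hJ) hYY⟩
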